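/- Let $d\in\{2,3\}$ and let $\Omega\subset\mathbb R^d$ be a polyhedral Lipschitz domain subdivided into two polyhedral Lipschitz subdomains $\Omega_S,\Omega_D$ with interface $\Sigma=\partial\Omega_S\cap\partial\Omega_D$; put $\Gamma_\circ=\partial\Omega_\circ\setminus\Sigma$ for $\circ\in\{S,D\}$, and let $\nu$ be the unit normal on $\Sigma$ pointing from $\Omega_S$ to $\Omega_D$. Let $$\mathbf H^1_S(\Omega_S)=\{\mathbf u\in H^1(\Omega_S)^d:\mathbf u=0\text{ on }\Gamma_S\},\qquad \mathbf H_D(\mathrm{div},\Omega_D)=\{\mathbf u\in\mathbf H(\mathrm{div},\Omega_D):\mathbf u\cdot\nu=0\text{ on }\Gamma_D\},$$ $$\mathbb X=\{(\mathbf u_S,\mathbf u_D)\in\mathbf H^1_S(\Omega_S)\times\mathbf H_D(\mathrm{div},\Omega_D):\mathbf u_S\cdot\nu=\mathbf u_D\cdot\nu\text{ on }\Sigma\},\qquad \|\mathbf u\|_{\mathbb X}^2=\|\mathbf u_S\|^2_{\mathbf H^1(\Omega_S)}+\|\mathbf u_D\|^2_{\mathbf H(\mathrm{div},\Omega_D)}.$$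 Let $H^{1/2}_{00}(\Sigma)$ be the space of functions on $\Sigma$ whose extension by zero to $\partial\Omega_D$ lies in $H^{1/2}(\partial\Omega_D)$ (the space of traces of $H^1(\Omega_D)$, with the image norm), with the norm of the extension, and let $H^{-1/2}_{00}(\Sigma)$ be its dual with respect to the pivot space $L^2(\Sigma)$. Let $h>0$ range over an arbitrary index family of discretization parameters. For each $h$ let $\mathcal T^h_S,\mathcal T^h_D$ be conforming simplicial triangulations of $\overline\Omega_S,\overline\Omega_D$, with all elements of diameter at most $h$, each inducing a partition of $\Sigma$ into element faces (denoted $\Sigma^h_D$ for $\mathcal T_D^h$), both families being shape-regular. Let $\mathbf H^h(\Omega_S)\subset H^1(\Omega_S)^d$ and $\mathbf H^h(\Omega_D)\subset\mathbf H(\mathrm{div},\Omega_D)$ be finite-dimensional spaces of piecewise polynomial fields on these triangulations. Put $\mathbf H^h_S(\Omega_S)=\mathbf H^h(\Omega_S)\cap\mathbf H^1_S(\Omega_S)$, $\mathbf H^h_D(\Omega_D)=\mathbf H^h(\Omega_D)\cap\mathbf H_D(\mathrm{div},\Omega_D)$ and $\Phi^h_\circ=\{\mathbf u_h\cdot\nu|_\Sigma:\mathbf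 u_h\in\mathbf H^h_\circ(\Omega_\circ)\}\subset L^2(\Sigma)$. Assume that $\Phi^h_D$ contains all functions that are constant on each face of $\Sigma^h_D$; let $R^h_D$ be the $L^2(\Sigma)$-orthogonal projection onto $\Phi^h_D$, and $$\mathbb X^h=\{(\mathbf u^h_S,\mathbf u^h_D)\in\mathbf H^h_S(\Omega_S)\times\mathbf H^h_D(\Omega_D):\mathbf u^h_D\cdot\nu=R^h_D(\mathbf u^h_S\cdot\nu)\text{ on }\Sigma\}.$$ Assume that there is a stable lifting of the normal trace: there are $C_L>0$ and, for every $h$, a linear map $\mathbf L^h:\Phi^h_D\to\mathbf H^h_D(\Omega_D)$ such that $(\mathbf L^h\phi)\cdot\nu=\phi$ on $\Sigma$ and $\|\mathbf L^h\phi\|_{\mathbf H(\mathrm{div},\Omega_D)}\le C_L\|\phi\|_{H^{-1/2}_{00}(\Sigma)}$ for all $\phi\in\Phi^h_D$. Then there are a constant $C>0$, independent of $h$, and numbers $0\le\lambda(h)\le C\,h^{1/2}$, with $\lambda(h)=0$ whenever $\Phi^h_S\subset\Phi^h_D$, such that for all $h$ and all $\mathbf u=(\mathbf u_S,\mathbf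 u_D)\in\mathbb X$ $$\inf_{\mathbf v_h\in\mathbb X^h}\|\mathbf u-\mathbf v_h\|_{\mathbb X}\le C\Big(\inf_{\mathbf u^h_S\in\mathbf H^h_S(\Omega_S)}\|\mathbf u_S-\mathbf u^h_S\|_{\mathbf H^1(\Omega_S)}+\inf_{\mathbf u^h_D\in\mathbf H^h_D(\Omega_D)}\|\mathbf u_D-\mathbf u^h_D\|_{\mathbf H(\mathrm{div},\Omega_D)}+\lambda(h)\,\|\mathbf u_S\cdot\nu-R^h_D(\mathbf u_S\cdot\nu)\|_{L^2(\Sigma)}\Big),$$ where the norm of $\mathbf u-\mathbf v_h$ is that of the product space $\mathbf H^1_S(\Omega_S)\times\mathbf H_D(\mathrm{div},\Omega_D)$. -/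

import Mathlib

open MeasureTheory Set Filter Topology
open scoped ContDiff

noncomputable section

namespace StokesDarcy

/-! ### Domains -/

/-- `O` is a Lipschitz domain: open, connected, bounded, and near every boundary point `x` it is the
strict epigraph, in some unit direction `e`, of a Lipschitz function of the variables orthogonal
to `e` (that is, of a Lipschitz function on the whole space that is invariant along `e`). -/
structure IsLipschitzDomain {d : ℕ} (O : Set (EuclideanSpace ℝ (Fin d))) : Prop where
  isOpen : IsOpen O
  isConnected : IsConnected O
  isBounded : Bornology.IsBounded O
  graph : ∀ x ∈ frontier O, ∃ (e : EuclideanSpace ℝ (Fin d)) (K : NNReal)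
    (f : EuclideanSpace ℝ (Fin d) → ℝ) (r : ℝ), ‖e‖ = 1 ∧ LipschitzWith K f ∧
      (∀ y, ∀ t : ℝ, f (y + t • e) = f y) ∧ 0 < r ∧
      ∀ y ∈ Metric.ball x r, y ∈ O ↔ f y < inner ℝ y e

/-- A Lipschitz domain is polyhedral if its boundary lies in a finite union of hyperplanes. -/
structure IsPolyhedralLipschitzDomain {d : ℕ} (O : Set (EuclideanSpace ℝ (Fin d))) : Prop
    extends IsLipschitzDomain O where
  flat : ∃ P : Finset (EuclideanSpace ℝ (Fin d) × ℝ), (∀ p ∈ P, p.1 ≠ 0) ∧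
    frontier O ⊆ ⋃ p ∈ P, {x | inner ℝ p.1 x = p.2}

/-- The interface `Σ` of two adjacent subdomains: the common part of their boundaries. -/
def interface {d : ℕ} (ΩS ΩD : Set (EuclideanSpace ℝ (Fin d))) :
    Set (EuclideanSpace ℝ (Fin d)) :=
  frontier ΩS ∩ frontier ΩD

/-- The polyhedral Lipschitz domain `Ω` is subdivided into the two polyhedral Lipschitz subdomains
`ΩS` (Stokes) and `ΩD` (Darcy), separated by their interface. -/
structure IsSubdivision {d : ℕ} (Ω ΩS ΩD : Set (EuclideanSpace ℝ (Fin d))) : Prop where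
  whole : IsPolyhedralLipschitzDomain Ω
  stokes : IsPolyhedralLipschitzDomain ΩS
  darcy : IsPolyhedralLipschitzDomain ΩD
  disjoint : Disjoint ΩS ΩD
  stokes_subset : ΩS ⊆ Ω
  darcy_subset : ΩD ⊆ Ω
  closure_eq : closure Ω = closure ΩS ∪ closure ΩD

/-- `n` is the outward unit normal of `O` at `x`, where the boundary is flat near `x`. -/
def IsOuterNormalAt {d : ℕ} (O : Set (EuclideanSpace ℝ (Fin d)))
    (x n : EuclideanSpace ℝ (Fin d)) : Prop :=
  ‖n‖ = 1 ∧ ∃ r > 0, ∀ y ∈ Metric.ball x r, y ∈ O ↔ inner ℝ (y - x) n < 0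

open Classical in
/-- The outward unit normal field of a polyhedral domain. It is defined at almost every boundary
point (the interior points of the flat faces); the value `0` elsewhere plays no role. -/
def outerNormal {d : ℕ} (O : Set (EuclideanSpace ℝ (Fin d))) (x : EuclideanSpace ℝ (Fin d)) :
    EuclideanSpace ℝ (Fin d) :=
  if h : ∃ n, IsOuterNormalAt O x n then h.choose else 0

/-! ### Lebesgue and Sobolev spaces -/

/-- Surface measure on a subset `S` of a hypersurface of `ℝ^d`: the `(d-1)`-dimensional Hausdorff
measure, normalised as area, restricted to `S`. -/
abbrev surface {d : ℕ} (S : Set (EuclideanSpace ℝ (Fin d))) :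
    Measure (EuclideanSpace ℝ (Fin d)) :=
  (Measure.euclideanHausdorffMeasure (d - 1)).restrict S

/-- `L²(S)` with respect to surface measure. -/
abbrev L2S {d : ℕ} (S : Set (EuclideanSpace ℝ (Fin d))) : Type :=
  Lp ℝ 2 (surface S)

/-- `L²(O)`, scalar functions. -/
abbrev L2 {d : ℕ} (O : Set (EuclideanSpace ℝ (Fin d))) : Type :=
  Lp ℝ 2 (volume.restrict O)

/-- `L²(O)^d`, vector fields. -/
abbrev L2V {d : ℕ} (O : Set (EuclideanSpace ℝ (Fin d))) : Type :=
  Lp (EuclideanSpace ℝ (Fin d)) 2 (volume.restrict O)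

/-- Test functions: smooth, with compact support contained in `O`. -/
structure IsTest {d : ℕ} (O : Set (EuclideanSpace ℝ (Fin d)))
    (φ : EuclideanSpace ℝ (Fin d) → ℝ) : Prop where
  smooth : ContDiff ℝ ∞ φ
  compact : HasCompactSupport φ
  support : tsupport φ ⊆ O

theorem continuous_gradient {d : ℕ} {φ : EuclideanSpace ℝ (Fin d) → ℝ}
    (h : ContDiff ℝ ∞ φ) : Continuous (gradient φ) :=
  (InnerProductSpace.toDual ℝ (EuclideanSpace ℝ (Fin d))).symm.continuous.comp
    (h.continuous_fderiv (by simp))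

theorem compact_gradient {d : ℕ} {φ : EuclideanSpace ℝ (Fin d) → ℝ}
    (h : HasCompactSupport φ) : HasCompactSupport (gradient φ) :=
  (h.fderiv ℝ).comp_left
    (g := (InnerProductSpace.toDual ℝ (EuclideanSpace ℝ (Fin d))).symm) (map_zero _)

/-- `H¹(O)`. An element is a function in `L²(O)` together with its weak gradient in `L²(O)^d`
(which it determines); the norm is `(‖u‖² + ‖∇u‖²)^{1/2}`. -/
def H1 {d : ℕ} (O : Set (EuclideanSpace ℝ (Fin d))) :
    Submodule ℝ (WithLp 2 (L2 O × L2V O)) where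
  carrier := {u | ∀ φ, IsTest O φ →
    ∫ x in O, u.fst x • gradient φ x = - ∫ x in O, φ x • u.snd x}
  zero_mem' := by
    intro φ _
    have h1 : ∫ x in O, ((0 : WithLp 2 (L2 O × L2V O)).fst x) • gradient φ x = 0 := by
      refine integral_eq_zero_of_ae ?_
      filter_upwards [Lp.coeFn_zero ℝ 2 (volume.restrict O)] with x hx
      simp only [WithLp.zero_fst, hx, Pi.zero_apply, zero_smul]
    have h2 : ∫ x in O, φ x • ((0 : WithLp 2 (L2 O × L2V O)).snd x) = 0 := by
      refine integral_eq_zero_of_ae ?_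
      filter_upwards [Lp.coeFn_zero (EuclideanSpace ℝ (Fin d)) 2 (volume.restrict O)] with x hx
      simp only [WithLp.zero_snd, hx, Pi.zero_apply, smul_zero]
    rw [h1, h2, neg_zero]
  add_mem' := by
    intro u v hu hv φ hφ
    have hg : MemLp (gradient φ) 2 (volume.restrict O) :=
      (continuous_gradient hφ.smooth).memLp_of_hasCompactSupport (compact_gradient hφ.compact)
    have hp : MemLp φ 2 (volume.restrict O) :=
      hφ.smooth.continuous.memLp_of_hasCompactSupport hφ.compact
    have i1 : ∀ w : L2 O, Integrable (fun x => w x • gradient φ x) (volume.restrict O) :=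
      fun w => memLp_one_iff_integrable.1 (hg.smul (Lp.memLp w))
    have i2 : ∀ w : L2V O, Integrable (fun x => φ x • w x) (volume.restrict O) :=
      fun w => memLp_one_iff_integrable.1 ((Lp.memLp w).smul hp)
    have h1 : ∫ x in O, ((u + v).fst x) • gradient φ x
        = ∫ x in O, (u.fst x • gradient φ x + v.fst x • gradient φ x) := by
      refine integral_congr_ae ?_
      filter_upwards [Lp.coeFn_add u.fst v.fst] with x hx
      simp only [WithLp.add_fst, hx, Pi.add_apply, add_smul]
    have h2 : ∫ x in O, φ x • ((u + v).snd x)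
        = ∫ x in O, (φ x • u.snd x + φ x • v.snd x) := by
      refine integral_congr_ae ?_
      filter_upwards [Lp.coeFn_add u.snd v.snd] with x hx
      simp only [WithLp.add_snd, hx, Pi.add_apply, smul_add]
    rw [h1, h2, integral_add (i1 _) (i1 _), integral_add (i2 _) (i2 _), hu φ hφ, hv φ hφ]
    abel
  smul_mem' := by
    intro c u hu φ hφ
    have h1 : ∫ x in O, ((c • u).fst x) • gradient φ x
        = ∫ x in O, c • (u.fst x • gradient φ x) := by
      refine integral_congr_ae ?_
      filter_upwards [Lp.coeFn_smul c u.fst] with x hx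
      simp only [WithLp.smul_fst, hx, Pi.smul_apply, smul_eq_mul, mul_smul]
    have h2 : ∫ x in O, φ x • ((c • u).snd x) = ∫ x in O, c • (φ x • u.snd x) := by
      refine integral_congr_ae ?_
      filter_upwards [Lp.coeFn_smul c u.snd] with x hx
      simp only [WithLp.smul_snd, hx, Pi.smul_apply]
      exact smul_comm _ _ _
    rw [h1, h2, integral_smul, integral_smul, hu φ hφ, smul_neg]

/-- `H(div, O)`. An element is a field in `L²(O)^d` together with its weak divergence in `L²(O)`
(which it determines); the norm is `(‖v‖² + ‖div v‖²)^{1/2}`. -/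
def Hdiv {d : ℕ} (O : Set (EuclideanSpace ℝ (Fin d))) :
    Submodule ℝ (WithLp 2 (L2V O × L2 O)) where
  carrier := {v | ∀ φ, IsTest O φ →
    ∫ x in O, inner ℝ (v.fst x) (gradient φ x) = - ∫ x in O, φ x * v.snd x}
  zero_mem' := by
    intro φ _
    have h1 : ∫ x in O, inner ℝ ((0 : WithLp 2 (L2V O × L2 O)).fst x) (gradient φ x) = 0 := by
      refine integral_eq_zero_of_ae ?_
      filter_upwards [Lp.coeFn_zero (EuclideanSpace ℝ (Fin d)) 2 (volume.restrict O)] with x hx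
      simp only [WithLp.zero_fst, hx, Pi.zero_apply, inner_zero_left]
    have h2 : ∫ x in O, φ x * ((0 : WithLp 2 (L2V O × L2 O)).snd x) = 0 := by
      refine integral_eq_zero_of_ae ?_
      filter_upwards [Lp.coeFn_zero ℝ 2 (volume.restrict O)] with x hx
      simp only [WithLp.zero_snd, hx, Pi.zero_apply, mul_zero]
    rw [h1, h2, neg_zero]
  add_mem' := by
    intro u v hu hv φ hφ
    have hg : MemLp (gradient φ) 2 (volume.restrict O) :=
      (continuous_gradient hφ.smooth).memLp_of_hasCompactSupport (compact_gradient hφ.compact)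
    have hp : MemLp φ 2 (volume.restrict O) :=
      hφ.smooth.continuous.memLp_of_hasCompactSupport hφ.compact
    have i1 : ∀ w : L2V O,
        Integrable (fun x => inner ℝ (w x) (gradient φ x)) (volume.restrict O) :=
      fun w => by
        refine (L2.integrable_inner (𝕜 := ℝ) w hg.toLp).congr ?_
        filter_upwards [hg.coeFn_toLp] with x hx
        rw [hx]
    have i2 : ∀ w : L2 O, Integrable (fun x => φ x * w x) (volume.restrict O) :=
      fun w => hp.integrable_mul (Lp.memLp w)
    have h1 : ∫ x in O, inner ℝ ((u + v).fst x) (gradient φ x)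
        = ∫ x in O, (inner ℝ (u.fst x) (gradient φ x) + inner ℝ (v.fst x) (gradient φ x)) := by
      refine integral_congr_ae ?_
      filter_upwards [Lp.coeFn_add u.fst v.fst] with x hx
      simp only [WithLp.add_fst, hx, Pi.add_apply, inner_add_left]
    have h2 : ∫ x in O, φ x * ((u + v).snd x)
        = ∫ x in O, (φ x * u.snd x + φ x * v.snd x) := by
      refine integral_congr_ae ?_
      filter_upwards [Lp.coeFn_add u.snd v.snd] with x hx
      simp only [WithLp.add_snd, hx, Pi.add_apply, mul_add]
    rw [h1, h2, integral_add (i1 _) (i1 _), integral_add (i2 _) (i2 _), hu φ hφ, hv φ hφ]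
    ring
  smul_mem' := by
    intro c u hu φ hφ
    have h1 : ∫ x in O, inner ℝ ((c • u).fst x) (gradient φ x)
        = ∫ x in O, c * inner ℝ (u.fst x) (gradient φ x) := by
      refine integral_congr_ae ?_
      filter_upwards [Lp.coeFn_smul c u.fst] with x hx
      simp only [WithLp.smul_fst, hx, Pi.smul_apply, real_inner_smul_left]
    have h2 : ∫ x in O, φ x * ((c • u).snd x) = ∫ x in O, c * (φ x * u.snd x) := by
      refine integral_congr_ae ?_
      filter_upwards [Lp.coeFn_smul c u.snd] with x hx
      simp only [WithLp.smul_snd, hx, Pi.smul_apply, smul_eq_mul]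
      ring
    rw [h1, h2, integral_const_mul, integral_const_mul, hu φ hφ, mul_neg]

/-- `H¹(O)^d`, with the product norm. -/
abbrev H1V {d : ℕ} (O : Set (EuclideanSpace ℝ (Fin d))) : Type :=
  PiLp 2 (fun _ : Fin d => H1 O)

/-! ### Traces -/

/-- The graph of the restriction `φ ↦ φ|_{∂O}` on functions smooth up to the boundary, as a subspace
of `H¹(O) × L²(∂O)`. -/
def smoothGraph {d : ℕ} (O : Set (EuclideanSpace ℝ (Fin d))) :
    Submodule ℝ (H1 O × L2S (frontier O)) where
  carrier := {p | ∃ φ : EuclideanSpace ℝ (Fin d) → ℝ, ContDiff ℝ ∞ φ ∧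
    p.1.1.fst =ᵐ[volume.restrict O] φ ∧ p.1.1.snd =ᵐ[volume.restrict O] gradient φ ∧
    p.2 =ᵐ[surface (frontier O)] φ}
  zero_mem' := by
    refine ⟨0, contDiff_const, Lp.coeFn_zero _ _ _, ?_, Lp.coeFn_zero _ _ _⟩
    filter_upwards [Lp.coeFn_zero (EuclideanSpace ℝ (Fin d)) 2 (volume.restrict O)] with x hx
    simpa [gradient] using hx
  add_mem' := by
    rintro p q ⟨φ, hφ, h1, h2, h3⟩ ⟨ψ, hψ, k1, k2, k3⟩
    refine ⟨φ + ψ, hφ.add hψ, ?_, ?_, ?_⟩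
    · exact (Lp.coeFn_add p.1.1.fst q.1.1.fst).trans (h1.add k1)
    · refine (Lp.coeFn_add p.1.1.snd q.1.1.snd).trans ((h2.add k2).trans ?_)
      refine Eventually.of_forall fun x => ?_
      simp only [Pi.add_apply, gradient]
      rw [fderiv_add (hφ.differentiable (by simp) x) (hψ.differentiable (by simp) x), map_add]
    · exact (Lp.coeFn_add p.2 q.2).trans (h3.add k3)
  smul_mem' := by
    rintro c p ⟨φ, hφ, h1, h2, h3⟩
    refine ⟨c • φ, hφ.const_smul c, ?_, ?_, ?_⟩
    · exact (Lp.coeFn_smul c p.1.1.fst).trans (h1.const_smul c)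
    · refine (Lp.coeFn_smul c p.1.1.snd).trans ((h2.const_smul c).trans ?_)
      refine Eventually.of_forall fun x => ?_
      simp only [Pi.smul_apply, gradient]
      rw [fderiv_const_smul (hφ.differentiable (by simp) x)]
      simp
    · exact (Lp.coeFn_smul c p.2).trans (h3.const_smul c)

/-- `g ∈ L²(∂O)` is the trace of `w ∈ H¹(O)`. The trace operator is the closure (for bounded
Lipschitz `O`, the continuous extension) of the restriction of smooth functions to `∂O`. -/
def HasTrace {d : ℕ} (O : Set (EuclideanSpace ℝ (Fin d))) (w : H1 O)
    (g : L2S (frontier O)) : Prop :=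
  (w, g) ∈ (smoothGraph O).topologicalClosure

/-- The field `u ∈ H¹(ΩS)^d` vanishes on `ΓS = ∂ΩS ∖ Σ`: this is the space `H¹_S(ΩS)`. -/
def H1S {d : ℕ} (ΩS ΩD : Set (EuclideanSpace ℝ (Fin d))) : Set (H1V ΩS) :=
  {u | ∃ t : Fin d → L2S (frontier ΩS), ∀ j, HasTrace ΩS (u j) (t j) ∧
    ∀ᵐ x ∂ surface (frontier ΩS \ interface ΩS ΩD), t j x = 0}

/-- `g = u · ν` on `Σ`, where `u ∈ H¹(ΩS)^d` is evaluated on `Σ` by its trace and `ν` is the unit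
normal on `Σ` that points out of `ΩS` (into `ΩD`). -/
def IsStokesNormalTrace {d : ℕ} (ΩS ΩD : Set (EuclideanSpace ℝ (Fin d))) (u : H1V ΩS)
    (g : L2S (interface ΩS ΩD)) : Prop :=
  ∃ t : Fin d → L2S (frontier ΩS), (∀ j, HasTrace ΩS (u j) (t j)) ∧
    ∀ᵐ x ∂ surface (interface ΩS ΩD), g x = ∑ j, t j x * outerNormal ΩS x j

/-- Green's formula pairing `∫_O (v · ∇w + (div v) w)`, that is, the duality product of the outward
normal trace of `v ∈ H(div, O)` with the trace of `w ∈ H¹(O)`. -/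
def greenPairing {d : ℕ} (O : Set (EuclideanSpace ℝ (Fin d))) (v : Hdiv O) (w : H1 O) : ℝ :=
  inner ℝ v.1.fst w.1.snd + inner ℝ v.1.snd w.1.fst

/-- `H_D(div, ΩD)`: fields in `H(div, ΩD)` with `v · ν = 0` on `ΓD = ∂ΩD ∖ Σ`, that is, whose normal
trace annihilates the traces that vanish on `Σ`. -/
def HDdiv {d : ℕ} (ΩS ΩD : Set (EuclideanSpace ℝ (Fin d))) : Submodule ℝ (Hdiv ΩD) where
  carrier := {v | ∀ (w : H1 ΩD) (t : L2S (frontier ΩD)), HasTrace ΩD w t →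
    (∀ᵐ x ∂ surface (interface ΩS ΩD), t x = 0) → greenPairing ΩD v w = 0}
  zero_mem' := by
    intro w t _ _
    simp [greenPairing]
  add_mem' := by
    intro u v hu hv w t hw ht
    have h1 := hu w t hw ht
    have h2 := hv w t hw ht
    simp only [greenPairing, Submodule.coe_add, WithLp.add_fst, WithLp.add_snd,
      inner_add_left] at h1 h2 ⊢
    linarith
  smul_mem' := by
    intro c v hv w t hw ht
    have h1 := hv w t hw ht
    simp only [greenPairing, Submodule.coe_smul, WithLp.smul_fst, WithLp.smul_snd,
      real_inner_smul_left] at h1 ⊢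
    rw [← mul_add, h1, mul_zero]

/-- The extension by zero of `φ ∈ L²(Σ)` to `∂ΩD` is the trace of `w ∈ H¹(ΩD)`. -/
def IsZeroExtTrace {d : ℕ} (ΩS ΩD : Set (EuclideanSpace ℝ (Fin d))) (w : H1 ΩD)
    (φ : L2S (interface ΩS ΩD)) : Prop :=
  ∃ t : L2S (frontier ΩD), HasTrace ΩD w t ∧
    (∀ᵐ x ∂ surface (interface ΩS ΩD), t x = φ x) ∧
    ∀ᵐ x ∂ surface (frontier ΩD \ interface ΩS ΩD), t x = 0

/-- `H₀₀^{1/2}(Σ)`: functions on `Σ` whose extension by zero belongs to `H^{1/2}(∂ΩD)`, the image of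
the trace operator of `H¹(ΩD)`. -/
def H00half {d : ℕ} (ΩS ΩD : Set (EuclideanSpace ℝ (Fin d))) :
    Set (L2S (interface ΩS ΩD)) :=
  {φ | ∃ w, IsZeroExtTrace ΩS ΩD w φ}

/-- The norm of `H₀₀^{1/2}(Σ)`: the `H^{1/2}(∂ΩD)` norm (the image norm of the trace operator) of
the extension by zero. -/
def h00Norm {d : ℕ} (ΩS ΩD : Set (EuclideanSpace ℝ (Fin d)))
    (φ : L2S (interface ΩS ΩD)) : ℝ :=
  sInf {r | ∃ w, IsZeroExtTrace ΩS ΩD w φ ∧ r = ‖w‖}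

/-- The norm of `H₀₀^{-1/2}(Σ)` (the dual of `H₀₀^{1/2}(Σ)` with pivot `L²(Σ)`) of a function in
`L²(Σ)`. -/
def h00DualNorm {d : ℕ} (ΩS ΩD : Set (EuclideanSpace ℝ (Fin d)))
    (ξ : L2S (interface ΩS ΩD)) : ℝ :=
  sSup {r | ∃ φ ∈ H00half ΩS ΩD, h00Norm ΩS ΩD φ ≤ 1 ∧ r = |inner ℝ ξ φ|}

/-- `v · ν = g` on `Σ`, for `v ∈ H(div, ΩD)` and `g ∈ L²(Σ)`, as functionals on `H₀₀^{1/2}(Σ)`.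
The minus sign is there because `ν` points into `ΩD`. -/
def IsDarcyNormalTrace {d : ℕ} (ΩS ΩD : Set (EuclideanSpace ℝ (Fin d))) (v : Hdiv ΩD)
    (g : L2S (interface ΩS ΩD)) : Prop :=
  ∀ (w : H1 ΩD) (φ : L2S (interface ΩS ΩD)), IsZeroExtTrace ΩS ΩD w φ →
    greenPairing ΩD v w = - inner ℝ g φ

/-- `𝕏`: pairs `(u_S, u_D) ∈ H¹_S(ΩS) × H_D(div, ΩD)` with `u_S · ν = u_D · ν` on `Σ`, inside the
product space with the product norm `(‖u_S‖² + ‖u_D‖²)^{1/2}`. -/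
def X {d : ℕ} (ΩS ΩD : Set (EuclideanSpace ℝ (Fin d))) : Set (WithLp 2 (H1V ΩS × Hdiv ΩD)) :=
  {u | u.fst ∈ H1S ΩS ΩD ∧ u.snd ∈ HDdiv ΩS ΩD ∧
    ∃ g, IsStokesNormalTrace ΩS ΩD u.fst g ∧ IsDarcyNormalTrace ΩS ΩD u.snd g}

/-! ### Triangulations -/

/-- The partition of the interface inherited from a triangulation: the `(d-1)`-dimensional faces
contained in it (each given by its set of `d` vertices). -/
def inheritedPartition {d : ℕ} (S : Set (EuclideanSpace ℝ (Fin d)))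
    (K : Geometry.SimplicialComplex ℝ (EuclideanSpace ℝ (Fin d))) :
    Set (Finset (EuclideanSpace ℝ (Fin d))) :=
  {e | e ∈ K.faces ∧ e.card = d ∧ convexHull ℝ (e : Set (EuclideanSpace ℝ (Fin d))) ⊆ S}

/-- `K` is a (conforming, finite) triangulation of `closure O` into `d`-simplices that induces a
partition of the part `S` of the boundary. -/
structure IsTriangulation {d : ℕ} (O S : Set (EuclideanSpace ℝ (Fin d)))
    (K : Geometry.SimplicialComplex ℝ (EuclideanSpace ℝ (Fin d))) : Prop where
  finite : K.faces.Finite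
  space_eq : K.space = closure O
  pure : ∀ s ∈ K.faces, ∃ T ∈ K.faces, s ⊆ T ∧ T.card = d + 1
  partition : ⋃ e ∈ inheritedPartition S K,
    convexHull ℝ (e : Set (EuclideanSpace ℝ (Fin d))) = S

/-- All elements of the triangulation have diameter at most `h`. -/
def HasMeshSize {d : ℕ} (K : Geometry.SimplicialComplex ℝ (EuclideanSpace ℝ (Fin d)))
    (h : ℝ) : Prop :=
  ∀ T ∈ K.faces, T.card = d + 1 →
    Metric.diam (convexHull ℝ (T : Set (EuclideanSpace ℝ (Fin d)))) ≤ h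

/-- A family of triangulations is (shape-)regular: every element contains a ball whose radius is
comparable to the diameter of the element, uniformly over the family. -/
def IsRegularFamily {d : ℕ} {ι : Type*}
    (K : ι → Geometry.SimplicialComplex ℝ (EuclideanSpace ℝ (Fin d))) : Prop :=
  ∃ κ : ℝ, ∀ i, ∀ T ∈ (K i).faces, T.card = d + 1 → ∃ (c : EuclideanSpace ℝ (Fin d)) (ρ : ℝ),
    0 < ρ ∧ Metric.closedBall c ρ ⊆ convexHull ℝ (T : Set (EuclideanSpace ℝ (Fin d))) ∧
    Metric.diam (convexHull ℝ (T : Set (EuclideanSpace ℝ (Fin d)))) ≤ κ * ρ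

/-- `f` coincides on (the part in `O` of) every element of the triangulation with a polynomial. -/
def IsPiecewisePolynomial {d : ℕ} (O : Set (EuclideanSpace ℝ (Fin d)))
    (K : Geometry.SimplicialComplex ℝ (EuclideanSpace ℝ (Fin d)))
    (f : EuclideanSpace ℝ (Fin d) → ℝ) : Prop :=
  ∀ T ∈ K.faces, T.card = d + 1 → ∃ p : MvPolynomial (Fin d) ℝ,
    ∀ᵐ x ∂ volume.restrict (O ∩ convexHull ℝ (T : Set (EuclideanSpace ℝ (Fin d)))),
      f x = MvPolynomial.eval (fun j => x j) p

/-- A discrete velocity space `H^h(ΩS)`: finite-dimensional, piecewise polynomial. -/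
structure IsStokesFE {d : ℕ} (ΩS : Set (EuclideanSpace ℝ (Fin d)))
    (K : Geometry.SimplicialComplex ℝ (EuclideanSpace ℝ (Fin d)))
    (V : Submodule ℝ (H1V ΩS)) : Prop where
  finite : FiniteDimensional ℝ V
  poly : ∀ u ∈ V, ∀ j, IsPiecewisePolynomial ΩS K (u j).1.fst

/-- A discrete velocity space `H^h(ΩD)`: finite-dimensional, piecewise polynomial. -/
structure IsDarcyFE {d : ℕ} (ΩD : Set (EuclideanSpace ℝ (Fin d)))
    (K : Geometry.SimplicialComplex ℝ (EuclideanSpace ℝ (Fin d)))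
    (V : Submodule ℝ (Hdiv ΩD)) : Prop where
  finite : FiniteDimensional ℝ V
  poly : ∀ v ∈ V, ∀ j, IsPiecewisePolynomial ΩD K (fun x => v.1.fst x j)

/-! ### Discrete spaces -/

/-- `H^h_S(ΩS) = H^h(ΩS) ∩ H¹_S(ΩS)`. -/
def stokesFE {d : ℕ} (ΩS ΩD : Set (EuclideanSpace ℝ (Fin d))) (VS : Submodule ℝ (H1V ΩS)) :
    Set (H1V ΩS) :=
  VS ∩ H1S ΩS ΩD

/-- `H^h_D(ΩD) = H^h(ΩD) ∩ H_D(div, ΩD)`. -/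
def darcyFE {d : ℕ} (ΩS ΩD : Set (EuclideanSpace ℝ (Fin d))) (VD : Submodule ℝ (Hdiv ΩD)) :
    Submodule ℝ (Hdiv ΩD) :=
  VD ⊓ HDdiv ΩS ΩD

/-- `Φ^h_S = {u_h · ν : u_h ∈ H^h_S(ΩS)}`. -/
def PhiS {d : ℕ} (ΩS ΩD : Set (EuclideanSpace ℝ (Fin d))) (VS : Submodule ℝ (H1V ΩS)) :
    Set (L2S (interface ΩS ΩD)) :=
  {g | ∃ u ∈ stokesFE ΩS ΩD VS, IsStokesNormalTrace ΩS ΩD u g}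

/-- `Φ^h_D = {u_h · ν : u_h ∈ H^h_D(ΩD)}`. -/
def PhiD {d : ℕ} (ΩS ΩD : Set (EuclideanSpace ℝ (Fin d))) (VD : Submodule ℝ (Hdiv ΩD)) :
    Submodule ℝ (L2S (interface ΩS ΩD)) where
  carrier := {g | ∃ v ∈ darcyFE ΩS ΩD VD, IsDarcyNormalTrace ΩS ΩD v g}
  zero_mem' := ⟨0, Submodule.zero_mem _, fun w φ _ => by simp [greenPairing]⟩
  add_mem' := by
    rintro g k ⟨u, hu, hug⟩ ⟨v, hv, hvk⟩
    refine ⟨u + v, Submodule.add_mem _ hu hv, fun w φ h => ?_⟩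
    have h1 := hug w φ h
    have h2 := hvk w φ h
    simp only [greenPairing, Submodule.coe_add, WithLp.add_fst, WithLp.add_snd,
      inner_add_left] at h1 h2 ⊢
    linarith
  smul_mem' := by
    rintro c g ⟨u, hu, hug⟩
    refine ⟨c • u, Submodule.smul_mem _ c hu, fun w φ h => ?_⟩
    have h1 := hug w φ h
    simp only [greenPairing, Submodule.coe_smul, WithLp.smul_fst, WithLp.smul_snd,
      real_inner_smul_left] at h1 ⊢
    rw [← mul_add, h1, mul_neg]

/-- `ℙ₀(Σ^h)`: functions in `L²(S)` that are constant on each face of the inherited partition. -/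
def IsPiecewiseConstant {d : ℕ} (S : Set (EuclideanSpace ℝ (Fin d)))
    (K : Geometry.SimplicialComplex ℝ (EuclideanSpace ℝ (Fin d))) (φ : L2S S) : Prop :=
  ∀ e ∈ inheritedPartition S K, ∃ c : ℝ,
    ∀ᵐ x ∂ surface (convexHull ℝ (e : Set (EuclideanSpace ℝ (Fin d)))), φ x = c

/-- `R^h_D`: the `L²(Σ)`-orthogonal projection onto `Φ^h_D`. (Mathlib's projection wants a complete
subspace, whence the closure; `Φ^h_D` is finite-dimensional, so it equals its closure.) -/
def RD {d : ℕ} (ΩS ΩD : Set (EuclideanSpace ℝ (Fin d))) (VD : Submodule ℝ (Hdiv ΩD)) :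
    L2S (interface ΩS ΩD) →L[ℝ] L2S (interface ΩS ΩD) :=
  (PhiD ΩS ΩD VD).topologicalClosure.starProjection

/-- `𝕏^h`: pairs `(u_S, u_D) ∈ H^h_S(ΩS) × H^h_D(ΩD)` with `u_D · ν = R^h_D (u_S · ν)` on `Σ`. -/
def Xh {d : ℕ} (ΩS ΩD : Set (EuclideanSpace ℝ (Fin d))) (VS : Submodule ℝ (H1V ΩS))
    (VD : Submodule ℝ (Hdiv ΩD)) : Set (WithLp 2 (H1V ΩS × Hdiv ΩD)) :=
  {u | u.fst ∈ stokesFE ΩS ΩD VS ∧ u.snd ∈ darcyFE ΩS ΩD VD ∧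
    ∃ g, IsStokesNormalTrace ΩS ΩD u.fst g ∧
      IsDarcyNormalTrace ΩS ΩD u.snd (RD ΩS ΩD VD g)}

/-- There is a stable lifting of the normal trace: linear right inverses
`L^h : Φ^h_D → H^h_D(ΩD)` of the normal trace, bounded from the `H₀₀^{-1/2}(Σ)` norm to the
`H(div, ΩD)` norm uniformly in `h`. -/
def HasStableLifting {d : ℕ} {ι : Type*} (ΩS ΩD : Set (EuclideanSpace ℝ (Fin d)))
    (VD : ι → Submodule ℝ (Hdiv ΩD)) : Prop :=
  ∃ C > 0, ∀ i, ∃ L : PhiD ΩS ΩD (VD i) →ₗ[ℝ] darcyFE ΩS ΩD (VD i), ∀ φ,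
    IsDarcyNormalTrace ΩS ΩD (L φ : Hdiv ΩD) (φ : L2S (interface ΩS ΩD)) ∧
    ‖L φ‖ ≤ C * h00DualNorm ΩS ΩD (φ : L2S (interface ΩS ΩD))

end StokesDarcy

end

open StokesDarcy

namespace StokesDarcy

/-! Take arbitrary discrete fields `a` (Stokes) and `b` (Darcy), and write `q = a · ν`, `gb = b ·
ν`, `g = u · ν` on `Σ`, and `R` for the projection onto `Φ^h_D`. The pair `(a, b)` violates only the
coupling condition, and the lifting repairs it: `c = b + L (R q - gb)` has normal trace `R q`, so
`(a, c)` lies in `𝕏^h`. The repair costs at most a multiple of the dual norm of `R q - gb = (q - g)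
+ (g - gb) - (q - R q)`.

Test this against the trace `φ` of some `w`. The term `q - g` is small in `L²` by the trace theorem
on `ΩS`, and `g - gb` is the normal trace of `u_D - b`, controlled by Green's formula. Finally `q -
R q = (I - R)(q - g) + (g - R g)`; the first part is again an `L²` error, and by orthogonality the
second pairs with `φ` as `⟨g - R g, φ - R φ⟩`. As `Φ^h_D` contains the piecewise constants, `‖φ - R
φ‖ ≤ c √h ‖w‖`, whence the extra term with `λ = √h`. If `Φ^h_S ⊆ Φ^h_D`, then `q = R q` and the term
is absent. This is `abs_inner_residual_le`, and `exists_Xh_dist_le` performs the correction.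

Three analytic facts carry this. Face estimates: integrating along segments from a ball inside an
element to one of its faces (`face_poincare_core`) gives both the trace theorem `exists_trace_bound`
and the half order of approximation `infDist_piecewiseConstant_le`. Existence: discrete Darcy fields
are bounded, and a bounded field in `H(div)` has an `L²` normal trace, seen by cutting off near the
boundary (`green_smooth_bound`) and Riesz representation (`exists_normalTrace`). Uniqueness: the
`L²` normal trace on `Σ` is unique (`IsDarcyNormalTrace.unique`); hence `Φ^h_D` is
finite-dimensional and `R` really maps into the domain of the lifting (`RD_mem`). -/

abbrev Euc (m : ℕ) : Type := EuclideanSpace ℝ (Fin m)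

/-! ### Orthogonal coordinates adapted to a hyperplane -/

theorem exists_frame {m : ℕ} {n : Euc (m + 1)} (hn : ‖n‖ = 1) :
    ∃ U : Euc m →ₗᵢ[ℝ] Euc (m + 1), ∀ z, inner ℝ (U z) n = 0 := by
  have hn0 : n ≠ 0 := by rintro rfl; simp at hn
  have : Fact (Module.finrank ℝ (Euc (m + 1)) = m + 1) := ⟨by simp⟩
  let b := OrthonormalBasis.fromOrthogonalSpanSingleton (𝕜 := ℝ) m hn0
  refine ⟨(Submodule.subtypeₗᵢ _).comp b.repr.symm.toLinearIsometry, fun z => ?_⟩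
  have := (b.repr.symm z).2
  rw [Submodule.mem_orthogonal_singleton_iff_inner_left] at this
  exact this

section Frame

variable {m : ℕ} {n : Euc (m + 1)} {U : Euc m →ₗᵢ[ℝ] Euc (m + 1)}

/-- The isometry `(z, s) ↦ U z + s n` from `ℝ^m × ℝ` onto `ℝ^(m+1)`. -/
theorem exists_frameEquiv (hn : ‖n‖ = 1) (hU : ∀ z, inner ℝ (U z) n = 0) :
    ∃ J : WithLp 2 (Euc m × ℝ) ≃ₗᵢ[ℝ] Euc (m + 1), ∀ p, J p = U p.fst + p.snd • n := by
  let J : WithLp 2 (Euc m × ℝ) →ₗᵢ[ℝ] Euc (m + 1) :=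
    { toFun := fun p => U p.fst + p.snd • n
      map_add' := fun p q => by simp [add_smul]; abel
      map_smul' := fun c p => by simp [mul_smul]
      norm_map' := fun p => by
        have h1 : ‖U p.fst + p.snd • n‖ ^ 2 = ‖p‖ ^ 2 := by
          have h0 : inner ℝ (U p.fst) (p.snd • n) = 0 := by
            rw [real_inner_smul_right, hU, mul_zero]
          rw [norm_add_sq_real, WithLp.prod_norm_sq_eq_of_L2, h0, norm_smul, hn,
            LinearIsometry.norm_map]
          simp
        exact (sq_eq_sq₀ (norm_nonneg _) (norm_nonneg _)).1 h1 }
  have hf : Module.finrank ℝ (WithLp 2 (Euc m × ℝ)) = Module.finrank ℝ (Euc (m + 1)) := by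
    rw [(WithLp.linearEquiv 2 ℝ (Euc m × ℝ)).finrank_eq]
    simp
  exact ⟨J.toLinearIsometryEquiv hf, fun p => rfl⟩

theorem frame_measurePreserving (hn : ‖n‖ = 1) (hU : ∀ z, inner ℝ (U z) n = 0) :
    MeasurePreserving (fun p : Euc m × ℝ => U p.1 + p.2 • n) (volume.prod volume) volume := by
  obtain ⟨J, hJ⟩ := exists_frameEquiv hn hU
  have h := J.measurePreserving.comp (WithLp.volume_preserving_toLp (Euc m) ℝ)
  have e : (J ∘ WithLp.toLp 2 : Euc m × ℝ → Euc (m + 1)) = fun p => U p.1 + p.2 • n := by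
    funext p; simp [hJ]
  rwa [e] at h

theorem frame_surjective (hn : ‖n‖ = 1) (hU : ∀ z, inner ℝ (U z) n = 0) (x : Euc (m + 1)) :
    ∃ z, x = U z + (inner ℝ x n : ℝ) • n := by
  obtain ⟨J, hJ⟩ := exists_frameEquiv hn hU
  refine ⟨(J.symm x).fst, ?_⟩
  have h1 : x = U (J.symm x).fst + (J.symm x).snd • n := by rw [← hJ]; simp
  have h2 : (inner ℝ x n : ℝ) = (J.symm x).snd := by
    conv_lhs => rw [h1]
    rw [inner_add_left, hU, real_inner_smul_left, real_inner_self_eq_norm_sq, hn]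
    simp
  rw [h2, ← h1]

theorem inner_frame (hn : ‖n‖ = 1) (hU : ∀ z, inner ℝ (U z) n = 0) (z : Euc m) (s : ℝ) :
    inner ℝ (U z + s • n) n = s := by
  rw [inner_add_left, hU, real_inner_smul_left, real_inner_self_eq_norm_sq, hn]
  simp

theorem isometry_slice (U : Euc m →ₗᵢ[ℝ] Euc (m + 1)) (c : Euc (m + 1)) :
    Isometry (fun z => U z + c) :=
  Isometry.of_dist_eq fun x y => by rw [dist_add_right, U.dist_map]

theorem range_slice (hn : ‖n‖ = 1) (hU : ∀ z, inner ℝ (U z) n = 0) (s : ℝ) :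
    range (fun z => U z + s • n) = {x | inner ℝ x n = s} := by
  ext x
  constructor
  · rintro ⟨z, rfl⟩
    exact inner_frame hn hU z s
  · intro hx
    obtain ⟨z, hz⟩ := frame_surjective hn hU x
    refine ⟨z, ?_⟩
    rw [mem_ofPred_eq] at hx
    rw [hx] at hz
    exact hz.symm

/-- Surface measure on a hyperplane is Lebesgue measure in orthogonal coordinates. -/
theorem map_slice (hn : ‖n‖ = 1) (hU : ∀ z, inner ℝ (U z) n = 0) (s : ℝ) :
    Measure.map (fun z => U z + s • n) volume
      = (Measure.euclideanHausdorffMeasure m).restrict {x : Euc (m + 1) | inner ℝ x n = s} := by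
  rw [← range_slice hn hU s, ← (isometry_slice U (s • n)).map_euclideanHausdorffMeasure (d := m),
    EuclideanSpace.euclideanHausdorffMeasure_eq_volume]

theorem measurableEmbedding_slice (U : Euc m →ₗᵢ[ℝ] Euc (m + 1)) (c : Euc (m + 1)) :
    MeasurableEmbedding (fun z => U z + c) :=
  (isometry_slice U c).isClosedEmbedding.measurableEmbedding

/-- Integrals over a subset of a hyperplane in orthogonal coordinates. -/
theorem lintegral_hyperplane (hn : ‖n‖ = 1) (hU : ∀ z, inner ℝ (U z) n = 0) {s : ℝ}
    {S : Set (Euc (m + 1))} (hS : S ⊆ {x | inner ℝ x n = s}) (hSm : MeasurableSet S)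
    (f : Euc (m + 1) → ENNReal) :
    ∫⁻ x in S, f x ∂(Measure.euclideanHausdorffMeasure m)
      = ∫⁻ z in (fun z => U z + s • n) ⁻¹' S, f (U z + s • n) := by
  have h1 : (Measure.euclideanHausdorffMeasure m : Measure (Euc (m + 1))).restrict S
      = (Measure.map (fun z => U z + s • n) volume).restrict S := by
    rw [map_slice hn hU, Measure.restrict_restrict hSm, inter_eq_left.2 hS]
  rw [h1, (measurableEmbedding_slice U _).restrict_map, (measurableEmbedding_slice U _).lintegral_map]

theorem measure_hyperplane (hn : ‖n‖ = 1) (hU : ∀ z, inner ℝ (U z) n = 0) {s : ℝ}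
    {S : Set (Euc (m + 1))} (hS : S ⊆ {x | inner ℝ x n = s}) :
    Measure.euclideanHausdorffMeasure m S = volume ((fun z => U z + s • n) ⁻¹' S) := by
  have h1 : S = (fun z => U z + s • n) '' ((fun z => U z + s • n) ⁻¹' S) := by
    rw [image_preimage_eq_inter_range, range_slice hn hU, inter_eq_left.2 hS]
  conv_lhs => rw [h1, (isometry_slice U _).euclideanHausdorffMeasure_image,
    EuclideanSpace.euclideanHausdorffMeasure_eq_volume]

end Frame

/-! ### Measures of hyperplanes, of bounded pieces of hyperplanes, and of polyhedral boundaries. -/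

theorem volume_closedBall_le {m : ℕ} (z : Euc m) {R : ℝ} (hR : 0 ≤ R) :
    volume (Metric.closedBall z R)
      = ENNReal.ofReal (R ^ m) * volume (Metric.ball (0 : Euc m) 1) := by
  rw [Measure.addHaar_closedBall _ _ hR]; simp

/-- The area of a subset of a hyperplane is bounded by that of a ball of radius the diameter. -/
theorem hyperplane_measure_le {m : ℕ} {n : Euc (m + 1)} (hn : ‖n‖ = 1) {s R : ℝ} (hR : 0 ≤ R)
    {S : Set (Euc (m + 1))} (hS : S ⊆ {x | inner ℝ x n = s})
    (hd : ∀ x ∈ S, ∀ y ∈ S, dist x y ≤ R) :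
    Measure.euclideanHausdorffMeasure m S
      ≤ ENNReal.ofReal (R ^ m) * volume (Metric.ball (0 : Euc m) 1) := by
  obtain ⟨U, hU⟩ := exists_frame hn
  rw [measure_hyperplane hn hU hS]
  rcases ((fun z => U z + s • n) ⁻¹' S).eq_empty_or_nonempty with h | ⟨z, hz⟩
  · rw [h]; simp
  · rw [← volume_closedBall_le z hR]
    refine measure_mono fun y hy => ?_
    rw [Metric.mem_closedBall, ← (isometry_slice U (s • n)).dist_eq]
    exact hd _ hy _ hz

theorem hyperplane_unit {m : ℕ} {a : Euc m} (ha : a ≠ 0) (b : ℝ) :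
    {x : Euc m | inner ℝ a x = b} = {x | inner ℝ x (‖a‖⁻¹ • a) = ‖a‖⁻¹ * b} := by
  ext x
  have : ‖a‖⁻¹ ≠ 0 := by simpa using ha
  simp only [mem_ofPred_eq, real_inner_smul_right, real_inner_comm x a]
  constructor
  · intro h; rw [h]
  · intro h; exact mul_left_cancel₀ this h

theorem norm_unit {m : ℕ} {a : Euc m} (ha : a ≠ 0) : ‖‖a‖⁻¹ • a‖ = 1 := by
  rw [norm_smul, norm_inv, norm_norm, inv_mul_cancel₀ (norm_ne_zero_iff.2 ha)]

theorem volume_hyperplane {m : ℕ} {a : Euc m} (ha : a ≠ 0) (b : ℝ) :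
    volume {x : Euc m | inner ℝ a x = b} = 0 := by
  by_cases hne : ∃ x0 : Euc m, inner ℝ a x0 = b
  · obtain ⟨x0, hx0⟩ := hne
    have h := Measure.addHaar_affineSubspace (volume : Measure (Euc m))
      (AffineSubspace.mk' x0 (ℝ ∙ a)ᗮ) ?_
    · convert h using 2
      ext x
      simp only [mem_ofPred_eq, SetLike.mem_coe, AffineSubspace.mem_mk', vsub_eq_sub,
        Submodule.mem_orthogonal_singleton_iff_inner_right, inner_sub_right, hx0, sub_eq_zero]
    · intro h
      have h1 : x0 + a ∈ AffineSubspace.mk' x0 (ℝ ∙ a)ᗮ := by rw [h]; trivial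
      rw [AffineSubspace.mem_mk', vsub_eq_sub, add_sub_cancel_left,
        Submodule.mem_orthogonal_singleton_iff_inner_right, inner_self_eq_zero] at h1
      exact ha h1
  · push Not at hne
    have : {x : Euc m | inner ℝ a x = b} = ∅ := by
      ext x; simpa using hne x
    rw [this]; simp

section Polyhedral

variable {m : ℕ} {O : Set (Euc (m + 1))}

theorem IsPolyhedralLipschitzDomain.volume_frontier (h : IsPolyhedralLipschitzDomain O) :
    volume (frontier O) = 0 := by
  obtain ⟨P, hP, hsub⟩ := h.flat
  refine measure_mono_null hsub ((measure_biUnion_null_iff P.countable_toSet).2 fun p hp => ?_)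
  exact volume_hyperplane (hP p hp) _

theorem IsLipschitzDomain.isCompact_closure (h : IsLipschitzDomain O) : IsCompact (closure O) :=
  h.isBounded.isCompact_closure

theorem IsLipschitzDomain.isCompact_frontier (h : IsLipschitzDomain O) : IsCompact (frontier O) :=
  h.isCompact_closure.of_isClosed_subset isClosed_frontier frontier_subset_closure

theorem IsPolyhedralLipschitzDomain.surface_frontier_lt_top (h : IsPolyhedralLipschitzDomain O) :
    Measure.euclideanHausdorffMeasure m (frontier O) < ⊤ := by
  obtain ⟨P, hP, hsub⟩ := h.flat
  have hb := h.toIsLipschitzDomain.isCompact_frontier.isBounded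
  have e : frontier O = ⋃ p ∈ P, ({x | inner ℝ p.1 x = p.2} ∩ frontier O) := by
    rw [← iUnion₂_inter, inter_eq_right.2 hsub]
  rw [e]
  refine measure_biUnion_lt_top P.finite_toSet fun p hp => ?_
  rw [hyperplane_unit (hP p hp)]
  refine (hyperplane_measure_le (norm_unit (hP p hp)) (Metric.diam_nonneg (s := frontier O))
    inter_subset_left fun x hx y hy => Metric.dist_le_diam_of_mem hb hx.2 hy.2).trans_lt ?_
  exact ENNReal.mul_lt_top ENNReal.ofReal_lt_top measure_ball_lt_top

end Polyhedral

/-! ### A scaled Poincaré inequality on a face of a convex body -/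

theorem lintegral_comp_affine {E : Type*} [NormedAddCommGroup E] [NormedSpace ℝ E]
    [FiniteDimensional ℝ E] [MeasurableSpace E] [BorelSpace E] (μ : Measure E)
    [μ.IsAddHaarMeasure] {f : E → ENNReal} (hf : Measurable f) {r : ℝ} (hr : r ≠ 0) (b : E) :
    ∫⁻ x, f (r • x + b) ∂μ = ENNReal.ofReal |(r ^ Module.finrank ℝ E)⁻¹| * ∫⁻ x, f x ∂μ := by
  have h1 : ∫⁻ x, f (r • x + b) ∂μ = ∫⁻ y, f (y + b) ∂(Measure.map (fun x => r • x) μ) := by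
    rw [lintegral_map (by fun_prop) (by fun_prop)]
  rw [h1, Measure.map_addHaar_smul μ hr, lintegral_smul_measure, lintegral_add_right_eq_self,
    smul_eq_mul]

/-- This bounds the inverse Jacobian of a dilation whose ratio is at least `1/2`, which is why
segments are later cut at their midpoint. -/
theorem inv_pow_abs_le {r : ℝ} (hr : 1 / 2 ≤ r) (k : ℕ) :
    ENNReal.ofReal |(r ^ k)⁻¹| ≤ 2 ^ k := by
  have h0 : 0 < r := by linarith
  have h2 : (2 : ENNReal) ^ k = ENNReal.ofReal (2 ^ k) := by
    rw [ENNReal.ofReal_pow (by norm_num)]; simp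
  rw [h2, abs_of_pos (by positivity), ← inv_pow]
  refine ENNReal.ofReal_le_ofReal (pow_le_pow_left₀ (by positivity) ?_ _)
  rw [inv_le_comm₀ h0 (by norm_num)]
  linarith

theorem sq_lintegral_unitInterval_le {f : ℝ → ENNReal} (hf : Measurable f) :
    (∫⁻ t in Icc (0 : ℝ) 1, f t) ^ 2 ≤ ∫⁻ t in Icc (0 : ℝ) 1, f t ^ 2 := by
  have h := ENNReal.lintegral_mul_le_Lp_mul_Lq (volume.restrict (Icc (0 : ℝ) 1))
    (Real.HolderConjugate.two_two) hf.aemeasurable (aemeasurable_const (b := (1 : ENNReal)))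
  simp only [Pi.mul_apply, mul_one, ENNReal.one_rpow, lintegral_const, MeasurableSet.univ,
    Measure.restrict_apply, univ_inter, Real.volume_Icc, sub_zero, ENNReal.ofReal_one] at h
  calc _ ≤ ((∫⁻ t in Icc (0 : ℝ) 1, f t ^ (2 : ℝ)) ^ (1 / 2 : ℝ)) ^ 2 := pow_le_pow_left' h 2
    _ = _ := by
      rw [← ENNReal.rpow_natCast, ← ENNReal.rpow_mul]
      norm_num

section

variable {k : ℕ} {φ : Euc k → ℝ}

theorem norm_gradient_eq (x : Euc k) : ‖gradient φ x‖ = ‖fderiv ℝ φ x‖ := by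
  simp [gradient]

/-- Integrate the derivative along the segment from `x` to `y` and apply Cauchy–Schwarz in the
parameter. -/
theorem enorm_sub_sq_le (hφ : ContDiff ℝ ∞ φ) {x y : Euc k} {D : ℝ} (hD : dist x y ≤ D) :
    ‖φ y - φ x‖ₑ ^ 2 ≤ ENNReal.ofReal (D ^ 2) *
      ∫⁻ t in Icc (0 : ℝ) 1, ‖gradient φ ((1 - t) • x + t • y)‖ₑ ^ 2 := by
  have hD0 : 0 ≤ D := dist_nonneg.trans hD
  have hc : Continuous fun t : ℝ => gradient φ ((1 - t) • x + t • y) :=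
    (continuous_gradient hφ).comp (by fun_prop)
  have hder : ∀ t : ℝ, HasDerivAt (fun t : ℝ => φ ((1 - t) • x + t • y))
      (inner ℝ (gradient φ ((1 - t) • x + t • y)) (y - x)) t := by
    intro t
    have h1 : HasDerivAt (fun t : ℝ => (1 - t) • x + t • y) (y - x) t := by
      have h2 := (((hasDerivAt_id t).const_sub 1).smul_const x).add
        ((hasDerivAt_id t).smul_const y)
      convert! h2 using 1
      simp; abel
    have h3 := ((hφ.differentiable (by simp)) ((1 - t) • x + t • y)).hasGradientAt.hasFDerivAt
    have h4 := h3.comp_hasDerivAt t h1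
    exact h4.congr_deriv (by simp [gradient])
  have hint : φ y - φ x = ∫ t in Icc (0 : ℝ) 1,
      inner ℝ (gradient φ ((1 - t) • x + t • y)) (y - x) := by
    have h1 := intervalIntegral.integral_eq_sub_of_hasDerivAt (a := 0) (b := 1)
      (fun t _ => hder t) ((hc.inner continuous_const).intervalIntegrable _ _)
    rw [intervalIntegral.integral_of_le zero_le_one, ← integral_Icc_eq_integral_Ioc] at h1
    rw [h1]; simp
  have h1 : ‖φ y - φ x‖ₑ ≤ ∫⁻ t in Icc (0 : ℝ) 1,
      ENNReal.ofReal D * ‖gradient φ ((1 - t) • x + t • y)‖ₑ := by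
    rw [hint]
    refine (enorm_integral_le_lintegral_enorm _).trans (lintegral_mono fun t => ?_)
    rw [← ofReal_norm, ← ofReal_norm, ← ENNReal.ofReal_mul hD0]
    refine ENNReal.ofReal_le_ofReal ((norm_inner_le_norm _ _).trans ?_)
    rw [mul_comm]
    refine mul_le_mul_of_nonneg_right ?_ (norm_nonneg _)
    rwa [← dist_eq_norm, dist_comm]
  rw [lintegral_const_mul _ hc.enorm.measurable] at h1
  calc ‖φ y - φ x‖ₑ ^ 2 ≤ _ := pow_le_pow_left' h1 2
    _ = ENNReal.ofReal (D ^ 2) *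
        (∫⁻ t in Icc (0 : ℝ) 1, ‖gradient φ ((1 - t) • x + t • y)‖ₑ) ^ 2 := by
      rw [mul_pow, ENNReal.ofReal_pow hD0]
    _ ≤ _ := by
      gcongr
      exact sq_lintegral_unitInterval_le hc.enorm.measurable

end

section Face

variable {m : ℕ} {T S : Set (Euc (m + 1))} {n c : Euc (m + 1)} {s ρ : ℝ}

/-- Contraction towards a point `y` of the convex set `T` with ratio at least `1/2`. -/
theorem lintegral_contract_le (hT : Convex ℝ T) (hTm : MeasurableSet T) {G : Euc (m + 1) → ENNReal}
    (hG : Measurable G) {B : Set (Euc (m + 1))} (hB : B ⊆ T) {y : Euc (m + 1)} (hy : y ∈ T) {t : ℝ}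
    (ht : t ∈ Icc (0 : ℝ) (1 / 2)) :
    ∫⁻ x in B, G ((1 - t) • x + t • y) ≤ 2 ^ (m + 1) * ∫⁻ x in T, G x := by
  have h1 : ∫⁻ x in B, G ((1 - t) • x + t • y)
      ≤ ∫⁻ x, T.indicator G ((1 - t) • x + t • y) := by
    refine (setLIntegral_mono (g := fun x => T.indicator G ((1 - t) • x + t • y))
      ((hG.indicator hTm).comp (by fun_prop)) fun x hx => ?_).trans (setLIntegral_le_lintegral _ _)
    rw [indicator_of_mem (hT (hB hx) hy (by linarith [ht.2]) ht.1 (by ring))]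
  refine h1.trans ?_
  rw [lintegral_comp_affine volume (hG.indicator hTm) (by linarith [ht.2] : 1 - t ≠ 0),
    lintegral_indicator hTm]
  gcongr
  simpa using inv_pow_abs_le (by linarith [ht.2] : (1 : ℝ) / 2 ≤ 1 - t) (m + 1)

/-- Integration over the frustum of the cone with base `S` and apex `x`. -/
theorem lintegral_cone_le (hT : Convex ℝ T) (hTm : MeasurableSet T) (hn : ‖n‖ = 1)
    (hS : S ⊆ T ∩ {x | inner ℝ x n = s}) (hSm : MeasurableSet S) (hρ : 0 < ρ)
    {G : Euc (m + 1) → ENNReal} (hG : Measurable G) {x : Euc (m + 1)} (hx : x ∈ T)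
    (hxs : inner ℝ x n ≤ s - ρ) :
    ∫⁻ t in Icc (1 / 2 : ℝ) 1, ∫⁻ y in S, G ((1 - t) • x + t • y)
        ∂(Measure.euclideanHausdorffMeasure m)
      ≤ 2 ^ m * ENNReal.ofReal (1 / ρ) * ∫⁻ x in T, G x := by
  obtain ⟨U, hU⟩ := exists_frame hn
  obtain ⟨ξ, hξ⟩ := frame_surjective hn hU x
  set σ : ℝ := inner ℝ x n with hσ
  set f := T.indicator G with hf
  have hfm : Measurable f := hG.indicator hTm
  have hJ := frame_measurePreserving hn hU
  have hcm : Measurable fun p : Euc m × ℝ => f (U p.1 + p.2 • n) := hfm.comp hJ.measurable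
  -- `F r` is the integral of `G` over the slice of `T` at height `r`; by Fubini the slices add up
  -- to the integral over `T`.
  set F : ℝ → ENNReal := fun r => ∫⁻ z, f (U z + r • n) with hF
  have hFm : Measurable F := hcm.lintegral_prod_left'
  have hFint : ∫⁻ r, F r = ∫⁻ x in T, G x := by
    rw [← lintegral_indicator hTm, ← hJ.lintegral_comp hfm, lintegral_prod_symm _ hcm.aemeasurable]
  have hslice : ∀ t ∈ Icc (1 / 2 : ℝ) 1, ∫⁻ y in S, G ((1 - t) • x + t • y)
      ∂(Measure.euclideanHausdorffMeasure m) ≤ 2 ^ m * F ((s - σ) • t + σ) := by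
    intro t ht
    have ht0 : t ≠ 0 := by linarith [ht.1]
    rw [lintegral_hyperplane hn hU (fun y hy => (hS hy).2) hSm]
    -- The homothety with centre `x` and ratio `t` sends the plane at height `s` to the plane at
    -- height `(s - σ) t + σ` and multiplies areas by `t ^ m ≥ 2 ^ (-m)`. The later substitution in
    -- the height costs `1 / (s - σ) ≤ 1 / ρ`.
    have e : ∀ z, (1 - t) • x + t • (U z + s • n)
        = U (t • z + (1 - t) • ξ) + ((s - σ) • t + σ) • n := by
      intro z
      rw [hξ, map_add, map_smul, map_smul]
      simp only [smul_eq_mul]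
      module
    have h1 : ∫⁻ z in (fun z => U z + s • n) ⁻¹' S, G ((1 - t) • x + t • (U z + s • n))
        ≤ ∫⁻ z, f (U (t • z + (1 - t) • ξ) + ((s - σ) • t + σ) • n) := by
      refine (setLIntegral_mono (hfm.comp ?_) fun z hz => ?_).trans (setLIntegral_le_lintegral _ _)
      · exact (by fun_prop : Continuous fun z : Euc m =>
          U (t • z + (1 - t) • ξ) + ((s - σ) • t + σ) • n).measurable
      · rw [Function.comp_apply, ← e, hf, indicator_of_mem]
        exact hT hx (hS hz).1 (by linarith [ht.2]) (by linarith [ht.1]) (by ring)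
    refine h1.trans ?_
    rw [lintegral_comp_affine volume (f := fun z => f (U z + ((s - σ) • t + σ) • n))
      (hfm.comp (isometry_slice U _).continuous.measurable) ht0]
    gcongr
    simpa using inv_pow_abs_le ht.1 m
  calc _ ≤ ∫⁻ t in Icc (1 / 2 : ℝ) 1, 2 ^ m * F ((s - σ) • t + σ) :=
        setLIntegral_mono (Measurable.const_mul (hFm.comp (by fun_prop)) _) hslice
    _ ≤ ∫⁻ t, 2 ^ m * F ((s - σ) • t + σ) := setLIntegral_le_lintegral _ _
    _ = 2 ^ m * ∫⁻ t, F ((s - σ) • t + σ) := lintegral_const_mul _ (hFm.comp (by fun_prop))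
    _ = 2 ^ m * (ENNReal.ofReal (1 / (s - σ)) * ∫⁻ x in T, G x) := by
      rw [lintegral_comp_affine volume hFm (by linarith : s - σ ≠ 0), hFint]
      simp only [Module.finrank_self, pow_one, one_div]
      rw [abs_of_pos (by rw [inv_pos]; linarith)]
    _ ≤ _ := by
      rw [← mul_assoc]
      gcongr
      linarith

/-- The order of integration depends on the half of the segment. For `t ≤ 1/2` one integrates in `x`
with `y` fixed, where the contraction factor `1 - t` stays away from zero. For `t ≥ 1/2` that factor
degenerates, so `y` and `t` are integrated together with `x` fixed; in the application they sweep
out part of a cone. -/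
theorem lintegral_segment_le {k : ℕ} {μ ν : Measure (Euc k)} [SFinite μ] [SFinite ν]
    {G : Euc k → ENNReal} (hG : Measurable G) {a b : ENNReal}
    (ha : ∀ᵐ y ∂μ, ∀ t ∈ Icc (0 : ℝ) (1 / 2), ∫⁻ x, G ((1 - t) • x + t • y) ∂ν ≤ a)
    (hb : ∀ᵐ x ∂ν, ∫⁻ t in Icc (1 / 2 : ℝ) 1, ∫⁻ y, G ((1 - t) • x + t • y) ∂μ ≤ b) :
    ∫⁻ x, ∫⁻ y, (∫⁻ t in Icc (0 : ℝ) 1, G ((1 - t) • x + t • y)) ∂μ ∂ν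
      ≤ a * μ univ + b * ν univ := by
  have hmeas : Measurable fun p : (Euc k × Euc k) × ℝ =>
      G ((1 - p.2) • p.1.1 + p.2 • p.1.2) := hG.comp (by fun_prop)
  have hm2 : ∀ A : Set ℝ, Measurable fun p : Euc k × Euc k =>
      ∫⁻ t in A, G ((1 - t) • p.1 + t • p.2) := fun A =>
    hmeas.lintegral_prod_right' (ν := volume.restrict A)
  have hm1 : ∀ (A : Set ℝ) x, Measurable fun y => ∫⁻ t in A, G ((1 - t) • x + t • y) :=
    fun A x => (hm2 A).comp (measurable_const.prodMk measurable_id)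
  have h1 : ∫⁻ x, ∫⁻ y, (∫⁻ t in Icc (0 : ℝ) 1, G ((1 - t) • x + t • y)) ∂μ ∂ν
      ≤ (∫⁻ x, ∫⁻ y, (∫⁻ t in Icc (0 : ℝ) (1 / 2), G ((1 - t) • x + t • y)) ∂μ ∂ν)
        + ∫⁻ x, ∫⁻ y, (∫⁻ t in Icc (1 / 2 : ℝ) 1, G ((1 - t) • x + t • y)) ∂μ ∂ν := by
    rw [← lintegral_add_left ((hm2 _).lintegral_prod_right' (ν := μ))]
    refine lintegral_mono fun x => ?_
    rw [← lintegral_add_left (hm1 _ x)]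
    refine lintegral_mono fun y => ?_
    rw [← Icc_union_Icc_eq_Icc (by norm_num : (0 : ℝ) ≤ 1 / 2) (by norm_num)]
    exact lintegral_union_le _ _ _
  refine h1.trans (add_le_add ?_ ?_)
  · rw [lintegral_lintegral_swap (hm2 _).aemeasurable, ← lintegral_const]
    refine lintegral_mono_ae (ha.mono fun y hy => ?_)
    have h3 : Measurable fun p : Euc k × ℝ => G ((1 - p.2) • p.1 + p.2 • y) :=
      hG.comp (by fun_prop)
    rw [lintegral_lintegral_swap h3.aemeasurable]
    calc _ ≤ ∫⁻ t in Icc (0 : ℝ) (1 / 2), a := setLIntegral_mono' measurableSet_Icc hy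
      _ ≤ a := by
        rw [lintegral_const]
        refine mul_le_of_le_one_right' ?_
        simp only [MeasurableSet.univ, Measure.restrict_apply, univ_inter, Real.volume_Icc]
        rw [ENNReal.ofReal_le_one]; norm_num
  · rw [← lintegral_const]
    refine lintegral_mono_ae (hb.mono fun x hx => ?_)
    have h3 : Measurable fun p : Euc k × ℝ => G ((1 - p.2) • x + p.2 • p.1) :=
      hG.comp (by fun_prop)
    rw [lintegral_lintegral_swap h3.aemeasurable]
    exact hx

/-- Both face estimates rest on this bound for the oscillation between a body set `B` and the face
`S`. The distance `ρ` between `B` and the plane of `S` keeps the cones with base `S` from being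
flat. -/
theorem face_poincare_core (hT : Convex ℝ T) (hTm : MeasurableSet T) (hn : ‖n‖ = 1)
    (hS : S ⊆ T ∩ {x | inner ℝ x n = s}) (hSm : MeasurableSet S)
    (hSfin : Measure.euclideanHausdorffMeasure m S < ⊤) (hρ : 0 < ρ)
    {D : ℝ} (hD : ∀ x ∈ T, ∀ y ∈ T, dist x y ≤ D)
    {B : Set (Euc (m + 1))} (hBm : MeasurableSet B) (hB : B ⊆ T)
    (hBs : ∀ x ∈ B, inner ℝ x n ≤ s - ρ) {φ : Euc (m + 1) → ℝ} (hφ : ContDiff ℝ ∞ φ) :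
    ∫⁻ x in B, ∫⁻ y in S, ‖φ y - φ x‖ₑ ^ 2 ∂(Measure.euclideanHausdorffMeasure m)
      ≤ ENNReal.ofReal (D ^ 2) * ((2 ^ (m + 1) * ∫⁻ x in T, ‖gradient φ x‖ₑ ^ 2)
          * Measure.euclideanHausdorffMeasure m S
        + (2 ^ m * ENNReal.ofReal (1 / ρ) * ∫⁻ x in T, ‖gradient φ x‖ₑ ^ 2) * volume B) := by
  have hG : Measurable fun x => ‖gradient φ x‖ₑ ^ 2 :=
    ((continuous_gradient hφ).enorm.measurable).pow_const 2
  have : IsFiniteMeasure ((Measure.euclideanHausdorffMeasure m).restrict S) :=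
    ⟨by rwa [Measure.restrict_apply_univ]⟩
  have h := lintegral_segment_le (μ := (Measure.euclideanHausdorffMeasure m).restrict S)
    (ν := volume.restrict B) hG
    ((ae_restrict_mem hSm).mono fun y hy t ht => lintegral_contract_le hT hTm hG hB (hS hy).1 ht)
    ((ae_restrict_mem hBm).mono fun x hx => lintegral_cone_le hT hTm hn hS hSm hρ hG (hB hx)
      (hBs x hx))
  rw [Measure.restrict_apply_univ, Measure.restrict_apply_univ] at h
  refine le_trans ?_ (mul_le_mul_right h _)
  rw [← lintegral_const_mul' _ _ ENNReal.ofReal_ne_top]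
  refine setLIntegral_mono' hBm fun x hx => ?_
  rw [← lintegral_const_mul' _ _ ENNReal.ofReal_ne_top]
  exact setLIntegral_mono' hSm fun y hy => enorm_sub_sq_le hφ (hD x (hB hx) y (hS hy).1)

end Face

theorem measure_closedBall_half_pos {m : ℕ} (c : Euc m) {ρ : ℝ} (hρ : 0 < ρ) :
    volume (Metric.closedBall c (ρ / 2)) ≠ 0 :=
  (Metric.measure_closedBall_pos volume c (by linarith)).ne'

/-- The constant in the Poincaré inequality on a face, for shape regularity constant `κ`. -/
noncomputable def faceConst (m : ℕ) (κ : ℝ) : ℝ :=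
  2 ^ (m + 1) * (2 * κ) ^ (m + 1) * (volume (Metric.ball (0 : Euc m) 1)).toReal
    / (volume (Metric.ball (0 : Euc (m + 1)) 1)).toReal + 2 ^ (m + 1) * κ

theorem faceConst_nonneg (m : ℕ) {κ : ℝ} (hκ : 0 ≤ κ) : 0 ≤ faceConst m κ := by
  unfold faceConst; positivity

section Face

variable {m : ℕ} {T S : Set (Euc (m + 1))} {n c : Euc (m + 1)} {s ρ D : ℝ}

/-- From a point of the half ball one can still move by `ρ / 2` in direction `n` without leaving
`T`, hence without crossing the plane of the face. -/
theorem inner_le_of_closedBall_subset (hn : ‖n‖ = 1) (hρ : 0 < ρ) (hc : Metric.closedBall c ρ ⊆ T)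
    (hTs : ∀ x ∈ T, inner ℝ x n ≤ s) {x : Euc (m + 1)} (hx : x ∈ Metric.closedBall c (ρ / 2)) :
    inner ℝ x n ≤ s - ρ / 2 := by
  have h1 : x + (ρ / 2) • n ∈ Metric.closedBall c ρ := by
    rw [Metric.mem_closedBall] at hx ⊢
    calc dist (x + (ρ / 2) • n) c ≤ dist (x + (ρ / 2) • n) x + dist x c := dist_triangle _ _ _
      _ ≤ ρ / 2 + ρ / 2 := by
        refine add_le_add ?_ hx
        rw [dist_eq_norm, add_sub_cancel_left, norm_smul, hn, Real.norm_eq_abs,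
          abs_of_pos (by linarith), mul_one]
      _ = ρ := by ring
  have h2 := hTs _ (hc h1)
  rw [inner_add_left, real_inner_smul_left, real_inner_self_eq_norm_sq, hn] at h2
  linarith

theorem measurable_faceOsc {φ : Euc (m + 1) → ℝ} (hφ : ContDiff ℝ ∞ φ)
    (μ : Measure (Euc (m + 1))) [SFinite μ] :
    Measurable fun x => ∫⁻ y, ‖φ y - φ x‖ₑ ^ 2 ∂μ := by
  have h : Measurable fun p : Euc (m + 1) × Euc (m + 1) => ‖φ p.2 - φ p.1‖ₑ ^ 2 :=
    (((hφ.continuous.comp continuous_snd).sub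
      (hφ.continuous.comp continuous_fst)).enorm.measurable).pow_const 2
  exact h.lintegral_prod_right'

/-- Poincaré inequality on a face of a shape regular convex body. -/
theorem face_poincare (hT : Convex ℝ T) (hTm : MeasurableSet T) (hn : ‖n‖ = 1)
    (hS : S ⊆ T ∩ {x | inner ℝ x n = s}) (hSm : MeasurableSet S)
    (hTs : ∀ x ∈ T, inner ℝ x n ≤ s) (hρ : 0 < ρ) (hc : Metric.closedBall c ρ ⊆ T)
    (hD : ∀ x ∈ T, ∀ y ∈ T, dist x y ≤ D) {κ : ℝ} (hκ : D ≤ κ * ρ)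
    {φ : Euc (m + 1) → ℝ} (hφ : ContDiff ℝ ∞ φ) :
    ∃ a : ℝ, ∫⁻ y in S, ‖φ y - a‖ₑ ^ 2 ∂(Measure.euclideanHausdorffMeasure m)
      ≤ ENNReal.ofReal (faceConst m κ * D) * ∫⁻ x in T, ‖gradient φ x‖ₑ ^ 2 := by
  have hcT : c ∈ T := hc (Metric.mem_closedBall_self hρ.le)
  have hD0 : 0 ≤ D := dist_nonneg.trans (hD c hcT c hcT)
  have hκ0 : 0 ≤ κ := nonneg_of_mul_nonneg_left (hD0.trans hκ) hρ
  set B := Metric.closedBall c (ρ / 2) with hBdef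
  have hB : B ⊆ T := (Metric.closedBall_subset_closedBall (by linarith)).trans hc
  have hSle : Measure.euclideanHausdorffMeasure m S
      ≤ ENNReal.ofReal (D ^ m) * volume (Metric.ball (0 : Euc m) 1) :=
    hyperplane_measure_le hn hD0 (fun x hx => (hS hx).2)
      fun x hx y hy => hD x (hS hx).1 y (hS hy).1
  have hSfin : Measure.euclideanHausdorffMeasure m S < ⊤ :=
    hSle.trans_lt (ENNReal.mul_lt_top ENNReal.ofReal_lt_top measure_ball_lt_top)
  have : IsFiniteMeasure ((Measure.euclideanHausdorffMeasure m).restrict S) :=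
    ⟨by rwa [Measure.restrict_apply_univ]⟩
  have hcore := face_poincare_core hT hTm hn hS hSm hSfin (by linarith : 0 < ρ / 2) hD
    Metric.isClosed_closedBall.measurableSet hB
    (fun x hx => inner_le_of_closedBall_subset hn hρ hc hTs hx) hφ
  set I := ∫⁻ x in T, ‖gradient φ x‖ₑ ^ 2
  have hB0 : volume B ≠ 0 := measure_closedBall_half_pos c hρ
  have hBtop : volume B ≠ ⊤ := measure_closedBall_lt_top.ne
  -- The approximating constant is the value of `φ` at a point of `B` where the squared oscillation
  -- over `S` is at most its mean over `B`.
  obtain ⟨x, _, hx⟩ := exists_le_setLAverage hB0 hBtop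
    (measurable_faceOsc hφ ((Measure.euclideanHausdorffMeasure m).restrict S)).aemeasurable
  refine ⟨φ x, hx.trans ?_⟩
  rw [setLAverage_eq]
  refine (ENNReal.div_le_of_le_mul ?_)
  refine hcore.trans ?_
  have hB1 : volume B = ENNReal.ofReal ((ρ / 2) ^ (m + 1)
      * (volume (Metric.ball (0 : Euc (m + 1)) 1)).toReal) := by
    rw [hBdef, volume_closedBall_le c (by linarith), ENNReal.ofReal_mul (by positivity),
      ENNReal.ofReal_toReal measure_ball_lt_top.ne]
  set w₀ := (volume (Metric.ball (0 : Euc m) 1)).toReal with hw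
  set w₁ := (volume (Metric.ball (0 : Euc (m + 1)) 1)).toReal with hw₁
  have hw₁0 : 0 < w₁ := ENNReal.toReal_pos
    (Metric.measure_ball_pos volume _ one_pos).ne' measure_ball_lt_top.ne
  have hS1 : Measure.euclideanHausdorffMeasure m S ≤ ENNReal.ofReal (D ^ m * w₀) := by
    rwa [ENNReal.ofReal_mul (by positivity), hw, ENNReal.ofReal_toReal measure_ball_lt_top.ne]
  have h2 : ∀ k : ℕ, (2 : ENNReal) ^ k = ENNReal.ofReal (2 ^ k) := fun k => by
    rw [ENNReal.ofReal_pow (by norm_num)]; simp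
  have hw0 : 0 ≤ w₀ := ENNReal.toReal_nonneg
  calc _ ≤ ENNReal.ofReal (D ^ 2) * ((ENNReal.ofReal (2 ^ (m + 1)) * I) * ENNReal.ofReal (D ^ m * w₀)
        + (ENNReal.ofReal (2 ^ m) * ENNReal.ofReal (1 / (ρ / 2)) * I)
          * ENNReal.ofReal ((ρ / 2) ^ (m + 1) * w₁)) := by
        rw [h2, h2, hB1]
        gcongr
    _ = (ENNReal.ofReal (D ^ 2 * (2 ^ (m + 1) * (D ^ m * w₀)
          + 2 ^ m * (1 / (ρ / 2)) * ((ρ / 2) ^ (m + 1) * w₁)))) * I := by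
        rw [ENNReal.ofReal_mul (p := D ^ 2) (by positivity),
          ENNReal.ofReal_add (by positivity) (by positivity),
          ENNReal.ofReal_mul (p := 2 ^ (m + 1)) (by positivity),
          ENNReal.ofReal_mul (p := 2 ^ m * (1 / (ρ / 2))) (by positivity),
          ENNReal.ofReal_mul (p := 2 ^ m) (by positivity)]
        ring
    _ ≤ (ENNReal.ofReal (faceConst m κ * D * ((ρ / 2) ^ (m + 1) * w₁))) * I := by
        refine mul_le_mul_left (ENNReal.ofReal_le_ofReal ?_) I
        -- Since `D ≤ κ ρ`, all powers of `D` but one cancel against the volume of `B`. The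
        -- remaining factor `D` is what becomes `h`, and `√h` after taking roots.
        have e1 : faceConst m κ * D * ((ρ / 2) ^ (m + 1) * w₁)
            = 2 ^ (m + 1) * D * (κ * ρ) ^ (m + 1) * w₀
              + 2 ^ (m + 1) * (κ * D) * ((ρ / 2) ^ (m + 1) * w₁) := by
          unfold faceConst
          rw [← hw, ← hw₁]
          have e0 : (κ * ρ) ^ (m + 1) = (2 * κ) ^ (m + 1) * (ρ / 2) ^ (m + 1) := by
            rw [← mul_pow]; congr 1; ring
          rw [e0]
          generalize (2 * κ) ^ (m + 1) = p
          generalize (ρ / 2) ^ (m + 1) = q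
          field_simp
        have e2 : D ^ 2 * (2 ^ (m + 1) * (D ^ m * w₀)
            + 2 ^ m * (1 / (ρ / 2)) * ((ρ / 2) ^ (m + 1) * w₁))
            = 2 ^ (m + 1) * D * D ^ (m + 1) * w₀
              + 2 ^ (m + 1) * (D ^ 2 / ρ) * ((ρ / 2) ^ (m + 1) * w₁) := by
          field_simp
          ring
        rw [e1, e2]
        have h3 : D ^ 2 / ρ ≤ κ * D := by
          rw [div_le_iff₀ hρ]; nlinarith
        gcongr
    _ = _ := by
        rw [ENNReal.ofReal_mul (mul_nonneg (faceConst_nonneg m hκ0) hD0), hB1]; ring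

/-- Trace inequality on a face of a convex body. -/
theorem face_trace (hT : Convex ℝ T) (hTm : MeasurableSet T) (hn : ‖n‖ = 1)
    (hS : S ⊆ T ∩ {x | inner ℝ x n = s}) (hSm : MeasurableSet S)
    (hTs : ∀ x ∈ T, inner ℝ x n ≤ s) (hρ : 0 < ρ) (hc : Metric.closedBall c ρ ⊆ T)
    (hD : ∀ x ∈ T, ∀ y ∈ T, dist x y ≤ D) :
    ∃ C : NNReal, ∀ φ : Euc (m + 1) → ℝ, ContDiff ℝ ∞ φ →
      ∫⁻ y in S, ‖φ y‖ₑ ^ 2 ∂(Measure.euclideanHausdorffMeasure m)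
        ≤ C * ((∫⁻ x in T, ‖φ x‖ₑ ^ 2) + ∫⁻ x in T, ‖gradient φ x‖ₑ ^ 2) := by
  have hcT : c ∈ T := hc (Metric.mem_closedBall_self hρ.le)
  have hD0 : 0 ≤ D := dist_nonneg.trans (hD c hcT c hcT)
  set B := Metric.closedBall c (ρ / 2) with hBdef
  have hB : B ⊆ T := (Metric.closedBall_subset_closedBall (by linarith)).trans hc
  set σ := Measure.euclideanHausdorffMeasure m S with hσ
  have hSfin : σ < ⊤ :=
    (hyperplane_measure_le hn hD0 (fun x hx => (hS hx).2)
      fun x hx y hy => hD x (hS hx).1 y (hS hy).1).trans_lt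
      (ENNReal.mul_lt_top ENNReal.ofReal_lt_top measure_ball_lt_top)
  have : IsFiniteMeasure ((Measure.euclideanHausdorffMeasure m).restrict S) :=
    ⟨by rwa [Measure.restrict_apply_univ]⟩
  have hB0 : volume B ≠ 0 := measure_closedBall_half_pos c hρ
  have hBtop : volume B ≠ ⊤ := measure_closedBall_lt_top.ne
  set K : ENNReal := ENNReal.ofReal (D ^ 2) * (2 ^ (m + 1) * σ
    + 2 ^ m * ENNReal.ofReal (1 / (ρ / 2)) * volume B) with hK
  have hKtop : K ≠ ⊤ := by
    refine ENNReal.mul_ne_top ENNReal.ofReal_ne_top (ENNReal.add_ne_top.2 ⟨?_, ?_⟩)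
    · exact ENNReal.mul_ne_top (by simp) hSfin.ne
    · exact ENNReal.mul_ne_top (ENNReal.mul_ne_top (by simp) ENNReal.ofReal_ne_top) hBtop
  set C : ENNReal := (2 * σ + 2 * K) / volume B with hCdef
  have hC : C ≠ ⊤ := ENNReal.div_ne_top (ENNReal.add_ne_top.2
    ⟨ENNReal.mul_ne_top (by simp) hSfin.ne, ENNReal.mul_ne_top (by simp) hKtop⟩) hB0
  refine ⟨C.toNNReal, fun φ hφ => ?_⟩
  rw [ENNReal.coe_toNNReal hC]
  have hcore := face_poincare_core hT hTm hn hS hSm hSfin (by linarith : 0 < ρ / 2) hD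
    Metric.isClosed_closedBall.measurableSet hB
    (fun x hx => inner_le_of_closedBall_subset hn hρ hc hTs hx) hφ
  set I := ∫⁻ x in T, ‖gradient φ x‖ₑ ^ 2
  have hm0 : Measurable fun x => ‖φ x‖ₑ ^ 2 := (hφ.continuous.enorm.measurable).pow_const 2
  -- Averaging this over `x ∈ B` bounds the boundary values by the interior values plus the
  -- oscillation.
  have hpt : ∀ x y, ‖φ y‖ₑ ^ 2 ≤ 2 * ‖φ x‖ₑ ^ 2 + 2 * ‖φ y - φ x‖ₑ ^ 2 := by
    intro x y
    simp only [← ofReal_norm, ← ENNReal.ofReal_pow (norm_nonneg _)]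
    rw [show (2 : ENNReal) = ENNReal.ofReal 2 by simp, ← ENNReal.ofReal_mul (by norm_num),
      ← ENNReal.ofReal_mul (by norm_num), ← ENNReal.ofReal_add (by positivity) (by positivity)]
    refine ENNReal.ofReal_le_ofReal ?_
    simp only [Real.norm_eq_abs, sq_abs]
    nlinarith [sq_nonneg (φ x - (φ y - φ x))]
  have h1 : ∫⁻ x in B, ∫⁻ y in S, ‖φ y‖ₑ ^ 2 ∂(Measure.euclideanHausdorffMeasure m)
      ≤ 2 * σ * (∫⁻ x in T, ‖φ x‖ₑ ^ 2) + 2 * (K * I) := by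
    calc _ ≤ ∫⁻ x in B, (2 * σ * ‖φ x‖ₑ ^ 2 + 2 * ∫⁻ y in S, ‖φ y - φ x‖ₑ ^ 2
            ∂(Measure.euclideanHausdorffMeasure m)) := by
          refine lintegral_mono fun x => ?_
          calc _ ≤ ∫⁻ y in S, (2 * ‖φ x‖ₑ ^ 2 + 2 * ‖φ y - φ x‖ₑ ^ 2)
                ∂(Measure.euclideanHausdorffMeasure m) := lintegral_mono fun y => hpt x y
            _ = _ := by
              rw [lintegral_add_left measurable_const, lintegral_const, Measure.restrict_apply_univ,
                lintegral_const_mul' _ _ (by simp)]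
              ring
      _ = 2 * σ * (∫⁻ x in B, ‖φ x‖ₑ ^ 2) + 2 * ∫⁻ x in B, ∫⁻ y in S, ‖φ y - φ x‖ₑ ^ 2
            ∂(Measure.euclideanHausdorffMeasure m) := by
          rw [lintegral_add_left (hm0.const_mul _), lintegral_const_mul _ hm0,
            lintegral_const_mul' _ _ (by simp)]
      _ ≤ _ := by
          gcongr
          refine hcore.trans (le_of_eq ?_)
          rw [hK]; ring
  rw [lintegral_const, Measure.restrict_apply_univ] at h1
  have h2 : (2 * σ * (∫⁻ x in T, ‖φ x‖ₑ ^ 2) + 2 * (K * I))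
      ≤ (2 * σ + 2 * K) * ((∫⁻ x in T, ‖φ x‖ₑ ^ 2) + I) := by
    calc _ ≤ (2 * σ * (∫⁻ x in T, ‖φ x‖ₑ ^ 2) + 2 * (K * I))
          + (2 * σ * I + 2 * K * (∫⁻ x in T, ‖φ x‖ₑ ^ 2)) := le_self_add
      _ = _ := by ring
  rw [hCdef, ENNReal.div_eq_inv_mul, mul_assoc, ← ENNReal.div_eq_inv_mul,
    ENNReal.le_div_iff_mul_le (Or.inl hB0) (Or.inl hBtop)]
  exact h1.trans h2

end Face

/-! ### Faces of simplices -/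

/-- The differences of `m + 1` points span at most `m` dimensions, so some nonzero vector is
orthogonal to all of them; its sign is chosen so that `a` lies on the lower side. -/
theorem exists_face_normal {m : ℕ} {e : Finset (Euc (m + 1))} (he : e.card = m + 1)
    (a : Euc (m + 1)) :
    ∃ (n : Euc (m + 1)) (s : ℝ), ‖n‖ = 1 ∧ (∀ x ∈ e, inner ℝ x n = s) ∧ inner ℝ a n ≤ s := by
  classical
  obtain ⟨x0, hx0⟩ : e.Nonempty := Finset.card_pos.1 (by omega)
  let W := Submodule.span ℝ (((e.erase x0).image fun x => x - x0 : Finset (Euc (m + 1))) :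
    Set (Euc (m + 1)))
  have hW : Module.finrank ℝ W < m + 1 := by
    refine (finrank_span_finset_le_card (R := ℝ) _).trans_lt ?_
    refine Finset.card_image_le.trans_lt ?_
    rw [Finset.card_erase_of_mem hx0, he]; omega
  have hne : Wᗮ ≠ ⊥ := by
    intro h
    rw [Submodule.orthogonal_eq_bot_iff] at h
    rw [h, finrank_top] at hW
    simp at hW
  obtain ⟨v, hv, hv0⟩ := Submodule.exists_mem_ne_zero_of_ne_bot hne
  have hx : ∀ x ∈ e, inner ℝ x v = inner ℝ x0 v := by
    intro x hx
    by_cases h : x = x0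
    · rw [h]
    · have h1 : x - x0 ∈ W := Submodule.subset_span (by
        simp only [Finset.coe_image, mem_image, Finset.mem_coe]
        exact ⟨x, Finset.mem_erase.2 ⟨h, hx⟩, rfl⟩)
      have h2 := (Submodule.mem_orthogonal W v).1 hv _ h1
      rw [inner_sub_left] at h2
      linarith
  rcases le_total (inner ℝ a v : ℝ) (inner ℝ x0 v) with h | h
  · refine ⟨‖v‖⁻¹ • v, ‖v‖⁻¹ * inner ℝ x0 v, norm_unit hv0, fun x h1 => ?_, ?_⟩
    · rw [real_inner_smul_right, hx x h1]
    · rw [real_inner_smul_right]; gcongr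
  · refine ⟨-(‖v‖⁻¹ • v), -(‖v‖⁻¹ * inner ℝ x0 v), by rw [norm_neg, norm_unit hv0],
      fun x h1 => ?_, ?_⟩
    · rw [inner_neg_right, real_inner_smul_right, hx x h1]
    · rw [inner_neg_right, real_inner_smul_right, neg_le_neg_iff]; gcongr

/-- Purity provides an element with exactly one vertex besides those of `e`. Orienting the normal
away from this vertex puts the whole simplex on one side of the plane of `e`. -/
theorem exists_element {m : ℕ} {O S : Set (Euc (m + 1))}
    {K : Geometry.SimplicialComplex ℝ (Euc (m + 1))} (hK : IsTriangulation O S K)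
    {e : Finset (Euc (m + 1))} (he : e ∈ inheritedPartition S K) :
    ∃ T ∈ K.faces, e ⊆ T ∧ T.card = m + 1 + 1 ∧ ∃ (n : Euc (m + 1)) (s : ℝ), ‖n‖ = 1 ∧
      convexHull ℝ (e : Set (Euc (m + 1))) ⊆
        convexHull ℝ (T : Set (Euc (m + 1))) ∩ {x | inner ℝ x n = s} ∧
      ∀ x ∈ convexHull ℝ (T : Set (Euc (m + 1))), inner ℝ x n ≤ s := by
  classical
  obtain ⟨T, hT, heT, hcard⟩ := hK.pure e he.1
  obtain ⟨a, ha⟩ := Finset.card_eq_one.1 (by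
    rw [Finset.card_sdiff_of_subset heT, hcard, he.2.1]; omega : (T \ e).card = 1)
  obtain ⟨n, s, hn, hs, has⟩ := exists_face_normal he.2.1 a
  have hlin : IsLinearMap ℝ fun x : Euc (m + 1) => (inner ℝ x n : ℝ) :=
    ⟨fun x y => inner_add_left _ _ _, fun c x => real_inner_smul_left _ _ _⟩
  refine ⟨T, hT, heT, hcard, n, s, hn, subset_inter (convexHull_mono heT) ?_, ?_⟩
  · exact convexHull_min (fun x hx => hs x hx) (convex_hyperplane hlin s)
  · refine convexHull_min (fun x hx => ?_) (convex_halfSpace_le hlin s)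
    by_cases h : x ∈ e
    · exact (hs x h).le
    · have : x ∈ T \ e := Finset.mem_sdiff.2 ⟨hx, h⟩
      rw [ha, Finset.mem_singleton] at this
      rw [this]; exact has

/-! ### Restriction of boundary values -/

theorem enorm_sq_eq_lintegral {α F : Type*} [MeasurableSpace α] [NormedAddCommGroup F]
    {μ : Measure α} (f : Lp F 2 μ) : ‖f‖ₑ ^ 2 = ∫⁻ x, ‖f x‖ₑ ^ 2 ∂μ := by
  have h := eLpNorm_nnreal_pow_eq_lintegral (μ := μ) (f := f) (p := 2) (by norm_num)
  rw [Lp.enorm_def]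
  simpa using h

theorem enorm_sq_congr {α F : Type*} [MeasurableSpace α] [NormedAddCommGroup F]
    {μ : Measure α} (f : Lp F 2 μ) {g : α → F} (h : f =ᵐ[μ] g) :
    ‖f‖ₑ ^ 2 = ∫⁻ x, ‖g x‖ₑ ^ 2 ∂μ := by
  rw [enorm_sq_eq_lintegral]
  refine lintegral_congr_ae (h.mono fun x hx => ?_)
  simp only [hx]

theorem surface_mono {d : ℕ} {S S' : Set (Euc d)} (h : S' ⊆ S) : surface S' ≤ surface S :=
  Measure.restrict_mono h le_rfl

/-- Restriction of square integrable functions to a smaller part of a hypersurface. -/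
noncomputable def resL2 {d : ℕ} {S S' : Set (Euc d)} (h : S' ⊆ S) : L2S S →L[ℝ] L2S S' :=
  LinearMap.mkContinuous
    { toFun := fun f => ((Lp.memLp f).mono_measure (surface_mono h)).toLp
      map_add' := fun f g => by
        rw [← MemLp.toLp_add]
        exact MemLp.toLp_congr _ _ (ae_mono (surface_mono h) (Lp.coeFn_add f g))
      map_smul' := fun c f => by
        rw [RingHom.id_apply, ← MemLp.toLp_const_smul]
        exact MemLp.toLp_congr _ _ (ae_mono (surface_mono h) (Lp.coeFn_smul c f)) } 1
    (fun f => by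
      rw [one_mul]
      simp only [LinearMap.coe_mk, AddHom.coe_mk, Lp.norm_toLp]
      exact ENNReal.toReal_mono (Lp.eLpNorm_ne_top f) (eLpNorm_mono_measure _ (surface_mono h)))

theorem resL2_coe {d : ℕ} {S S' : Set (Euc d)} (h : S' ⊆ S) (f : L2S S) :
    resL2 h f =ᵐ[surface S'] f :=
  MemLp.coeFn_toLp ((Lp.memLp f).mono_measure (surface_mono h))

theorem interface_subset_stokes {d : ℕ} {ΩS ΩD : Set (Euc d)} :
    interface ΩS ΩD ⊆ frontier ΩS := inter_subset_left

theorem interface_subset_darcy {d : ℕ} {ΩS ΩD : Set (Euc d)} :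
    interface ΩS ΩD ⊆ frontier ΩD := inter_subset_right

theorem H1_enorm_sq {d : ℕ} {O : Set (Euc d)} (w : H1 O) :
    ‖w‖ₑ ^ 2 = ‖w.1.fst‖ₑ ^ 2 + ‖w.1.snd‖ₑ ^ 2 := by
  simp only [← ofReal_norm, ← ENNReal.ofReal_pow (norm_nonneg _)]
  rw [← ENNReal.ofReal_add (by positivity) (by positivity), ← WithLp.prod_norm_sq_eq_of_L2]
  rfl

theorem H1_enorm_sq_smooth {d : ℕ} {O : Set (Euc d)} {w : H1 O} {φ : Euc d → ℝ}
    (h1 : w.1.fst =ᵐ[volume.restrict O] φ) (h2 : w.1.snd =ᵐ[volume.restrict O] gradient φ) :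
    ‖w‖ₑ ^ 2 = (∫⁻ x in O, ‖φ x‖ₑ ^ 2) + ∫⁻ x in O, ‖gradient φ x‖ₑ ^ 2 := by
  rw [H1_enorm_sq, enorm_sq_congr _ h1, enorm_sq_congr _ h2]

/-- Traces are defined by closing the graph of the restriction of smooth functions. Hence a closed
relation between `w` and its trace needs checking only for smooth functions. -/
theorem HasTrace.of_smooth {d : ℕ} {O : Set (Euc d)} {P : H1 O → L2S (frontier O) → Prop}
    (hcl : IsClosed {p : H1 O × L2S (frontier O) | P p.1 p.2})
    (hP : ∀ (w : H1 O) (t : L2S (frontier O)) (φ : Euc d → ℝ), ContDiff ℝ ∞ φ →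
      w.1.fst =ᵐ[volume.restrict O] φ → w.1.snd =ᵐ[volume.restrict O] gradient φ →
      t =ᵐ[surface (frontier O)] φ → P w t)
    {w : H1 O} {t : L2S (frontier O)} (h : HasTrace O w t) : P w t := by
  have h1 : (w, t) ∈ closure (smoothGraph O : Set (H1 O × L2S (frontier O))) := by
    rw [← Submodule.topologicalClosure_coe]; exact h
  have h2 : (smoothGraph O : Set (H1 O × L2S (frontier O))) ⊆ {p | P p.1 p.2} := by
    rintro ⟨w', t'⟩ ⟨φ, hφ, h1, h2, h3⟩
    exact hP w' t' φ hφ h1 h2 h3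
  exact closure_minimal h2 hcl h1

theorem norm_le_of_enorm_sq_le {E F : Type*} [SeminormedAddCommGroup E] [SeminormedAddCommGroup F]
    {x : E} {y : F} {C : ℝ} (hC : 0 ≤ C) (h : ‖x‖ₑ ^ 2 ≤ ENNReal.ofReal C * ‖y‖ₑ ^ 2) :
    ‖x‖ ≤ Real.sqrt C * ‖y‖ := by
  simp only [← ofReal_norm, ← ENNReal.ofReal_pow (norm_nonneg _)] at h
  rw [← ENNReal.ofReal_mul hC, ENNReal.ofReal_le_ofReal_iff (by positivity)] at h
  refine (sq_le_sq₀ (norm_nonneg _) (by positivity)).1 ?_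
  rwa [mul_pow, Real.sq_sqrt hC]

theorem lintegral_biUnion_finset_le {α ι : Type*} [MeasurableSpace α] {μ : Measure α}
    (s : Finset ι) (t : ι → Set α) (f : α → ENNReal) :
    ∫⁻ x in ⋃ i ∈ s, t i, f x ∂μ ≤ ∑ i ∈ s, ∫⁻ x in t i, f x ∂μ := by
  classical
  induction s using Finset.induction_on with
  | empty => simp
  | insert a s ha ih =>
    rw [Finset.set_biUnion_insert, Finset.sum_insert ha]
    exact (lintegral_union_le _ _ _).trans (add_le_add le_rfl ih)

/-! ### Null intersections in a simplicial complex -/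

/-- At most `k` points lie in an affine subspace of dimension below `k`, so the Hausdorff dimension
of their hull is below `k`. -/
theorem hausdorff_convexHull_eq_zero {d k : ℕ} {f : Finset (Euc d)} (hf : f.card ≤ k) :
    (Measure.euclideanHausdorffMeasure k : Measure (Euc d))
      (convexHull ℝ (f : Set (Euc d))) = 0 := by
  classical
  rcases f.eq_empty_or_nonempty with rfl | ⟨x0, hx0⟩
  · simp
  · let W := Submodule.span ℝ (((f.erase x0).image fun x => x - x0 : Finset (Euc d)) : Set (Euc d))
    have hW : Module.finrank ℝ W < k := by
      refine (finrank_span_finset_le_card (R := ℝ) _).trans_lt ?_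
      refine Finset.card_image_le.trans_lt ?_
      rw [Finset.card_erase_of_mem hx0]
      have := Finset.card_pos.2 ⟨x0, hx0⟩
      omega
    have hiso : Isometry fun v : W => x0 + (v : Euc d) :=
      Isometry.of_dist_eq fun x y => by rw [dist_add_left]; rfl
    have hsub : convexHull ℝ (f : Set (Euc d)) ⊆ (fun v : W => x0 + (v : Euc d)) '' univ := by
      refine convexHull_min (fun x hx => ?_) ?_
      · refine ⟨⟨x - x0, ?_⟩, trivial, by simp⟩
        by_cases h : x = x0
        · simp [h]
        · refine Submodule.subset_span ?_
          simp only [Finset.coe_image, mem_image, Finset.mem_coe]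
          exact ⟨x, Finset.mem_erase.2 ⟨h, hx⟩, rfl⟩
      · rintro _ ⟨v, -, rfl⟩ _ ⟨w, -, rfl⟩ a b ha hb hab
        refine ⟨a • v + b • w, trivial, ?_⟩
        have : x0 = a • x0 + b • x0 := by rw [← add_smul, hab, one_smul]
        simp only [Submodule.coe_add, Submodule.coe_smul, smul_add]
        nth_rw 1 [this]
        abel
    have hdim : dimH (convexHull ℝ (f : Set (Euc d))) < ((k : NNReal) : ENNReal) := by
      refine (dimH_mono hsub).trans_lt ?_
      rw [hiso.dimH_image, Real.dimH_univ_eq_finrank]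
      exact_mod_cast hW
    have h0 := hausdorffMeasure_of_dimH_lt hdim
    rw [Measure.euclideanHausdorffMeasure_def, Measure.smul_apply]
    simp only [NNReal.coe_natCast] at h0
    rw [h0, smul_zero]

/-- Two faces of a complex meet inside the hull of their common vertices, and distinct faces with `k
+ 1` vertices share at most `k`. This serves both interface faces and full elements. -/
theorem hausdorff_inter_faces {d k : ℕ} {K : Geometry.SimplicialComplex ℝ (Euc d)}
    {e e' : Finset (Euc d)} (he : e ∈ K.faces) (he' : e' ∈ K.faces) (hk : e.card = k + 1)
    (hk' : e'.card = k + 1) (hne : e ≠ e') :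
    (Measure.euclideanHausdorffMeasure k : Measure (Euc d))
      (convexHull ℝ (e : Set (Euc d)) ∩ convexHull ℝ (e' : Set (Euc d))) = 0 := by
  classical
  refine measure_mono_null (K.inter_subset_convexHull he he') ?_
  rw [← Finset.coe_inter]
  refine hausdorff_convexHull_eq_zero ?_
  by_contra h
  have h1 : e ∩ e' = e := Finset.eq_of_subset_of_card_le Finset.inter_subset_left (by omega)
  have h2 : e ∩ e' = e' := Finset.eq_of_subset_of_card_le Finset.inter_subset_right (by omega)
  exact hne (h1.symm.trans h2)

/-! ### The trace theorem and piecewise constant approximation on a triangulated boundary part. -/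

section Triangulation

variable {m : ℕ} {O S : Set (Euc (m + 1))} {K : Geometry.SimplicialComplex ℝ (Euc (m + 1))}

theorem measurableSet_convexHull_finset {d : ℕ} (e : Finset (Euc d)) :
    MeasurableSet (convexHull ℝ (e : Set (Euc d))) :=
  (e.finite_toSet.isCompact_convexHull ℝ).isClosed.measurableSet

/-- Elements are contained only in `closure O`; the difference from `O` is null because the boundary
lies in finitely many hyperplanes. -/
theorem lintegral_element_le (hO : IsPolyhedralLipschitzDomain O) (hK : IsTriangulation O S K)
    {T : Finset (Euc (m + 1))} (hT : T ∈ K.faces) (f : Euc (m + 1) → ENNReal) :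
    ∫⁻ x in convexHull ℝ (T : Set (Euc (m + 1))), f x ≤ ∫⁻ x in O, f x := by
  have hsub : convexHull ℝ (T : Set (Euc (m + 1))) ⊆ closure O :=
    hK.space_eq ▸ K.convexHull_subset_space hT
  have h : volume.restrict (closure O) = volume.restrict O := by
    refine Measure.restrict_congr_set ?_
    have h1 := hO.volume_frontier
    rw [hO.isOpen.frontier_eq] at h1
    exact (ae_le_set.2 h1).antisymm subset_closure.eventuallyLE
  rw [← h]
  exact lintegral_mono_set hsub

theorem dist_le_diam_convexHull (T : Finset (Euc (m + 1))) :
    ∀ x ∈ convexHull ℝ (T : Set (Euc (m + 1))), ∀ y ∈ convexHull ℝ (T : Set (Euc (m + 1))),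
      dist x y ≤ Metric.diam (convexHull ℝ (T : Set (Euc (m + 1)))) := fun _ hx _ hy =>
  Metric.dist_le_diam_of_mem (T.finite_toSet.isCompact_convexHull ℝ).isBounded hx hy

/-- Every element of `K` contains a ball of radius comparable to its diameter. -/
def IsShapeRegular (K : Geometry.SimplicialComplex ℝ (Euc (m + 1))) (κ : ℝ) : Prop :=
  ∀ T ∈ K.faces, T.card = m + 1 + 1 → ∃ (c : Euc (m + 1)) (ρ : ℝ),
    0 < ρ ∧ Metric.closedBall c ρ ⊆ convexHull ℝ (T : Set (Euc (m + 1))) ∧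
    Metric.diam (convexHull ℝ (T : Set (Euc (m + 1)))) ≤ κ * ρ

/-- The inherited partition is finite. -/
noncomputable def facesIn (hK : IsTriangulation O S K) : Finset (Finset (Euc (m + 1))) :=
  (hK.finite.subset (fun _ h => h.1 : inheritedPartition S K ⊆ K.faces)).toFinset

theorem mem_facesIn (hK : IsTriangulation O S K) {e : Finset (Euc (m + 1))} :
    e ∈ facesIn hK ↔ e ∈ inheritedPartition S K := Finite.mem_toFinset _

theorem iUnion_facesIn (hK : IsTriangulation O S K) :
    ⋃ e ∈ facesIn hK, convexHull ℝ (e : Set (Euc (m + 1))) = S := by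
  simp only [mem_facesIn]
  exact hK.partition

theorem lintegral_surface_le (hK : IsTriangulation O S K) (f : Euc (m + 1) → ENNReal) :
    ∫⁻ x, f x ∂(surface S) ≤ ∑ e ∈ facesIn hK, ∫⁻ x in convexHull ℝ (e : Set (Euc (m + 1))), f x
      ∂(Measure.euclideanHausdorffMeasure m) := by
  conv_lhs => rw [surface, ← iUnion_facesIn hK]
  exact lintegral_biUnion_finset_le _ _ _

/-- The trace theorem on the triangulated part `S` of the boundary. -/
theorem exists_trace_bound (hO : IsPolyhedralLipschitzDomain O) (hK : IsTriangulation O S K)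
    {κ : ℝ} (hκ : IsShapeRegular K κ) (hS : S ⊆ frontier O) :
    ∃ C ≥ 0, ∀ (w : H1 O) (t : L2S (frontier O)), HasTrace O w t → ‖resL2 hS t‖ ≤ C * ‖w‖ := by
  have key : ∀ e ∈ facesIn hK, ∃ C : NNReal, ∀ φ : Euc (m + 1) → ℝ, ContDiff ℝ ∞ φ →
      ∫⁻ y in convexHull ℝ (e : Set (Euc (m + 1))), ‖φ y‖ₑ ^ 2
          ∂(Measure.euclideanHausdorffMeasure m)
        ≤ C * ((∫⁻ x in O, ‖φ x‖ₑ ^ 2) + ∫⁻ x in O, ‖gradient φ x‖ₑ ^ 2) := by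
    intro e he
    obtain ⟨T, hT, -, hcard, n, s, hn, hs, hTs⟩ := exists_element hK ((mem_facesIn hK).1 he)
    obtain ⟨c, ρ, hρ, hc, -⟩ := hκ T hT hcard
    obtain ⟨C, hC⟩ := face_trace (convex_convexHull ℝ _) (measurableSet_convexHull_finset T) hn hs
      (measurableSet_convexHull_finset e) hTs hρ hc (dist_le_diam_convexHull T)
    refine ⟨C, fun φ hφ => (hC φ hφ).trans ?_⟩
    exact mul_le_mul_right (add_le_add (lintegral_element_le hO hK hT _)
      (lintegral_element_le hO hK hT _)) _
  choose! C hC using key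
  -- Summing the face constants gives a bound that depends on `K`. This is harmless, since a single
  -- fixed triangulation suffices to obtain the trace theorem on `S`.
  refine ⟨Real.sqrt (∑ e ∈ facesIn hK, C e : NNReal), Real.sqrt_nonneg _, fun w t h => ?_⟩
  refine h.of_smooth (P := fun w t => ‖resL2 hS t‖ ≤ Real.sqrt (∑ e ∈ facesIn hK, C e : NNReal) * ‖w‖)
    (isClosed_le ((resL2 hS).continuous.comp continuous_snd).norm
      (continuous_const.mul continuous_fst.norm)) ?_
  intro w t φ hφ h1 h2 h3
  refine norm_le_of_enorm_sq_le (NNReal.coe_nonneg _) ?_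
  rw [enorm_sq_congr _ ((resL2_coe hS t).trans (ae_mono (surface_mono hS) h3)),
    H1_enorm_sq_smooth h1 h2, ENNReal.ofReal_coe_nnreal]
  calc _ ≤ ∑ e ∈ facesIn hK, ∫⁻ y in convexHull ℝ (e : Set (Euc (m + 1))), ‖φ y‖ₑ ^ 2
          ∂(Measure.euclideanHausdorffMeasure m) := by
        exact lintegral_surface_le hK _
    _ ≤ ∑ e ∈ facesIn hK, C e * ((∫⁻ x in O, ‖φ x‖ₑ ^ 2) + ∫⁻ x in O, ‖gradient φ x‖ₑ ^ 2) :=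
        Finset.sum_le_sum fun e he => hC e he φ hφ
    _ = _ := by rw [← Finset.sum_mul]; push_cast; rfl

theorem surface_convexHull_lt_top (hK : IsTriangulation O S K)
    {e : Finset (Euc (m + 1))} (he : e ∈ inheritedPartition S K) :
    (Measure.euclideanHausdorffMeasure m : Measure (Euc (m + 1)))
      (convexHull ℝ (e : Set (Euc (m + 1)))) < ⊤ := by
  obtain ⟨T, hT, -, hcard, n, s, hn, hs, hTs⟩ := exists_element hK he
  exact (hyperplane_measure_le hn Metric.diam_nonneg (fun x hx => (hs hx).2)
    (fun x hx y hy => dist_le_diam_convexHull T x (hs hx).1 y (hs hy).1)).trans_lt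
    (ENNReal.mul_lt_top ENNReal.ofReal_lt_top measure_ball_lt_top)

/-- A piecewise constant function with prescribed values on the faces. -/
theorem exists_piecewiseConstant (hK : IsTriangulation O S K)
    (a : Finset (Euc (m + 1)) → ℝ) :
    ∃ ψ : L2S S, ∀ e ∈ inheritedPartition S K,
      ∀ᵐ x ∂ surface (convexHull ℝ (e : Set (Euc (m + 1)))), ψ x = a e := by
  classical
  have hmem : MemLp (fun x => ∑ e ∈ facesIn hK,
      (convexHull ℝ (e : Set (Euc (m + 1)))).indicator (fun _ => a e) x) 2 (surface S) := by
    refine memLp_finsetSum _ fun e he => ?_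
    refine memLp_indicator_const 2 (measurableSet_convexHull_finset e) _ (Or.inr ?_)
    exact ((Measure.restrict_apply_le _ _).trans_lt
      (surface_convexHull_lt_top hK ((mem_facesIn hK).1 he))).ne
  refine ⟨hmem.toLp, fun e he => ?_⟩
  have h1 := ae_mono (surface_mono he.2.2) hmem.coeFn_toLp
  -- Faces overlap in null sets only, so at almost every point of `e` the sum of indicators reduces
  -- to the term of `e`.
  have h2 : ∀ᵐ x ∂ surface (convexHull ℝ (e : Set (Euc (m + 1)))),
      ∀ e' ∈ facesIn hK, e' ≠ e → x ∉ convexHull ℝ (e' : Set (Euc (m + 1))) := by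
    rw [Finset.eventually_all]
    intro e' he'
    by_cases hne : e' = e
    · exact Eventually.of_forall fun x h => absurd hne h
    · have h0 := hausdorff_inter_faces ((mem_facesIn hK).1 he').1 he.1
        ((mem_facesIn hK).1 he').2.1 he.2.1 hne
      have h3 : surface (convexHull ℝ (e : Set (Euc (m + 1))))
          (convexHull ℝ (e' : Set (Euc (m + 1)))) = 0 := by
        rw [surface, Measure.restrict_apply (measurableSet_convexHull_finset e')]
        exact h0
      exact (measure_eq_zero_iff_ae_notMem.1 h3).mono fun x hx _ => hx
  filter_upwards [h1, h2, ae_restrict_mem (measurableSet_convexHull_finset e)] with x hx1 hx2 hx3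
  rw [hx1, Finset.sum_eq_single e, indicator_of_mem hx3]
  · intro e' he' hne
    exact indicator_of_notMem (hx2 e' he' hne) _
  · intro h
    exact absurd ((mem_facesIn hK).2 he) h

theorem sum_elements_le (hO : IsPolyhedralLipschitzDomain O) (hK : IsTriangulation O S K)
    {A : Finset (Finset (Euc (m + 1)))} (hA : ∀ T ∈ A, T ∈ K.faces ∧ T.card = m + 1 + 1)
    (f : Euc (m + 1) → ENNReal) :
    ∑ T ∈ A, ∫⁻ x in convexHull ℝ (T : Set (Euc (m + 1))), f x ≤ ∫⁻ x in O, f x := by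
  rw [← lintegral_biUnion_finset₀ (μ := volume) (t := fun T : Finset (Euc (m + 1)) =>
    convexHull ℝ (T : Set (Euc (m + 1))))]
  · have hsub : (⋃ T ∈ A, convexHull ℝ (T : Set (Euc (m + 1)))) ⊆ closure O := by
      refine iUnion₂_subset fun T hT => ?_
      exact hK.space_eq ▸ K.convexHull_subset_space (hA T hT).1
    refine (lintegral_mono_set hsub).trans (le_of_eq ?_)
    congr 1
    refine Measure.restrict_congr_set ?_
    have h1 := hO.volume_frontier
    rw [hO.isOpen.frontier_eq] at h1
    exact (ae_le_set.2 h1).antisymm subset_closure.eventuallyLE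
  · intro T hT T' hT' hne
    have h := hausdorff_inter_faces (hA T hT).1 (hA T' hT').1 (hA T hT).2 (hA T' hT').2 hne
    rwa [EuclideanSpace.euclideanHausdorffMeasure_eq_volume] at h
  · exact fun T _ => (measurableSet_convexHull_finset T).nullMeasurableSet

/-- Approximation of traces by piecewise constant functions. -/
theorem infDist_piecewiseConstant_le (hO : IsPolyhedralLipschitzDomain O)
    (hK : IsTriangulation O S K) {κ h : ℝ} (hκ0 : 0 ≤ κ) (hκ : IsShapeRegular K κ) (hh : 0 ≤ h)
    (hsize : HasMeshSize K h) (hS : S ⊆ frontier O) (w : H1 O) (t : L2S (frontier O))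
    (hwt : HasTrace O w t) :
    Metric.infDist (resL2 hS t) {ψ | IsPiecewiseConstant S K ψ}
      ≤ Real.sqrt (2 ^ (m + 2) * faceConst m κ * h) * ‖w‖ := by
  classical
  -- Phrased through the distance to the piecewise constants, rather than through a chosen
  -- approximant, the estimate is closed in `(w, t)` and passes to the limit.
  refine hwt.of_smooth (P := fun w t => Metric.infDist (resL2 hS t) {ψ | IsPiecewiseConstant S K ψ}
      ≤ Real.sqrt (2 ^ (m + 2) * faceConst m κ * h) * ‖w‖)
    (isClosed_le ((Metric.continuous_infDist_pt _).comp ((resL2 hS).continuous.comp continuous_snd))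
      (continuous_const.mul continuous_fst.norm)) ?_
  intro w t φ hφ h1 h2 h3
  have hF := faceConst_nonneg m hκ0
  have key : ∀ e ∈ facesIn hK, ∃ T : Finset (Euc (m + 1)), ∃ a : ℝ,
      T ∈ K.faces ∧ T.card = m + 1 + 1 ∧ e ⊆ T ∧
      ∫⁻ y in convexHull ℝ (e : Set (Euc (m + 1))), ‖φ y - a‖ₑ ^ 2
        ∂(Measure.euclideanHausdorffMeasure m) ≤ ENNReal.ofReal (faceConst m κ * h) *
          ∫⁻ x in convexHull ℝ (T : Set (Euc (m + 1))), ‖gradient φ x‖ₑ ^ 2 := by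
    intro e he
    obtain ⟨T, hT, heT, hcard, n, s, hn, hs, hTs⟩ := exists_element hK ((mem_facesIn hK).1 he)
    obtain ⟨c, ρ, hρ, hc, hd⟩ := hκ T hT hcard
    obtain ⟨a, ha⟩ := face_poincare (convex_convexHull ℝ _) (measurableSet_convexHull_finset T) hn
      hs (measurableSet_convexHull_finset e) hTs hρ hc (dist_le_diam_convexHull T) hd hφ
    refine ⟨T, a, hT, hcard, heT, ha.trans ?_⟩
    gcongr
    exact hsize T hT hcard
  choose! T a hTK hTcard heT ha using key
  obtain ⟨ψ, hψ⟩ := exists_piecewiseConstant hK a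
  have hψP : IsPiecewiseConstant S K ψ := fun e he => ⟨a e, hψ e he⟩
  refine (Metric.infDist_le_dist_of_mem (show ψ ∈ {ψ | IsPiecewiseConstant S K ψ} from hψP)).trans ?_
  rw [dist_eq_norm]
  refine norm_le_of_enorm_sq_le (by positivity) ?_
  have hsub : ((resL2 hS t - ψ : L2S S) : Euc (m + 1) → ℝ) =ᵐ[surface S] fun x => φ x - ψ x := by
    filter_upwards [Lp.coeFn_sub (resL2 hS t) ψ, resL2_coe hS t, ae_mono (surface_mono hS) h3]
      with x e1 e2 e3
    rw [e1, Pi.sub_apply, e2, e3]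
  rw [enorm_sq_congr _ hsub]
  set G : Euc (m + 1) → ENNReal := fun x => ‖gradient φ x‖ₑ ^ 2 with hG
  calc ∫⁻ x, ‖φ x - ψ x‖ₑ ^ 2 ∂(surface S)
      ≤ ∑ e ∈ facesIn hK, ∫⁻ y in convexHull ℝ (e : Set (Euc (m + 1))), ‖φ y - ψ y‖ₑ ^ 2
          ∂(Measure.euclideanHausdorffMeasure m) := by
        exact lintegral_surface_le hK _
    _ ≤ ∑ e ∈ facesIn hK, ENNReal.ofReal (faceConst m κ * h) *
          ∫⁻ x in convexHull ℝ (T e : Set (Euc (m + 1))), G x := by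
        refine Finset.sum_le_sum fun e he => (le_of_eq ?_).trans (ha e he)
        refine lintegral_congr_ae ((hψ e ((mem_facesIn hK).1 he)).mono fun x hx => ?_)
        simp only [hx]
    _ = ENNReal.ofReal (faceConst m κ * h) * ∑ e ∈ facesIn hK,
          ∫⁻ x in convexHull ℝ (T e : Set (Euc (m + 1))), G x := by rw [Finset.mul_sum]
    _ ≤ ENNReal.ofReal (faceConst m κ * h) * (2 ^ (m + 2) * ∫⁻ x in O, G x) := by
        gcongr
        -- Several faces may have been assigned the same element. Each is a subset of its `m + 2`
        -- vertices, so there are at most `2 ^ (m + 2)` of them; distinct elements overlap in null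
        -- sets.
        rw [← Finset.sum_fiberwise_of_maps_to
          (fun e he => Finset.mem_image_of_mem T he : ∀ e ∈ facesIn hK, T e ∈ (facesIn hK).image T)]
        calc _ ≤ ∑ T' ∈ (facesIn hK).image T, 2 ^ (m + 2) *
              ∫⁻ x in convexHull ℝ (T' : Set (Euc (m + 1))), G x := by
              refine Finset.sum_le_sum fun T' hT' => ?_
              rw [Finset.sum_congr rfl (g := fun _ =>
                ∫⁻ x in convexHull ℝ (T' : Set (Euc (m + 1))), G x)
                (fun e he => by rw [(Finset.mem_filter.1 he).2]), Finset.sum_const, nsmul_eq_mul]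
              gcongr
              obtain ⟨e0, he0, rfl⟩ := Finset.mem_image.1 hT'
              have : ({e ∈ facesIn hK | T e = T e0} : Finset _).card ≤ 2 ^ (m + 2) := by
                rw [← hTcard e0 he0, ← Finset.card_powerset]
                refine Finset.card_le_card fun e he => ?_
                rw [Finset.mem_filter] at he
                rw [Finset.mem_powerset, ← he.2]
                exact heT e he.1
              exact_mod_cast this
          _ ≤ _ := by
              rw [← Finset.mul_sum]
              gcongr
              refine sum_elements_le hO hK (fun T' hT' => ?_) G
              obtain ⟨e0, he0, rfl⟩ := Finset.mem_image.1 hT'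
              exact ⟨hTK e0 he0, hTcard e0 he0⟩
    _ ≤ _ := by
        rw [H1_enorm_sq_smooth h1 h2, mul_assoc (2 ^ (m + 2)),
          ENNReal.ofReal_mul (p := 2 ^ (m + 2)) (by positivity),
          ENNReal.ofReal_pow (by norm_num), ENNReal.ofReal_ofNat]
        rw [mul_left_comm, mul_assoc]
        gcongr
        exact le_add_self

end Triangulation

/-! ### Smooth cutoff functions near the boundary -/

/-- A convolution with a probability density is an average of translates, and each translate has the
same Lipschitz constant. -/
theorem lipschitzWith_normed_convolution {d : ℕ} (ρ : ContDiffBump (0 : Euc d)) {g : Euc d → ℝ}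
    {L : NNReal} (hg : LipschitzWith L g) :
    LipschitzWith L (convolution (ρ.normed volume) g (ContinuousLinearMap.lsmul ℝ ℝ) volume) := by
  have hint : ∀ x, Integrable (fun t => ρ.normed volume t • g (x - t)) := fun x => by
    refine Continuous.integrable_of_hasCompactSupport ?_ ?_
    · exact ρ.continuous_normed.smul (hg.continuous.comp (by fun_prop))
    · exact ρ.hasCompactSupport_normed.smul_right
  refine LipschitzWith.of_dist_le_mul fun x y => ?_
  simp only [convolution, ContinuousLinearMap.lsmul_apply]
  rw [dist_eq_norm, ← integral_sub (hint x) (hint y)]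
  calc _ ≤ ∫ t, ρ.normed volume t * (L * dist x y) := by
        refine norm_integral_le_of_norm_le (ρ.integrable_normed.mul_const _)
          (Eventually.of_forall fun t => ?_)
        rw [← smul_sub, norm_smul, Real.norm_of_nonneg (ρ.nonneg_normed t)]
        refine mul_le_mul_of_nonneg_left ?_ (ρ.nonneg_normed t)
        rw [← dist_eq_norm]
        simpa using hg.dist_le_mul (x - t) (y - t)
    _ = L * dist x y := by
        rw [integral_mul_const, ρ.integral_normed, one_mul]

/-- These cutoffs tend to `1` inside `O` as `ε → 0`. Their gradients have size `1 / ε` on a strip of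
width of order `ε`, so `|∇θ|` acts as a multiple of surface measure in the limit. -/
theorem exists_cutoff {d : ℕ} {O : Set (Euc d)} (hb : Bornology.IsBounded O)
    {ε : ℝ} (hε : 0 < ε) :
    ∃ θ : Euc d → ℝ, IsTest O θ ∧ (∀ x, |θ x| ≤ 2) ∧
      (∀ x, 2 * ε ≤ Metric.infDist x Oᶜ → θ x = 1) ∧
      (∀ x, 2 * ε < Metric.infDist x Oᶜ → gradient θ x = 0) ∧
      ∀ x, ‖gradient θ x‖ ≤ 2 / ε := by
  set D : Euc d → ℝ := fun x => Metric.infDist x Oᶜ with hD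
  have hDL : LipschitzWith 1 D := Metric.lipschitz_infDist_pt _
  -- This ramp is `0` where `D ≤ ε / 2` and `1` where `D ≥ ε`. Mollifying at radius `ε / 4` keeps it
  -- `0` for `D ≤ ε / 4` and `1` for `D ≥ 2 ε`.
  set c : Euc d → ℝ := fun y => max 0 (min 1 (2 / ε * D y - 1)) with hc
  have hcL : LipschitzWith (2 / ε).toNNReal c := by
    have h1 : LipschitzWith (2 / ε).toNNReal fun y => 2 / ε * D y - 1 := by
      refine LipschitzWith.of_dist_le_mul fun x y => ?_
      rw [Real.dist_eq, sub_sub_sub_cancel_right, ← mul_sub, abs_mul, abs_of_pos (by positivity),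
        Real.coe_toNNReal _ (by positivity)]
      have := hDL.dist_le_mul x y
      rw [Real.dist_eq, NNReal.coe_one, one_mul] at this
      gcongr
    exact (h1.const_min 1).const_max 0
  have hc1 : ∀ y, |c y| ≤ 1 := fun y => by
    rw [abs_of_nonneg (le_max_left _ _)]
    exact max_le zero_le_one (min_le_left _ _)
  have hc0 : ∀ y, 0 ≤ c y := fun y => le_max_left _ _
  let ρ : ContDiffBump (0 : Euc d) := ⟨ε / 8, ε / 4, by positivity, by linarith⟩
  set θ := convolution (ρ.normed volume) c (ContinuousLinearMap.lsmul ℝ ℝ) volume with hθ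
  have hθsm : ContDiff ℝ ∞ θ := by
    have h := HasCompactSupport.contDiff_convolution_left (n := (⊤ : ℕ∞))
      (ContinuousLinearMap.lsmul ℝ ℝ) (ρ.hasCompactSupport_normed (μ := volume)) ρ.contDiff_normed
      (hcL.continuous.locallyIntegrable (μ := volume))
    exact h
  have hDball : ∀ x y, y ∈ Metric.ball x (ε / 4) → |D y - D x| ≤ ε / 4 := by
    intro x y hy
    have := hDL.dist_le_mul y x
    rw [Real.dist_eq, NNReal.coe_one, one_mul] at this
    exact this.trans (Metric.mem_ball.1 hy).le
  have hone : ∀ x, 2 * ε ≤ D x → θ x = 1 := by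
    intro x hx
    have h1 : ∀ y, ε ≤ D y → c y = 1 := by
      intro y hy
      have : 2 ≤ 2 / ε * D y := by
        rw [div_mul_eq_mul_div, le_div_iff₀ hε]; linarith
      simp only [hc]
      rw [min_eq_left (by linarith), max_eq_right zero_le_one]
    rw [hθ, ContDiffBump.normed_convolution_eq_right, h1 x (by linarith)]
    intro y hy
    have := abs_le.1 (hDball x y hy)
    rw [h1 y (by linarith [this.1]), h1 x (by linarith)]
  have hzero : ∀ x, D x ≤ ε / 4 → θ x = 0 := by
    intro x hx
    have h1 : ∀ y, D y ≤ ε / 2 → c y = 0 := by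
      intro y hy
      have : 2 / ε * D y ≤ 1 := by
        rw [div_mul_eq_mul_div, div_le_iff₀ hε]; linarith
      simp only [hc]
      rw [max_eq_left]
      exact (min_le_right _ _).trans (by linarith)
    rw [hθ, ContDiffBump.normed_convolution_eq_right, h1 x (by linarith)]
    intro y hy
    have := abs_le.1 (hDball x y hy)
    rw [h1 y (by linarith [this.2]), h1 x (by linarith)]
  have hsupp : tsupport θ ⊆ {x | ε / 4 ≤ D x} := by
    refine closure_minimal (fun x hx => ?_) (isClosed_le continuous_const hDL.continuous)
    by_contra h
    exact hx (hzero x (not_le.1 h).le)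
  have hsubO : {x | ε / 4 ≤ D x} ⊆ O := by
    intro x hx
    by_contra h
    have : D x = 0 := Metric.infDist_zero_of_mem (mem_compl h)
    have h2 : ε / 4 ≤ D x := hx
    linarith
  refine ⟨θ, ⟨hθsm, ?_, hsupp.trans hsubO⟩, ?_, hone, ?_, ?_⟩
  · exact Metric.isCompact_of_isClosed_isBounded (isClosed_tsupport _)
      (hb.subset (hsupp.trans hsubO))
  · intro x
    have h1 := ρ.dist_normed_convolution_le (μ := volume) (g := c) (x₀ := x) (ε := 1)
      hcL.continuous.aestronglyMeasurable (fun y _ => by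
        rw [Real.dist_eq, abs_le]
        have h2 := abs_le.1 (hc1 x)
        have h3 := abs_le.1 (hc1 y)
        constructor <;> linarith [hc0 x, hc0 y])
    rw [Real.dist_eq] at h1
    calc |θ x| = |(θ x - c x) + c x| := by rw [sub_add_cancel]
      _ ≤ |θ x - c x| + |c x| := abs_add_le _ _
      _ ≤ 1 + 1 := add_le_add h1 (hc1 x)
      _ = 2 := by norm_num
  · intro x hx
    have h1 : θ =ᶠ[𝓝 x] fun _ => 1 := by
      filter_upwards [(isOpen_lt continuous_const hDL.continuous).mem_nhds hx] with y hy
      exact hone y (le_of_lt hy)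
    simp [gradient, h1.fderiv_eq]
  · intro x
    rw [norm_gradient_eq]
    have h := norm_fderiv_le_of_lipschitz ℝ (lipschitzWith_normed_convolution ρ hcL) (x₀ := x)
    rwa [Real.coe_toNNReal _ (by positivity)] at h

/-! ### Integrals over a boundary strip -/

/-- The orthogonal coordinate `z` is a `1`-Lipschitz function of the point. It shows that a graph
has at least the area of its projection, so no area formula is needed. -/
theorem exists_frameProj {m : ℕ} {n : Euc (m + 1)} {U : Euc m →ₗᵢ[ℝ] Euc (m + 1)}
    (hn : ‖n‖ = 1) (hU : ∀ z, inner ℝ (U z) n = 0) :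
    ∃ p : Euc (m + 1) → Euc m, LipschitzWith 1 p ∧ ∀ z (s : ℝ), p (U z + s • n) = z := by
  obtain ⟨J, hJ⟩ := exists_frameEquiv hn hU
  refine ⟨fun x => (J.symm x).fst, LipschitzWith.of_dist_le_mul fun x y => ?_, fun z s => ?_⟩
  · rw [NNReal.coe_one, one_mul, ← J.symm.dist_map x y, dist_eq_norm, dist_eq_norm]
    have h := WithLp.prod_norm_sq_eq_of_L2 (J.symm x - J.symm y)
    refine (sq_le_sq₀ (norm_nonneg _) (norm_nonneg _)).1 ?_
    rw [h, WithLp.sub_fst]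
    nlinarith [sq_nonneg ‖(J.symm x - J.symm y).snd‖]
  · have : U z + s • n = J (WithLp.toLp 2 (z, s)) := by simp [hJ]
    simp [this]

theorem volume_image_le {m : ℕ} {p : Euc (m + 1) → Euc m} (hp : LipschitzWith 1 p)
    (A : Set (Euc (m + 1))) : volume (p '' A) ≤ Measure.euclideanHausdorffMeasure m A := by
  have h := hp.hausdorffMeasure_image_le (d := m) (by positivity) A
  rw [← EuclideanSpace.euclideanHausdorffMeasure_eq_volume, Measure.euclideanHausdorffMeasure_def,
    Measure.euclideanHausdorffMeasure_def, Measure.smul_apply, Measure.smul_apply]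
  gcongr
  simpa using h

/-- Area of a graph dominates the area of its projection. -/
theorem lintegral_graph_le {m : ℕ} {p : Euc (m + 1) → Euc m} (hp : LipschitzWith 1 p)
    {γ : Euc m → Euc (m + 1)} (hγ : Continuous γ) (hpγ : ∀ z, p (γ z) = z) {S : Set (Euc (m + 1))}
    {Z : Set (Euc m)} (hZ : ∀ z ∈ Z, γ z ∈ S) {f : Euc (m + 1) → ENNReal} (hf : Measurable f) :
    ∫⁻ z in Z, f (γ z) ≤ ∫⁻ x, f x ∂((Measure.euclideanHausdorffMeasure m).restrict S) := by
  rw [← lintegral_map hf hγ.measurable]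
  refine lintegral_mono' (Measure.le_iff.2 fun A hA => ?_) le_rfl
  rw [Measure.map_apply hγ.measurable hA, Measure.restrict_apply (hγ.measurable hA),
    Measure.restrict_apply hA]
  refine (measure_mono fun z hz => ?_).trans (volume_image_le hp (A ∩ S))
  exact ⟨γ z, ⟨hz.1, hZ z hz.2⟩, hpγ z⟩

theorem exists_lipschitz_on_ball {k : ℕ} {φ : Euc k → ℝ} (hφ : ContDiff ℝ ∞ φ) (x : Euc k) (r : ℝ) :
    ∃ L ≥ 0, ∀ y ∈ Metric.closedBall x r, ∀ z ∈ Metric.closedBall x r,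
      |φ y - φ z| ≤ L * dist y z := by
  obtain ⟨L, hL⟩ := (isCompact_closedBall x r).exists_bound_of_continuousOn
    (hφ.continuous_fderiv (by simp)).continuousOn
  refine ⟨max L 0, le_max_right _ _, fun y hy z hz => ?_⟩
  rw [dist_eq_norm, ← Real.norm_eq_abs]
  exact (convex_closedBall x r).norm_image_sub_le_of_norm_fderiv_le
    (fun w _ => hφ.differentiable (by simp) w) (fun w hw => (hL w hw).trans (le_max_left _ _)) hz hy

/-- A point near the boundary lies above a nearby boundary point. -/
theorem boundary_point {m : ℕ} {O : Set (Euc (m + 1))} (hO : IsOpen O) {x e : Euc (m + 1)}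
    {K : NNReal} {f : Euc (m + 1) → ℝ} {r : ℝ} (he : ‖e‖ = 1) (hf : LipschitzWith K f)
    (hfe : ∀ y, ∀ t : ℝ, f (y + t • e) = f y)
    (hgr : ∀ y ∈ Metric.ball x r, y ∈ O ↔ f y < inner ℝ y e)
    {η : ℝ} (hη : 0 < η) (hηr : 2 * (K + 1) * η < r / 2) {y : Euc (m + 1)} (hyO : y ∈ O)
    (hy : y ∈ Metric.ball x (r / 2)) (hyd : Metric.infDist y Oᶜ ≤ η) (hne : (Oᶜ).Nonempty) :
    f y < inner ℝ y e ∧ (inner ℝ y e : ℝ) ≤ f y + 2 * (K + 1) * η ∧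
      y + (f y - inner ℝ y e) • e ∈ frontier O ∩ Metric.ball x r := by
  have hK : (0 : ℝ) ≤ K := K.2
  have hηr2 : 2 * η < r / 2 := by nlinarith
  -- A nearly closest exterior point, at distance below `2 η`, suffices. Comparing heights at `y`
  -- and `z` then gives the thickness `2 (K + 1) η`: one part from the height coordinate, `K` parts
  -- from `f`.
  obtain ⟨z, hz, hyz⟩ := (Metric.infDist_lt_iff hne).1 (lt_of_le_of_lt hyd (by linarith : η < 2 * η))
  rw [Metric.mem_ball] at hy
  have hzb : z ∈ Metric.ball x r := by
    rw [Metric.mem_ball]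
    linarith [dist_triangle z y x, dist_comm y z]
  have hyb : y ∈ Metric.ball x r := by rw [Metric.mem_ball]; linarith [dist_nonneg (x := y) (y := x)]
  have h1 : f y < inner ℝ y e := (hgr y hyb).1 hyO
  have h2 : inner ℝ z e ≤ f z := not_lt.1 fun h => hz ((hgr z hzb).2 h)
  have h3 : |f z - f y| ≤ K * dist z y := by rw [← Real.dist_eq]; exact hf.dist_le_mul z y
  have h4 : |(inner ℝ y e : ℝ) - inner ℝ z e| ≤ dist y z := by
    rw [← inner_sub_left, dist_eq_norm]
    simpa [he] using abs_real_inner_le_norm (y - z) e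
  have h5 : (inner ℝ y e : ℝ) ≤ f y + 2 * (K + 1) * η := by
    have h6 := abs_le.1 h3
    have h7 := abs_le.1 h4
    rw [dist_comm z y] at h6
    nlinarith [mul_le_mul_of_nonneg_left hyz.le hK]
  refine ⟨h1, h5, ?_⟩
  set b := y + (f y - inner ℝ y e) • e with hb
  have hbe : inner ℝ b e = f y := by
    rw [hb, inner_add_left, real_inner_smul_left, real_inner_self_eq_norm_sq, he]; ring
  have hfb : f b = f y := hfe _ _
  have hbb : b ∈ Metric.ball x r := by
    rw [Metric.mem_ball]
    have : dist b y ≤ 2 * (K + 1) * η := by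
      rw [hb, dist_eq_norm, add_sub_cancel_left, norm_smul, he, mul_one, Real.norm_eq_abs,
        abs_of_nonpos (by linarith)]
      linarith
    linarith [dist_triangle b y x]
  refine ⟨?_, hbb⟩
  rw [hO.frontier_eq]
  refine ⟨?_, fun h => ?_⟩
  · have ht : Tendsto (fun δ : ℝ => b + δ • e) (𝓝[>] 0) (𝓝 b) := by
      have : Tendsto (fun δ : ℝ => b + δ • e) (𝓝 0) (𝓝 (b + (0 : ℝ) • e)) :=
        Continuous.tendsto (by fun_prop) 0
      rw [zero_smul, add_zero] at this
      exact this.mono_left nhdsWithin_le_nhds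
    refine mem_closure_of_tendsto ht ?_
    filter_upwards [ht.eventually (Metric.isOpen_ball.mem_nhds hbb), self_mem_nhdsWithin]
      with δ h1 h2
    rw [hgr _ h1, hfe, hfb, inner_add_left, hbe, real_inner_smul_left, real_inner_self_eq_norm_sq, he]
    have : (0 : ℝ) < δ := h2
    linarith
  · have := (hgr b hbb).1 h
    rw [hfb, hbe] at this
    exact lt_irrefl _ this

/-- In graph coordinates the strip lies within height `τ = 2 (K + 1) η` above the boundary, and `φ`
differs there by at most `L τ` from its value at the foot point. What matters is that `C` does not
depend on `φ`; the constant `M` may, because it enters with an additional factor `η`. -/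
theorem strip_local {m : ℕ} {O : Set (Euc (m + 1))} (hO : IsLipschitzDomain O)
    (hne : (Oᶜ).Nonempty) {x : Euc (m + 1)} (hx : x ∈ frontier O) :
    ∃ r > 0, ∃ C ≥ 0, ∃ η₀ > 0, ∀ φ : Euc (m + 1) → ℝ, ContDiff ℝ ∞ φ → ∃ M ≥ 0,
      ∀ η, 0 < η → η < η₀ →
      ∫⁻ y in O ∩ Metric.ball x r ∩ {y | Metric.infDist y Oᶜ ≤ η}, ‖φ y‖ₑ
        ≤ ENNReal.ofReal (C * η) * ((∫⁻ y, ‖φ y‖ₑ ∂(surface (frontier O)))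
          + ENNReal.ofReal (M * η)) := by
  obtain ⟨e, K, f, r, he, hf, hfe, hr, hgr⟩ := hO.graph x hx
  obtain ⟨U, hU⟩ := exists_frame he
  obtain ⟨p, hp, hpU⟩ := exists_frameProj he hU
  have hK : (0 : ℝ) ≤ K := K.2
  set F : Euc m → ℝ := fun z => f (U z) with hF
  have hFc : Continuous F := hf.continuous.comp U.continuous
  have hfU : ∀ z (s : ℝ), f (U z + s • e) = F z := fun z s => hfe _ _
  set γ : Euc m → Euc (m + 1) := fun z => U z + F z • e with hγ
  have hγc : Continuous γ := by fun_prop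
  set Z : Set (Euc m) := {z | γ z ∈ frontier O ∩ Metric.ball x r} with hZ
  have hZm : MeasurableSet Z :=
    (isClosed_frontier.measurableSet.inter Metric.isOpen_ball.measurableSet).preimage hγc.measurable
  have hZvol : volume Z < ⊤ := by
    refine (measure_mono fun z hz => ?_).trans_lt
      (measure_closedBall_lt_top (x := p x) (r := r))
    rw [Metric.mem_closedBall]
    have h1 := hp.dist_le_mul (γ z) x
    rw [hpU, NNReal.coe_one, one_mul] at h1
    exact h1.trans (Metric.mem_ball.1 hz.2).le
  set V := (volume Z).toReal with hV
  refine ⟨r / 2, by linarith, 2 * (K + 1), by positivity, r / (8 * (K + 1)), by positivity,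
    fun φ hφ => ?_⟩
  obtain ⟨L, hL0, hL⟩ := exists_lipschitz_on_ball hφ x r
  refine ⟨L * (2 * (K + 1)) * V, by positivity, fun η hη hη0 => ?_⟩
  set τ := 2 * (K + 1) * η with hτ
  have hτ0 : 0 < τ := by positivity
  have hτr : τ < r / 2 := by
    rw [lt_div_iff₀ (by positivity)] at hη0
    rw [hτ]; nlinarith
  set A := O ∩ Metric.ball x (r / 2) ∩ {y | Metric.infDist y Oᶜ ≤ η} with hA
  have hAm : MeasurableSet A := (hO.isOpen.measurableSet.inter Metric.isOpen_ball.measurableSet).inter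
    (isClosed_le (Metric.continuous_infDist_pt _) continuous_const).measurableSet
  have hφm : Measurable fun y => ‖φ y‖ₑ := hφ.continuous.enorm.measurable
  have hJ := frame_measurePreserving he hU
  set g : Euc m → ENNReal := fun z => ‖φ (γ z)‖ₑ + ENNReal.ofReal (L * τ) with hg
  have hgm : Measurable g := (hφm.comp hγc.measurable).add_const _
  -- On each vertical line the integrand is dominated by a constant on an interval of length `τ`.
  have hpt : ∀ (z : Euc m) (s : ℝ), A.indicator (fun y => ‖φ y‖ₑ) (U z + s • e)
      ≤ (Icc (F z) (F z + τ)).indicator (fun _ => Z.indicator g z) s := by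
    intro z s
    by_cases hy : U z + s • e ∈ A
    · have hb := boundary_point hO.isOpen he hf hfe hgr hη hτr hy.1.1 hy.1.2 hy.2 hne
      rw [hfU, inner_frame he hU] at hb
      obtain ⟨h1, h2, h3⟩ := hb
      have e1 : U z + s • e + (F z - s) • e = γ z := by rw [hγ]; module
      rw [e1] at h3
      rw [indicator_of_mem hy, indicator_of_mem (mem_Icc.2 ⟨h1.le, h2⟩),
        indicator_of_mem (show z ∈ Z from h3)]
      have hyb : U z + s • e ∈ Metric.closedBall x r := by
        have := Metric.mem_ball.1 hy.1.2
        rw [Metric.mem_closedBall]; linarith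
      have h4 := hL _ hyb _ (Metric.ball_subset_closedBall h3.2)
      have h5 : dist (U z + s • e) (γ z) ≤ τ := by
        rw [hγ, dist_eq_norm, add_sub_add_left_eq_sub, ← sub_smul, norm_smul, he, mul_one,
          Real.norm_eq_abs, abs_of_pos (by linarith)]
        linarith
      rw [hg]
      simp only [← ofReal_norm, Real.norm_eq_abs]
      rw [← ENNReal.ofReal_add (abs_nonneg _) (by positivity)]
      refine ENNReal.ofReal_le_ofReal ?_
      have h6 : |φ (U z + s • e)| - |φ (γ z)| ≤ |φ (U z + s • e) - φ (γ z)| :=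
        abs_sub_abs_le_abs_sub _ _
      have h7 : L * dist (U z + s • e) (γ z) ≤ L * τ := by gcongr
      linarith
    · rw [indicator_of_notMem hy]; exact zero_le
  calc ∫⁻ y in A, ‖φ y‖ₑ = ∫⁻ q : Euc m × ℝ, A.indicator (fun y => ‖φ y‖ₑ) (U q.1 + q.2 • e)
          ∂(volume.prod volume) := by
        rw [hJ.lintegral_comp (hφm.indicator hAm), lintegral_indicator hAm]
    _ = ∫⁻ z, ∫⁻ s, A.indicator (fun y => ‖φ y‖ₑ) (U z + s • e) :=
        lintegral_prod _ ((hφm.indicator hAm).comp hJ.measurable).aemeasurable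
    _ ≤ ∫⁻ z, ∫⁻ s, (Icc (F z) (F z + τ)).indicator (fun _ => Z.indicator g z) s :=
        lintegral_mono fun z => lintegral_mono fun s => hpt z s
    _ = ∫⁻ z, ENNReal.ofReal τ * Z.indicator g z := by
        refine lintegral_congr fun z => ?_
        rw [lintegral_indicator measurableSet_Icc, lintegral_const, Measure.restrict_apply_univ,
          Real.volume_Icc, add_sub_cancel_left, mul_comm]
    _ = ENNReal.ofReal τ * ∫⁻ z in Z, g z := by
        rw [lintegral_const_mul _ (hgm.indicator hZm), lintegral_indicator hZm]
    _ = ENNReal.ofReal τ * ((∫⁻ z in Z, ‖φ (γ z)‖ₑ) + ENNReal.ofReal (L * τ) * volume Z) := by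
        rw [hg, lintegral_add_right _ measurable_const, lintegral_const, Measure.restrict_apply_univ]
    _ ≤ _ := by
        gcongr
        · exact lintegral_graph_le hp hγc (fun z => hpU z _) (fun z hz => hz.1) hφm
        · rw [← ENNReal.ofReal_toReal hZvol.ne, ← ENNReal.ofReal_mul (by positivity)]
          refine ENNReal.ofReal_le_ofReal (le_of_eq ?_)
          rw [hτ, ← hV]; ring

/-- Finitely many charts cover the compact boundary and also a neighbourhood of it, which contains
every sufficiently thin strip. -/
theorem strip_global {m : ℕ} {O : Set (Euc (m + 1))} (hO : IsLipschitzDomain O)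
    (hne : (Oᶜ).Nonempty) :
    ∃ C ≥ 0, ∀ φ : Euc (m + 1) → ℝ, ContDiff ℝ ∞ φ → ∃ M ≥ 0, ∃ η₀ > 0, ∀ η, 0 < η → η < η₀ →
      ∫⁻ y in O ∩ {y | Metric.infDist y Oᶜ ≤ η}, ‖φ y‖ₑ
        ≤ ENNReal.ofReal (C * η) * ((∫⁻ y, ‖φ y‖ₑ ∂(surface (frontier O)))
          + ENNReal.ofReal (M * η)) := by
  classical
  choose! r hr C hC η₀ hη₀ hloc using fun (x : Euc (m + 1)) (hx : x ∈ frontier O) =>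
    strip_local hO hne hx
  obtain ⟨t, ht, hcov⟩ := hO.isCompact_frontier.elim_nhds_subcover (fun x => Metric.ball x (r x))
    fun x hx => Metric.ball_mem_nhds x (hr x hx)
  obtain ⟨δ, hδ, hthick⟩ := hO.isCompact_frontier.exists_thickening_subset_open
    (isOpen_biUnion fun x (_ : x ∈ t) => Metric.isOpen_ball) hcov
  obtain ⟨η₁, hη₁, hη₁t⟩ : ∃ η₁ > 0, ∀ x ∈ t, η₁ ≤ η₀ x := by
    rcases t.eq_empty_or_nonempty with h | h
    · exact ⟨1, one_pos, by simp [h]⟩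
    · refine ⟨t.inf' h η₀, ?_, fun x hx => Finset.inf'_le _ hx⟩
      exact (Finset.lt_inf'_iff h).2 fun x hx => hη₀ x (ht x hx)
  have hne2 : O ≠ univ := fun h => by simp [h] at hne
  refine ⟨∑ x ∈ t, C x, Finset.sum_nonneg fun x hx => hC x (ht x hx), fun φ hφ => ?_⟩
  choose! M hM hMφ using fun x hx => hloc x hx φ hφ
  refine ⟨∑ x ∈ t, M x, Finset.sum_nonneg fun x hx => hM x (ht x hx), min δ η₁,
    lt_min hδ hη₁, fun η hη hηlt => ?_⟩
  have hsub : O ∩ {y | Metric.infDist y Oᶜ ≤ η} ⊆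
      ⋃ x ∈ t, (O ∩ Metric.ball x (r x) ∩ {y | Metric.infDist y Oᶜ ≤ η}) := by
    rintro y ⟨hyO, hy⟩
    obtain ⟨z, hz, hyz⟩ := exists_mem_frontier_infDist_compl_eq_dist hyO hne2
    have h1 : y ∈ Metric.thickening δ (frontier O) := by
      rw [Metric.mem_thickening_iff]
      refine ⟨z, hz, ?_⟩
      rw [← hyz]
      exact lt_of_le_of_lt hy (hηlt.trans_le (min_le_left _ _))
    obtain ⟨x, hx, hyx⟩ := mem_iUnion₂.1 (hthick h1)
    exact mem_iUnion₂.2 ⟨x, hx, ⟨hyO, hyx⟩, hy⟩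
  refine (lintegral_mono_set hsub).trans ((lintegral_biUnion_finset_le _ _ _).trans ?_)
  rw [Finset.sum_mul, ENNReal.ofReal_sum_of_nonneg
    fun x hx => mul_nonneg (hC x (ht x hx)) hη.le, Finset.sum_mul]
  refine Finset.sum_le_sum fun x hx => ?_
  refine (hMφ x (ht x hx) η hη (hηlt.trans_le ((min_le_right _ _).trans (hη₁t x hx)))).trans ?_
  gcongr
  exact Finset.single_le_sum (fun x hx => hM x (ht x hx)) hx

/-! ### Bounded fields in `H(div)` have a square integrable normal trace -/

theorem greenPairing_eq {d : ℕ} {O : Set (Euc d)} (v : Hdiv O) (w : H1 O) {φ : Euc d → ℝ}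
    (h1 : w.1.fst =ᵐ[volume.restrict O] φ) (h2 : w.1.snd =ᵐ[volume.restrict O] gradient φ) :
    greenPairing O v w
      = (∫ x in O, inner ℝ (v.1.fst x) (gradient φ x)) + ∫ x in O, φ x * v.1.snd x := by
  rw [greenPairing, L2.inner_def, L2.inner_def]
  congr 1
  · exact integral_congr_ae (h2.mono fun x hx => by simp only [hx])
  · refine integral_congr_ae (h1.mono fun x hx => ?_)
    simp only [hx]
    simp

theorem integrable_of_continuous_closure {d : ℕ} {O : Set (Euc d)} {F : Type*}
    [NormedAddCommGroup F] (hb : Bornology.IsBounded O) {g : Euc d → F} (hg : Continuous g) :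
    MemLp g 2 (volume.restrict O) := by
  have hfin : IsFiniteMeasure (volume.restrict O) :=
    ⟨by rw [Measure.restrict_apply_univ]; exact hb.measure_lt_top⟩
  obtain ⟨C, hC⟩ := hb.isCompact_closure.exists_bound_of_continuousOn hg.continuousOn
  refine MemLp.of_bound hg.aestronglyMeasurable C ?_
  have h : ∀ᵐ x ∂volume.restrict (closure O), ‖g x‖ ≤ C :=
    (ae_restrict_mem isClosed_closure.measurableSet).mono fun x hx => hC x hx
  exact ae_restrict_of_ae_restrict_of_subset subset_closure h

theorem gradient_mul {d : ℕ} {θ φ : Euc d → ℝ} (hθ : ContDiff ℝ ∞ θ) (hφ : ContDiff ℝ ∞ φ)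
    (x : Euc d) : gradient (fun y => θ y * φ y) x = θ x • gradient φ x + φ x • gradient θ x := by
  have h := fderiv_fun_mul (hθ.differentiable (by simp) x) (hφ.differentiable (by simp) x)
  simp only [gradient, h, map_add, map_smulₛₗ]
  simp

/-- The weak divergence tested with `θ φ` contributes nothing to the Green functional, so only `(1 -
θ) φ` counts; the product rule separates the term with `∇θ`. -/
theorem green_cutoff {d : ℕ} {O : Set (Euc d)} (hb : Bornology.IsBounded O) (v : Hdiv O)
    {θ φ : Euc d → ℝ} (hθ : IsTest O θ) (hφ : ContDiff ℝ ∞ φ) :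
    (∫ x in O, inner ℝ (v.1.fst x) (gradient φ x)) + ∫ x in O, φ x * v.1.snd x
      = (∫ x in O, (1 - θ x) * (inner ℝ (v.1.fst x) (gradient φ x) + φ x * v.1.snd x))
        - ∫ x in O, φ x * inner ℝ (v.1.fst x) (gradient θ x) := by
  have iinner : ∀ g : Euc d → Euc d, Continuous g →
      Integrable (fun x => inner ℝ (v.1.fst x) (g x)) (volume.restrict O) := fun g hg => by
    have hgm := integrable_of_continuous_closure hb hg
    refine (L2.integrable_inner (𝕜 := ℝ) v.1.fst hgm.toLp).congr ?_
    filter_upwards [hgm.coeFn_toLp] with x hx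
    rw [hx]
  have imul : ∀ g : Euc d → ℝ, Continuous g →
      Integrable (fun x => g x * v.1.snd x) (volume.restrict O) := fun g hg =>
    (integrable_of_continuous_closure hb hg).integrable_mul (Lp.memLp _)
  have hgφ := continuous_gradient hφ
  have hgθ := continuous_gradient hθ.smooth
  have htest : IsTest O fun x => θ x * φ x :=
    ⟨hθ.smooth.mul hφ, hθ.compact.mul_right, (tsupport_mul_subset_left).trans hθ.support⟩
  have hv := v.2 _ htest
  have i1 := iinner _ hgφ
  have i2 := imul _ hφ.continuous
  have i3 : Integrable (fun x => θ x * φ x * v.1.snd x) (volume.restrict O) :=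
    imul _ (hθ.smooth.continuous.mul hφ.continuous)
  have i4 : Integrable (fun x => inner ℝ (v.1.fst x) (θ x • gradient φ x)) (volume.restrict O) :=
    iinner _ (hθ.smooth.continuous.smul hgφ)
  have i5 : Integrable (fun x => inner ℝ (v.1.fst x) (φ x • gradient θ x)) (volume.restrict O) :=
    iinner _ (hφ.continuous.smul hgθ)
  have i12 : Integrable (fun x => inner ℝ (v.1.fst x) (gradient φ x) + φ x * v.1.snd x)
      (volume.restrict O) := i1.add i2
  have i43 : Integrable (fun x => inner ℝ (v.1.fst x) (θ x • gradient φ x)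
      + θ x * φ x * v.1.snd x) (volume.restrict O) := i4.add i3
  have e1 : ∫ x in O, inner ℝ (v.1.fst x) (gradient (fun y => θ y * φ y) x)
      = (∫ x in O, inner ℝ (v.1.fst x) (θ x • gradient φ x))
        + ∫ x in O, inner ℝ (v.1.fst x) (φ x • gradient θ x) := by
    rw [← integral_add i4 i5]
    refine integral_congr_ae (Eventually.of_forall fun x => ?_)
    simp only [gradient_mul hθ.smooth hφ, inner_add_right]
  have e2 : (∫ x in O, (1 - θ x) * (inner ℝ (v.1.fst x) (gradient φ x) + φ x * v.1.snd x))
      = ((∫ x in O, inner ℝ (v.1.fst x) (gradient φ x)) + ∫ x in O, φ x * v.1.snd x)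
        - ((∫ x in O, inner ℝ (v.1.fst x) (θ x • gradient φ x))
          + ∫ x in O, θ x * φ x * v.1.snd x) := by
    rw [← integral_add i1 i2, ← integral_add i4 i3, ← integral_sub i12 i43]
    refine integral_congr_ae (Eventually.of_forall fun x => ?_)
    simp only [real_inner_smul_right]
    ring
  have e3 : ∫ x in O, φ x * inner ℝ (v.1.fst x) (gradient θ x)
      = ∫ x in O, inner ℝ (v.1.fst x) (φ x • gradient θ x) :=
    integral_congr_ae (Eventually.of_forall fun x => by simp only [real_inner_smul_right])
  rw [e1] at hv
  rw [e2, e3]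
  linarith

theorem IsLipschitzDomain.compl_nonempty {m : ℕ} {O : Set (Euc (m + 1))}
    (hO : IsLipschitzDomain O) : (Oᶜ).Nonempty := by
  rw [nonempty_compl]
  rintro rfl
  exact NormedSpace.unbounded_univ ℝ (Euc (m + 1)) hO.isBounded

theorem lintegral_surface_lt_top {m : ℕ} {O : Set (Euc (m + 1))}
    (hO : IsPolyhedralLipschitzDomain O) {φ : Euc (m + 1) → ℝ} (hφ : Continuous φ) :
    ∫⁻ y, ‖φ y‖ₑ ∂(surface (frontier O)) < ⊤ := by
  obtain ⟨C, hC⟩ := hO.toIsLipschitzDomain.isCompact_frontier.exists_bound_of_continuousOn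
    hφ.continuousOn
  calc _ ≤ ∫⁻ y, ENNReal.ofReal C ∂(surface (frontier O)) := by
        refine setLIntegral_mono' isClosed_frontier.measurableSet fun x hx => ?_
        rw [← ofReal_norm]
        exact ENNReal.ofReal_le_ofReal (hC x hx)
    _ < ⊤ := by
        rw [lintegral_const, Measure.restrict_apply_univ]
        exact ENNReal.mul_lt_top ENNReal.ofReal_lt_top hO.surface_frontier_lt_top

/-- Let `ε → 0` in `green_cutoff`. The term with `1 - θ` vanishes by dominated convergence. The term
with `∇θ` is at most `N (2 / ε)` times the integral of `|φ|` over the strip of width `2 ε`, hence at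
most `4 N C` times the boundary integral up to `O(ε)`. Boundedness of `v` is essential for an `L¹`
bound on the boundary. -/
theorem green_smooth_bound {m : ℕ} {O : Set (Euc (m + 1))} (hO : IsPolyhedralLipschitzDomain O)
    (v : Hdiv O) {N : ℝ} (hN : 0 ≤ N) (hv : ∀ᵐ x ∂volume.restrict O, ‖v.1.fst x‖ ≤ N) :
    ∃ C ≥ 0, ∀ φ : Euc (m + 1) → ℝ, ContDiff ℝ ∞ φ →
      |(∫ x in O, inner ℝ (v.1.fst x) (gradient φ x)) + ∫ x in O, φ x * v.1.snd x|
        ≤ C * (∫⁻ y, ‖φ y‖ₑ ∂(surface (frontier O))).toReal := by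
  have hL := hO.toIsLipschitzDomain
  have hb := hL.isBounded
  have hne := hL.compl_nonempty
  obtain ⟨C, hC, hstrip⟩ := strip_global hL hne
  refine ⟨4 * N * C, by positivity, fun φ hφ => ?_⟩
  obtain ⟨M, hM, η₀, hη₀, hstrip⟩ := hstrip φ hφ
  set B := ∫⁻ y, ‖φ y‖ₑ ∂(surface (frontier O)) with hB
  have hBtop : B ≠ ⊤ := (lintegral_surface_lt_top hO hφ.continuous).ne
  choose! θ hθ using fun (ε : ℝ) (hε : 0 < ε) => exists_cutoff hb hε
  set g : Euc (m + 1) → ℝ := fun x => inner ℝ (v.1.fst x) (gradient φ x) + φ x * v.1.snd x with hg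
  have hgi : Integrable g (volume.restrict O) := by
    have h1 := integrable_of_continuous_closure hb (continuous_gradient hφ)
    have h2 : Integrable (fun x => inner ℝ (v.1.fst x) (gradient φ x)) (volume.restrict O) := by
      refine (L2.integrable_inner (𝕜 := ℝ) v.1.fst h1.toLp).congr ?_
      filter_upwards [h1.coeFn_toLp] with x hx
      rw [hx]
    exact h2.add ((integrable_of_continuous_closure hb hφ.continuous).integrable_mul (Lp.memLp _))
  set ℓ := (∫ x in O, inner ℝ (v.1.fst x) (gradient φ x)) + ∫ x in O, φ x * v.1.snd x with hℓ
  have hlim : Tendsto (fun ε => ∫ x in O, (1 - θ ε x) * g x) (𝓝[>] (0 : ℝ)) (𝓝 0) := by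
    have h0 : ∫ x in O, (0 : ℝ) = 0 := by simp
    conv => arg 3; rw [← h0]
    -- The factor `3` bounds `|1 - θ|`, since `|θ| ≤ 2`.
    refine tendsto_integral_filter_of_dominated_convergence (fun x => 3 * ‖g x‖) ?_ ?_
      (hgi.norm.const_mul 3) ?_
    · filter_upwards [self_mem_nhdsWithin] with ε hε
      exact (continuous_const.sub (hθ ε hε).1.smooth.continuous).aestronglyMeasurable.mul
        hgi.aestronglyMeasurable
    · filter_upwards [self_mem_nhdsWithin] with ε hε
      refine Eventually.of_forall fun x => ?_
      rw [norm_mul]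
      refine mul_le_mul_of_nonneg_right ?_ (norm_nonneg _)
      have := abs_le.1 ((hθ ε hε).2.1 x)
      rw [Real.norm_eq_abs, abs_le]
      constructor <;> linarith [this.1, this.2]
    · filter_upwards [ae_restrict_mem hL.isOpen.measurableSet] with x hx
      refine tendsto_const_nhds.congr' ?_
      have hpos : 0 < Metric.infDist x Oᶜ :=
        (hL.isOpen.isClosed_compl.notMem_iff_infDist_pos hne).1 (by simpa using hx)
      have h1 : ∀ᶠ ε in 𝓝[>] (0 : ℝ), ε < Metric.infDist x Oᶜ / 2 :=
        (eventually_lt_nhds (by linarith)).filter_mono nhdsWithin_le_nhds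
      filter_upwards [self_mem_nhdsWithin, h1] with ε hε h1
      rw [(hθ ε hε).2.2.1 x (by linarith), sub_self, zero_mul]
  have hbound : ∀ᶠ ε in 𝓝[>] (0 : ℝ), |ℓ - ∫ x in O, (1 - θ ε x) * g x|
      ≤ 4 * N * C * (B.toReal + M * (2 * ε)) := by
    have h1 : ∀ᶠ ε in 𝓝[>] (0 : ℝ), ε < η₀ / 2 :=
      (eventually_lt_nhds (by linarith)).filter_mono nhdsWithin_le_nhds
    filter_upwards [self_mem_nhdsWithin, h1] with ε hε h1
    have hε0 : 0 < ε := hε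
    obtain ⟨ht, -, -, hgz, hgb⟩ := hθ ε hε
    have e1 : ℓ - ∫ x in O, (1 - θ ε x) * g x
        = - ∫ x in O, φ x * inner ℝ (v.1.fst x) (gradient (θ ε) x) := by
      rw [hℓ, green_cutoff hb v ht hφ]; ring
    set D : Set (Euc (m + 1)) := {y | Metric.infDist y Oᶜ ≤ 2 * ε} with hD
    have hDm : MeasurableSet D :=
      (isClosed_le (Metric.continuous_infDist_pt _) continuous_const).measurableSet
    have e2 : ‖∫ x in O, φ x * inner ℝ (v.1.fst x) (gradient (θ ε) x)‖ₑ
        ≤ ENNReal.ofReal (4 * N * C * (B.toReal + M * (2 * ε))) := by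
      calc _ ≤ ∫⁻ x in O, ‖φ x * inner ℝ (v.1.fst x) (gradient (θ ε) x)‖ₑ :=
            enorm_integral_le_lintegral_enorm _
        _ ≤ ∫⁻ x in O, ENNReal.ofReal (N * (2 / ε)) * D.indicator (fun x => ‖φ x‖ₑ) x := by
            refine lintegral_mono_ae (hv.mono fun x hx => ?_)
            by_cases hxD : x ∈ D
            · rw [indicator_of_mem hxD, ← ofReal_norm, ← ofReal_norm,
                ← ENNReal.ofReal_mul (by positivity)]
              refine ENNReal.ofReal_le_ofReal ?_
              rw [norm_mul, mul_comm]
              refine mul_le_mul_of_nonneg_right ((norm_inner_le_norm _ _).trans ?_) (norm_nonneg _)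
              exact mul_le_mul hx (hgb x) (norm_nonneg _) hN
            · rw [hgz x (not_le.1 hxD)]; simp
        _ = ENNReal.ofReal (N * (2 / ε)) * ∫⁻ x in O ∩ D, ‖φ x‖ₑ := by
            rw [lintegral_const_mul _ (hφ.continuous.enorm.measurable.indicator hDm),
              setLIntegral_indicator hDm, inter_comm]
        _ ≤ ENNReal.ofReal (N * (2 / ε)) * (ENNReal.ofReal (C * (2 * ε)) *
              (B + ENNReal.ofReal (M * (2 * ε)))) := by
            gcongr
            exact hstrip (2 * ε) (by linarith) (by linarith)
        _ = _ := by
            rw [← ENNReal.ofReal_toReal hBtop, ← ENNReal.ofReal_add (by positivity) (by positivity),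
              ← ENNReal.ofReal_mul (by positivity), ← ENNReal.ofReal_mul (by positivity),
              ENNReal.ofReal_toReal hBtop]
            congr 1
            field_simp
            ring
    rw [e1, abs_neg, ← Real.norm_eq_abs]
    rw [← ofReal_norm, ENNReal.ofReal_le_ofReal_iff (by positivity)] at e2
    exact e2
  have hl1 : Tendsto (fun ε => |ℓ - ∫ x in O, (1 - θ ε x) * g x|) (𝓝[>] (0 : ℝ)) (𝓝 |ℓ|) := by
    simpa using (hlim.const_sub ℓ).abs
  have hl2 : Tendsto (fun ε => 4 * N * C * (B.toReal + M * (2 * ε))) (𝓝[>] (0 : ℝ))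
      (𝓝 (4 * N * C * B.toReal)) := by
    have h : Tendsto (fun ε : ℝ => 4 * N * C * (B.toReal + M * (2 * ε))) (𝓝 0)
        (𝓝 (4 * N * C * (B.toReal + M * (2 * 0)))) := Continuous.tendsto (by fun_prop) 0
    simp only [mul_zero, add_zero] at h
    exact h.mono_left nhdsWithin_le_nhds
  exact le_of_tendsto_of_tendsto hl1 hl2 hbound

theorem continuous_greenPairing {d : ℕ} {O : Set (Euc d)} (v : Hdiv O) :
    Continuous (greenPairing O v) := by
  unfold greenPairing
  have h1 : Continuous fun w : H1 O => w.1.fst :=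
    (WithLp.prod_continuous_ofLp 2 _ _).fst.comp continuous_subtype_val
  have h2 : Continuous fun w : H1 O => w.1.snd :=
    (WithLp.prod_continuous_ofLp 2 _ _).snd.comp continuous_subtype_val
  exact (continuous_const.inner h2).add (continuous_const.inner h1)

/-- On a boundary of finite area the `L¹` norm is dominated by the `L²` norm, and the resulting
inequality is closed. -/
theorem green_trace_bound {m : ℕ} {O : Set (Euc (m + 1))} (hO : IsPolyhedralLipschitzDomain O)
    (v : Hdiv O) {N : ℝ} (hN : 0 ≤ N) (hv : ∀ᵐ x ∂volume.restrict O, ‖v.1.fst x‖ ≤ N) :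
    ∃ C ≥ 0, ∀ (w : H1 O) (t : L2S (frontier O)), HasTrace O w t →
      |greenPairing O v w| ≤ C * ‖t‖ := by
  obtain ⟨C, hC, hbd⟩ := green_smooth_bound hO v hN hv
  set σ := (surface (frontier O) univ).toReal with hσ
  have hσtop : surface (frontier O) univ ≠ ⊤ := by
    rw [Measure.restrict_apply_univ]; exact hO.surface_frontier_lt_top.ne
  refine ⟨C * Real.sqrt σ, by positivity, fun w t hwt => ?_⟩
  refine hwt.of_smooth (P := fun w t => |greenPairing O v w| ≤ C * Real.sqrt σ * ‖t‖)
    (isClosed_le ((continuous_greenPairing v).comp continuous_fst).abs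
      (continuous_const.mul continuous_snd.norm)) ?_
  intro w t φ hφ h1 h2 h3
  rw [greenPairing_eq v w h1 h2, mul_assoc]
  refine (hbd φ hφ).trans (mul_le_mul_of_nonneg_left ?_ hC)
  have h4 : ∫⁻ y, ‖φ y‖ₑ ∂(surface (frontier O)) = eLpNorm t 1 (surface (frontier O)) := by
    rw [eLpNorm_one_eq_lintegral_enorm]
    exact lintegral_congr_ae (h3.mono fun x hx => by simp only [hx])
  have h5 := eLpNorm_le_eLpNorm_mul_rpow_measure_univ (p := 1) (q := 2) (by norm_num)
    (Lp.memLp t).aestronglyMeasurable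
  rw [h4, Lp.norm_def, mul_comm, Real.sqrt_eq_rpow, hσ, ENNReal.toReal_rpow, ← ENNReal.toReal_mul]
  refine ENNReal.toReal_mono (ENNReal.mul_ne_top (Lp.eLpNorm_ne_top t)
    (ENNReal.rpow_ne_top_of_nonneg (by norm_num) hσtop)) (h5.trans (le_of_eq ?_))
  norm_num

/-- The Green pairing as a linear functional of its second argument. -/
noncomputable def greenLinear {d : ℕ} {O : Set (Euc d)} (v : Hdiv O) : H1 O →ₗ[ℝ] ℝ where
  toFun := greenPairing O v
  map_add' := fun w w' => by
    simp only [greenPairing, Submodule.coe_add, WithLp.add_fst, WithLp.add_snd, inner_add_right]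
    ring
  map_smul' := fun c w => by
    simp only [greenPairing, Submodule.coe_smul, WithLp.smul_fst, WithLp.smul_snd,
      real_inner_smul_right, RingHom.id_apply, smul_eq_mul]
    ring

/-- A functional bounded by the second component of a graph is an inner product with it. -/
theorem exists_riesz_of_bound {V H : Type*} [AddCommGroup V] [Module ℝ V] [NormedAddCommGroup H]
    [InnerProductSpace ℝ H] [CompleteSpace H] (G : Submodule ℝ (V × H)) (l : V →ₗ[ℝ] ℝ) {C : ℝ}
    (hC : ∀ p ∈ G, |l p.1| ≤ C * ‖p.2‖) :
    ∃ F : H, ∀ p ∈ G, l p.1 = inner ℝ F p.2 := by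
  let f2 : G →ₗ[ℝ] H := (LinearMap.snd ℝ V H).comp G.subtype
  let f1 : G →ₗ[ℝ] ℝ := (l.comp (LinearMap.fst ℝ V H)).comp G.subtype
  -- The bound makes `l` vanish wherever the second component does, so `l` factors through the
  -- second component; a linear section realises this factorisation. Hahn–Banach and Riesz then
  -- represent it.
  obtain ⟨s, hs⟩ := LinearMap.exists_rightInverse_of_surjective f2.rangeRestrict
    f2.range_rangeRestrict
  have hs2 : ∀ y, f2 (s y) = y := fun y => by
    have := LinearMap.congr_fun hs y
    exact congrArg Subtype.val this
  let g : StrongDual ℝ (LinearMap.range f2) := (f1.comp s).mkContinuous C fun y => by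
    have h := hC (s y) (s y).2
    have h2 : ((s y : G) : V × H).2 = y := hs2 y
    rw [h2] at h
    exact h
  obtain ⟨g', hg', -⟩ := exists_extension_norm_eq (LinearMap.range f2) g
  refine ⟨(InnerProductSpace.toDual ℝ H).symm g', fun p hp => ?_⟩
  rw [InnerProductSpace.toDual_symm_apply]
  let q : G := ⟨p, hp⟩
  have h1 : g' p.2 = f1 (s ⟨f2 q, LinearMap.mem_range_self f2 q⟩) := hg' ⟨f2 q, LinearMap.mem_range_self f2 q⟩
  have h2 : f1 (q - s ⟨f2 q, LinearMap.mem_range_self f2 q⟩) = 0 := by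
    have h3 := hC _ (q - s ⟨f2 q, LinearMap.mem_range_self f2 q⟩).2
    have h4 : f2 (q - s ⟨f2 q, LinearMap.mem_range_self f2 q⟩) = 0 := by
      rw [map_sub, hs2, sub_self]
    have h5 : ((q - s ⟨f2 q, LinearMap.mem_range_self f2 q⟩ : G) : V × H).2 = 0 := h4
    rw [h5, norm_zero, mul_zero] at h3
    exact abs_nonpos_iff.1 h3
  rw [map_sub, sub_eq_zero] at h2
  rw [h1, ← h2]
  rfl

theorem exists_normalTrace {m : ℕ} {O : Set (Euc (m + 1))} (hO : IsPolyhedralLipschitzDomain O)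
    (v : Hdiv O) {N : ℝ} (hN : 0 ≤ N) (hv : ∀ᵐ x ∂volume.restrict O, ‖v.1.fst x‖ ≤ N) :
    ∃ F : L2S (frontier O), ∀ (w : H1 O) (t : L2S (frontier O)), HasTrace O w t →
      greenPairing O v w = inner ℝ F t := by
  obtain ⟨C, -, hC⟩ := green_trace_bound hO v hN hv
  obtain ⟨F, hF⟩ := exists_riesz_of_bound (smoothGraph O).topologicalClosure (greenLinear v)
    (C := C) (fun p hp => hC p.1 p.2 hp)
  exact ⟨F, fun w t h => hF (w, t) h⟩

/-- A field with an `L²` normal trace on `∂ΩD` has one on `Σ`. -/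
theorem exists_darcyNormalTrace {m : ℕ} {ΩS ΩD : Set (Euc (m + 1))}
    (hD : IsPolyhedralLipschitzDomain ΩD) (v : Hdiv ΩD) {N : ℝ} (hN : 0 ≤ N)
    (hv : ∀ᵐ x ∂volume.restrict ΩD, ‖v.1.fst x‖ ≤ N) :
    ∃ g, IsDarcyNormalTrace ΩS ΩD v g := by
  obtain ⟨F, hF⟩ := exists_normalTrace hD v hN hv
  -- The sign changes because `ν` points into `ΩD` whereas `F` represents the outward normal trace.
  refine ⟨-(resL2 interface_subset_darcy F), fun w φ hwφ => ?_⟩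
  obtain ⟨t, ht, h1, h2⟩ := hwφ
  rw [hF w t ht, inner_neg_left, neg_neg, L2.inner_def, L2.inner_def]
  have hIm : MeasurableSet (interface ΩS ΩD) :=
    (isClosed_frontier.inter isClosed_frontier).measurableSet
  have hsplit := integral_inter_add_sdiff (μ := Measure.euclideanHausdorffMeasure m)
    (s := frontier ΩD) (t := interface ΩS ΩD) (f := fun x => (inner ℝ (F x) (t x) : ℝ)) hIm
    (L2.integrable_inner (𝕜 := ℝ) F t)
  rw [inter_eq_right.2 interface_subset_darcy] at hsplit
  have e1 : ∫ x in frontier ΩD \ interface ΩS ΩD, (inner ℝ (F x) (t x) : ℝ)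
      ∂(Measure.euclideanHausdorffMeasure m) = 0 :=
    integral_eq_zero_of_ae (h2.mono fun x hx => by simp [hx])
  rw [e1, add_zero] at hsplit
  refine hsplit.symm.trans (integral_congr_ae ?_)
  filter_upwards [h1, resL2_coe interface_subset_darcy F] with x hx1 hx2
  rw [hx1, hx2]

theorem norm_le_sum_abs {d : ℕ} (x : Euc d) : ‖x‖ ≤ ∑ j, |x j| := by
  rw [EuclideanSpace.norm_eq]
  refine Real.sqrt_le_iff.2 ⟨Finset.sum_nonneg fun j _ => abs_nonneg _, ?_⟩
  exact Finset.sum_sq_le_sq_sum_of_nonneg fun j _ => abs_nonneg _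

/-- Piecewise polynomial fields are bounded. -/
theorem IsDarcyFE.exists_bound {m : ℕ} {ΩD S : Set (Euc (m + 1))}
    {K : Geometry.SimplicialComplex ℝ (Euc (m + 1))} {V : Submodule ℝ (Hdiv ΩD)}
    (hV : IsDarcyFE ΩD K V) (hK : IsTriangulation ΩD S K) {v : Hdiv ΩD} (hv : v ∈ V) :
    ∃ N ≥ 0, ∀ᵐ x ∂volume.restrict ΩD, ‖v.1.fst x‖ ≤ N := by
  classical
  have key : ∀ T ∈ K.faces, ∃ N ≥ 0, ∀ᵐ x ∂volume.restrict
      (ΩD ∩ convexHull ℝ (T : Set (Euc (m + 1)))), ‖v.1.fst x‖ ≤ N := by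
    intro T hT
    obtain ⟨T', hT', hTT', hcard⟩ := hK.pure T hT
    choose p hp using fun j => hV.poly v hv j T' hT' hcard
    have hcont : Continuous fun x : Euc (m + 1) =>
        ∑ j, |MvPolynomial.eval (fun i => x i) (p j)| := by
      refine continuous_finsetSum _ fun j _ => Continuous.abs ?_
      exact (MvPolynomial.continuous_eval (p j)).comp (by fun_prop)
    obtain ⟨N, hN⟩ := (T'.finite_toSet.isCompact_convexHull ℝ).exists_bound_of_continuousOn
      hcont.continuousOn
    refine ⟨max N 0, le_max_right _ _, ?_⟩
    have h1 : ∀ᵐ x ∂volume.restrict (ΩD ∩ convexHull ℝ (T' : Set (Euc (m + 1)))),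
        ‖v.1.fst x‖ ≤ max N 0 := by
      have h2 : ∀ᵐ x ∂volume.restrict (ΩD ∩ convexHull ℝ (T' : Set (Euc (m + 1)))),
          x ∈ convexHull ℝ (T' : Set (Euc (m + 1))) :=
        ae_restrict_of_ae_restrict_of_subset inter_subset_right
          (ae_restrict_mem (measurableSet_convexHull_finset T'))
      filter_upwards [eventually_all.2 hp, h2] with x hx hxT
      refine le_trans ?_ ((hN x hxT).trans (le_max_left _ _))
      rw [Real.norm_of_nonneg (Finset.sum_nonneg fun j _ => abs_nonneg _)]
      refine le_trans (norm_le_sum_abs _) (le_of_eq ?_)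
      exact Finset.sum_congr rfl fun j _ => by rw [hx j]
    exact ae_restrict_of_ae_restrict_of_subset
      (inter_subset_inter_right _ (convexHull_mono hTT')) h1
  choose! N hN0 hN using key
  refine ⟨∑ T ∈ hK.finite.toFinset, N T,
    Finset.sum_nonneg fun T hT => hN0 T (hK.finite.mem_toFinset.1 hT), ?_⟩
  have hcov : ΩD ⊆ ⋃ T ∈ hK.finite.toFinset, ΩD ∩ convexHull ℝ (T : Set (Euc (m + 1))) := by
    intro x hx
    have h1 : x ∈ K.space := hK.space_eq ▸ subset_closure hx
    obtain ⟨T, hT, hxT⟩ := Geometry.SimplicialComplex.mem_space_iff.1 h1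
    exact mem_iUnion₂.2 ⟨T, hK.finite.mem_toFinset.2 hT, hx, hxT⟩
  refine ae_restrict_of_ae_restrict_of_subset hcov ?_
  rw [ae_restrict_biUnion_finset_iff]
  intro T hT
  refine (hN T (hK.finite.mem_toFinset.1 hT)).mono fun x hx => hx.trans ?_
  exact Finset.single_le_sum (fun T hT => hN0 T (hK.finite.mem_toFinset.1 hT)) hT

/-! ### Uniqueness of the normal trace on the interface -/

theorem smooth_weakGradient {d : ℕ} {O : Set (Euc d)} {φ ψ : Euc d → ℝ} (hφ : ContDiff ℝ ∞ φ)
    (hψ : IsTest O ψ) :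
    ∫ x in O, φ x • gradient ψ x = - ∫ x in O, ψ x • gradient φ x := by
  have hgφ := continuous_gradient hφ
  have hgψ := continuous_gradient hψ.smooth
  have i1 : Integrable fun x => φ x • gradient ψ x :=
    (hφ.continuous.smul hgψ).integrable_of_hasCompactSupport
      (compact_gradient hψ.compact).smul_left
  have i2 : Integrable fun x => ψ x • gradient φ x :=
    (hψ.smooth.continuous.smul hgφ).integrable_of_hasCompactSupport hψ.compact.smul_right
  have z1 : ∀ x, x ∉ O → ψ x = 0 := fun x hx =>
    image_eq_zero_of_notMem_tsupport fun h => hx (hψ.support h)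
  have z2 : ∀ x, x ∉ O → gradient ψ x = 0 := fun x hx => by
    have h1 : x ∉ tsupport ψ := fun h => hx (hψ.support h)
    have h2 := (notMem_tsupport_iff_eventuallyEq.1 h1).fderiv_eq (𝕜 := ℝ)
    simp [gradient, h2]
  rw [setIntegral_eq_integral_of_forall_compl_eq_zero fun x hx => by rw [z2 x hx, smul_zero],
    setIntegral_eq_integral_of_forall_compl_eq_zero fun x hx => by rw [z1 x hx, zero_smul]]
  refine ext_inner_left ℝ fun v => ?_
  rw [inner_neg_right, ← integral_inner i1, ← integral_inner i2]
  have hgr : ∀ (f : Euc d → ℝ) x, inner ℝ v (gradient f x) = fderiv ℝ f x v := fun f x => by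
    rw [real_inner_comm, gradient, InnerProductSpace.toDual_symm_apply]
  simp only [real_inner_smul_right, hgr]
  have hcφ : Continuous fun x => fderiv ℝ φ x v :=
    (hφ.continuous_fderiv (by simp)).clm_apply continuous_const
  have hcψ : Continuous fun x => fderiv ℝ ψ x v :=
    (hψ.smooth.continuous_fderiv (by simp)).clm_apply continuous_const
  have hsψ : HasCompactSupport fun x => fderiv ℝ ψ x v := hψ.compact.fderiv_apply ℝ v
  rw [integral_mul_fderiv_eq_neg_fderiv_mul_of_integrable]
  · congr 1
    exact integral_congr_ae (Eventually.of_forall fun x => mul_comm _ _)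
  · exact (hcφ.mul hψ.smooth.continuous).integrable_of_hasCompactSupport hψ.compact.mul_left
  · exact (hφ.continuous.mul hcψ).integrable_of_hasCompactSupport hsψ.mul_left
  · exact (hφ.continuous.mul hψ.smooth.continuous).integrable_of_hasCompactSupport
      hψ.compact.mul_left
  · exact fun x _ => hφ.differentiable (by simp) x
  · exact fun x _ => hψ.smooth.differentiable (by simp) x

/-- This supplies the test functions used to separate normal traces. -/
theorem exists_smooth_trace {m : ℕ} {O : Set (Euc (m + 1))} (hO : IsPolyhedralLipschitzDomain O)
    {φ : Euc (m + 1) → ℝ} (hφ : ContDiff ℝ ∞ φ) :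
    ∃ (w : H1 O) (t : L2S (frontier O)), HasTrace O w t ∧ t =ᵐ[surface (frontier O)] φ := by
  have hb := hO.isBounded
  have h1 := integrable_of_continuous_closure hb hφ.continuous
  have h2 := integrable_of_continuous_closure hb (continuous_gradient hφ)
  have h3 : MemLp φ 2 (surface (frontier O)) := by
    have : IsFiniteMeasure (surface (frontier O)) :=
      ⟨by rw [Measure.restrict_apply_univ]; exact hO.surface_frontier_lt_top⟩
    obtain ⟨C, hC⟩ := hO.toIsLipschitzDomain.isCompact_frontier.exists_bound_of_continuousOn
      hφ.continuous.continuousOn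
    exact MemLp.of_bound hφ.continuous.aestronglyMeasurable C
      ((ae_restrict_mem isClosed_frontier.measurableSet).mono fun x hx => hC x hx)
  let f : L2 O := h1.toLp φ
  let F : L2V O := h2.toLp (gradient φ)
  have hf : f =ᵐ[volume.restrict O] φ := h1.coeFn_toLp
  have hF : F =ᵐ[volume.restrict O] gradient φ := h2.coeFn_toLp
  have hw : WithLp.toLp 2 (f, F) ∈ H1 O := fun ψ hψ => by
    have e1 : ∫ x in O, f x • gradient ψ x = ∫ x in O, φ x • gradient ψ x :=
      integral_congr_ae (hf.mono fun x hx => by simp only [hx])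
    have e2 : ∫ x in O, ψ x • F x = ∫ x in O, ψ x • gradient φ x :=
      integral_congr_ae (hF.mono fun x hx => by simp only [hx])
    exact e1.trans ((smooth_weakGradient hφ hψ).trans (congrArg Neg.neg e2.symm))
  exact ⟨⟨_, hw⟩, h3.toLp, Submodule.le_topologicalClosure _
    ⟨φ, hφ, hf, hF, h3.coeFn_toLp⟩, h3.coeFn_toLp⟩

/-- The points near which the boundary of `O` is contained in `S`. -/
def relInterior {d : ℕ} (O S : Set (Euc d)) : Set (Euc d) :=
  interior {x | x ∈ frontier O → x ∈ S}

/-- Exceptional points of the flat convex piece `C` lie either on its relative boundary, null by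
convexity, or on one of finitely many boundary hyperplanes transversal to its plane. Near any other
point of `C` every boundary point of `O` lies in the plane of `C` and projects into its interior, so
it belongs to `C`. -/
theorem face_diff_relInterior_null {m : ℕ} {O S C : Set (Euc (m + 1))}
    (hO : IsPolyhedralLipschitzDomain O) (hCS : C ⊆ S) (hC : Convex ℝ C)
    {n : Euc (m + 1)} {s : ℝ} (hn : ‖n‖ = 1) (hCn : C ⊆ {x | inner ℝ x n = s}) :
    Measure.euclideanHausdorffMeasure m (C \ relInterior O S) = 0 := by
  obtain ⟨U, hU⟩ := exists_frame hn
  obtain ⟨p, hp, hpU⟩ := exists_frameProj hn hU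
  obtain ⟨P, hP0, hP⟩ := hO.flat
  rw [measure_hyperplane hn hU (sdiff_subset.trans hCn)]
  set γ : Euc m → Euc (m + 1) := fun z => U z + s • n with hγ
  set Z := γ ⁻¹' C with hZ
  have hZc : Convex ℝ Z := by
    intro a ha b hb α β hα hβ hαβ
    have h1 : γ (α • a + β • b) = α • γ a + β • γ b := by
      simp only [hγ, map_add, map_smul, smul_add]
      have : s • n = α • s • n + β • s • n := by rw [← add_smul, hαβ, one_smul]
      nth_rw 1 [this]
      abel
    rw [hZ, mem_preimage, h1]
    exact hC ha hb hα hβ hαβ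
  -- `a q` is the tangential component of the vector `q`; it vanishes exactly for vectors normal to
  -- the plane of `C`.
  let a : Euc (m + 1) → Euc m := fun q => ContinuousLinearMap.adjoint U.toContinuousLinearMap q
  have ha : ∀ q z, inner ℝ (a q) z = inner ℝ q (U z) := fun q z =>
    ContinuousLinearMap.adjoint_inner_left _ _ _
  have hnull : volume (frontier Z ∪ ⋃ q ∈ P.filter (fun q => a q.1 ≠ 0),
      {z | inner ℝ (a q.1) z = q.2 - s * inner ℝ q.1 n}) = 0 := by
    refine measure_union_null (hZc.addHaar_frontier volume)
      ((measure_biUnion_null_iff (Finset.countable_toSet _)).2 fun q hq => ?_)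
    exact volume_hyperplane (Finset.mem_filter.1 hq).2 _
  refine measure_mono_null (fun z hz => ?_) hnull
  by_contra hbad
  rw [mem_union, not_or] at hbad
  obtain ⟨hfr, hbad⟩ := hbad
  have hzZ : z ∈ Z := hz.1
  have hzint : z ∈ interior Z := by
    by_contra h
    exact hfr ⟨subset_closure hzZ, h⟩
  refine hz.2 ?_
  rw [relInterior, mem_interior_iff_mem_nhds]
  have hpz : p (γ z) = z := hpU z s
  have h1 : ∀ᶠ y in 𝓝 (γ z), p y ∈ interior Z :=
    hp.continuous.continuousAt.eventually (by rw [hpz]; exact isOpen_interior.mem_nhds hzint)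
  -- Close to `γ z` only the hyperplanes through `γ z` are met.
  have h2 : ∀ᶠ y in 𝓝 (γ z), ∀ q ∈ P, inner ℝ q.1 (γ z) ≠ q.2 → inner ℝ q.1 y ≠ q.2 := by
    rw [Finset.eventually_all]
    intro q _
    by_cases hq : inner ℝ q.1 (γ z) = q.2
    · exact Eventually.of_forall fun y h => absurd hq h
    · have hc : Continuous fun y : Euc (m + 1) => (inner ℝ q.1 y : ℝ) := by fun_prop
      filter_upwards [(isOpen_ne_fun hc continuous_const).mem_nhds hq] with y hy _
      exact hy
  filter_upwards [h1, h2] with y hy1 hy2 hyO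
  obtain ⟨q, hq, hyq⟩ := mem_iUnion₂.1 (hP hyO)
  have hzq : inner ℝ q.1 (γ z) = q.2 := by
    by_contra h
    exact hy2 q hq h hyq
  have haq : a q.1 = 0 := by
    by_contra h
    refine hbad (mem_iUnion₂.2 ⟨q, Finset.mem_filter.2 ⟨hq, h⟩, ?_⟩)
    rw [mem_ofPred_eq, ha, ← hzq, hγ, inner_add_right, real_inner_smul_right]
    ring
  have hUq : ∀ z, inner ℝ q.1 (U z) = 0 := fun z => by rw [← ha, haq, inner_zero_left]
  have hexp : ∀ x, inner ℝ q.1 x = inner ℝ x n * inner ℝ q.1 n := by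
    intro x
    obtain ⟨ξ, hξ⟩ := frame_surjective hn hU x
    conv_lhs => rw [hξ]
    rw [inner_add_right, hUq, real_inner_smul_right, zero_add]
  have hqn : (inner ℝ q.1 n : ℝ) ≠ 0 := by
    intro h
    refine hP0 q hq (inner_self_eq_zero (𝕜 := ℝ).1 ?_)
    rw [hexp, h, mul_zero]
  have hyn : inner ℝ y n = s := by
    have h3 : inner ℝ q.1 y = q.2 := hyq
    rw [← hzq, hexp y, hexp (γ z), hγ, inner_frame hn hU] at h3
    exact mul_right_cancel₀ hqn h3
  obtain ⟨ξ, hξ⟩ := frame_surjective hn hU y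
  rw [hyn] at hξ
  have h4 : p y = ξ := by rw [hξ]; exact hpU ξ s
  rw [h4] at hy1
  have h5 : ξ ∈ Z := interior_subset hy1
  rw [hξ]
  exact hCS h5

theorem ae_mem_relInterior {m : ℕ} {O S : Set (Euc (m + 1))}
    {K : Geometry.SimplicialComplex ℝ (Euc (m + 1))} (hO : IsPolyhedralLipschitzDomain O)
    (hK : IsTriangulation O S K) : ∀ᵐ x ∂surface S, x ∈ relInterior O S := by
  have hV : MeasurableSet (relInterior O S) := isOpen_interior.measurableSet
  rw [ae_iff]
  have e : {x | x ∉ relInterior O S} = (relInterior O S)ᶜ := rfl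
  rw [e, surface, Measure.restrict_apply hV.compl, ← iUnion_facesIn hK, inter_iUnion₂]
  rw [iUnion_facesIn hK]
  refine (measure_biUnion_null_iff (Finset.countable_toSet _)).2 fun f hf => ?_
  have hf' := (mem_facesIn hK).1 hf
  obtain ⟨T, -, -, -, n, s, hn, hs, -⟩ := exists_element hK hf'
  rw [inter_comm]
  exact face_diff_relInterior_null hO hf'.2.2 (convex_convexHull ℝ _) hn fun x hx => (hs hx).2

/-! ### The Darcy normal trace on the interface and the space `Φ^h_D`. -/

section Darcy

variable {m : ℕ} {ΩS ΩD : Set (Euc (m + 1))}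

theorem IsDarcyNormalTrace.add {v v' : Hdiv ΩD} {g g' : L2S (interface ΩS ΩD)}
    (h : IsDarcyNormalTrace ΩS ΩD v g) (h' : IsDarcyNormalTrace ΩS ΩD v' g') :
    IsDarcyNormalTrace ΩS ΩD (v + v') (g + g') := fun w φ hw => by
  have h1 := h w φ hw
  have h2 := h' w φ hw
  simp only [greenPairing, Submodule.coe_add, WithLp.add_fst, WithLp.add_snd,
    inner_add_left] at h1 h2 ⊢
  linarith

theorem IsDarcyNormalTrace.smul {v : Hdiv ΩD} {g : L2S (interface ΩS ΩD)}
    (h : IsDarcyNormalTrace ΩS ΩD v g) (c : ℝ) :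
    IsDarcyNormalTrace ΩS ΩD (c • v) (c • g) := fun w φ hw => by
  have h1 := h w φ hw
  simp only [greenPairing, Submodule.coe_smul, WithLp.smul_fst, WithLp.smul_snd,
    real_inner_smul_left] at h1 ⊢
  rw [← mul_add, h1, mul_neg]

theorem IsDarcyNormalTrace.sub {v v' : Hdiv ΩD} {g g' : L2S (interface ΩS ΩD)}
    (h : IsDarcyNormalTrace ΩS ΩD v g) (h' : IsDarcyNormalTrace ΩS ΩD v' g') :
    IsDarcyNormalTrace ΩS ΩD (v - v') (g - g') := by
  have h1 := h.add (h'.smul (-1))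
  simpa [sub_eq_add_neg] using h1

/-- A smooth function supported in the open set `relInterior` vanishes on `∂ΩD ∖ Σ`, so its
restriction to `Σ` is an admissible test function. Such functions determine an integrable function
on that set, which contains almost all of `Σ`. -/
theorem IsDarcyNormalTrace.unique {K : Geometry.SimplicialComplex ℝ (Euc (m + 1))}
    (hD : IsPolyhedralLipschitzDomain ΩD) (hK : IsTriangulation ΩD (interface ΩS ΩD) K)
    {v : Hdiv ΩD} {g g' : L2S (interface ΩS ΩD)} (h : IsDarcyNormalTrace ΩS ΩD v g)
    (h' : IsDarcyNormalTrace ΩS ΩD v g') : g = g' := by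
  have h0 := h.sub h'
  rw [sub_self] at h0
  set f := g - g' with hf
  suffices hf0 : f = 0 from sub_eq_zero.1 hf0
  have hfin : IsFiniteMeasure (surface (interface ΩS ΩD)) := ⟨by
    rw [Measure.restrict_apply_univ]
    exact (measure_mono interface_subset_darcy).trans_lt hD.surface_frontier_lt_top⟩
  have hint : Integrable f (surface (interface ΩS ΩD)) :=
    (Lp.memLp f).integrable (by norm_num)
  have key := (isOpen_interior : IsOpen (relInterior ΩD (interface ΩS ΩD)))
    |>.ae_eq_zero_of_integral_contDiff_smul_eq_zero (μ := surface (interface ΩS ΩD)) (f := f)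
      (hint.locallyIntegrable.locallyIntegrableOn _) ?_
  · refine (Lp.eq_zero_iff_ae_eq_zero).2 ?_
    filter_upwards [key, ae_mem_relInterior hD hK] with x hx hxV
    exact hx hxV
  · intro φ hφ _ hsupp
    obtain ⟨w, t, hwt, ht⟩ := exists_smooth_trace hD hφ
    have hzero : IsZeroExtTrace ΩS ΩD w (resL2 interface_subset_darcy t) := by
      refine ⟨t, hwt, ?_, ?_⟩
      · filter_upwards [resL2_coe interface_subset_darcy t] with x hx
        exact hx.symm
      · have hm : MeasurableSet (frontier ΩD \ interface ΩS ΩD) :=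
          isClosed_frontier.measurableSet.diff
            (isClosed_frontier.inter isClosed_frontier).measurableSet
        filter_upwards [ae_mono (surface_mono sdiff_subset) ht, ae_restrict_mem hm] with x hx hxm
        rw [hx]
        refine image_eq_zero_of_notMem_tsupport fun hxs => ?_
        exact hxm.2 (interior_subset (hsupp hxs) hxm.1)
    have h1 := h0 w _ hzero
    have h2 : greenPairing ΩD (0 : Hdiv ΩD) w = 0 := by simp [greenPairing]
    rw [h2, eq_comm, neg_eq_zero, L2.inner_def] at h1
    rw [← h1]
    refine integral_congr_ae ?_
    filter_upwards [resL2_coe interface_subset_darcy t,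
      ae_mono (surface_mono interface_subset_darcy) ht] with x hx1 hx2
    rw [hx1, hx2]
    simp

theorem exists_trace_of_mem_darcyFE {K : Geometry.SimplicialComplex ℝ (Euc (m + 1))}
    (hD : IsPolyhedralLipschitzDomain ΩD) (hK : IsTriangulation ΩD (interface ΩS ΩD) K)
    {V : Submodule ℝ (Hdiv ΩD)} (hV : IsDarcyFE ΩD K V) {v : Hdiv ΩD}
    (hv : v ∈ darcyFE ΩS ΩD V) : ∃ g, IsDarcyNormalTrace ΩS ΩD v g := by
  obtain ⟨N, hN, hb⟩ := hV.exists_bound hK hv.1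
  exact exists_darcyNormalTrace hD v hN hb

/-- Existence and uniqueness of `L²` traces make the normal trace a linear map on the
finite-dimensional space `darcyFE`, and its range contains `PhiD`. -/
theorem finiteDimensional_PhiD {K : Geometry.SimplicialComplex ℝ (Euc (m + 1))}
    (hD : IsPolyhedralLipschitzDomain ΩD) (hK : IsTriangulation ΩD (interface ΩS ΩD) K)
    {V : Submodule ℝ (Hdiv ΩD)} (hV : IsDarcyFE ΩD K V) :
    FiniteDimensional ℝ (PhiD ΩS ΩD V) := by
  have hfin := hV.finite
  have hfin2 : FiniteDimensional ℝ (darcyFE ΩS ΩD V) :=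
    Submodule.finiteDimensional_of_le (inf_le_left : darcyFE ΩS ΩD V ≤ V)
  choose T hT using fun v : darcyFE ΩS ΩD V => exists_trace_of_mem_darcyFE hD hK hV v.2
  let L : darcyFE ΩS ΩD V →ₗ[ℝ] L2S (interface ΩS ΩD) :=
    { toFun := T
      map_add' := fun v v' => (hT (v + v')).unique hD hK ((hT v).add (hT v'))
      map_smul' := fun c v => (hT (c • v)).unique hD hK ((hT v).smul c) }
  have hle : PhiD ΩS ΩD V ≤ LinearMap.range L := by
    rintro g ⟨v, hv, hvg⟩
    exact ⟨⟨v, hv⟩, (hT ⟨v, hv⟩).unique hD hK hvg⟩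
  exact Submodule.finiteDimensional_of_le hle

/-- The projection is taken onto a closure, while the lifting is defined on `PhiD` itself; finite
dimension identifies the two. -/
theorem RD_mem {K : Geometry.SimplicialComplex ℝ (Euc (m + 1))}
    (hD : IsPolyhedralLipschitzDomain ΩD) (hK : IsTriangulation ΩD (interface ΩS ΩD) K)
    {V : Submodule ℝ (Hdiv ΩD)} (hV : IsDarcyFE ΩD K V) (g : L2S (interface ΩS ΩD)) :
    RD ΩS ΩD V g ∈ PhiD ΩS ΩD V := by
  have hfin := finiteDimensional_PhiD (ΩS := ΩS) hD hK hV
  have h1 : (PhiD ΩS ΩD V).topologicalClosure = PhiD ΩS ΩD V :=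
    IsClosed.submodule_topologicalClosure_eq (Submodule.closed_of_finiteDimensional _)
  have h2 := Submodule.starProjection_apply_mem (PhiD ΩS ΩD V).topologicalClosure g
  exact h1.le h2

end Darcy

/-! ### The outward normal and the Stokes normal trace -/

/-- If `n ≠ n'`, moving slightly in direction `n' - n` enters `O` according to `n` and leaves it
according to `n'`. -/
theorem IsOuterNormalAt.unique {d : ℕ} {O : Set (Euc d)} {x n n' : Euc d}
    (h : IsOuterNormalAt O x n) (h' : IsOuterNormalAt O x n') : n = n' := by
  obtain ⟨hn, r, hr, H⟩ := h
  obtain ⟨hn', r', hr', H'⟩ := h'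
  by_contra hne
  have h1 : inner ℝ n n' < (1 : ℝ) := inner_lt_one_iff_real_of_norm_eq_one hn hn' |>.2 hne
  have hlim : Tendsto (fun s : ℝ => x + s • (n' - n)) (𝓝[>] 0) (𝓝 x) := by
    have : Tendsto (fun s : ℝ => x + s • (n' - n)) (𝓝 0) (𝓝 (x + (0 : ℝ) • (n' - n))) :=
      Continuous.tendsto (by fun_prop) _
    rw [zero_smul, add_zero] at this
    exact this.mono_left nhdsWithin_le_nhds
  obtain ⟨s, hs, hs1, hs2⟩ := ((eventually_mem_nhdsWithin (a := (0 : ℝ)) (s := Ioi 0)).and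
    ((hlim.eventually (Metric.ball_mem_nhds x hr)).and
      (hlim.eventually (Metric.ball_mem_nhds x hr')))).exists
  have hs : (0 : ℝ) < s := hs
  have e1 := (H _ hs1).2 (by
    rw [add_sub_cancel_left, real_inner_smul_left, inner_sub_left, real_inner_self_eq_norm_sq, hn,
      real_inner_comm]
    nlinarith)
  have e2 := (H' _ hs2).1 e1
  rw [add_sub_cancel_left, real_inner_smul_left, inner_sub_left, real_inner_self_eq_norm_sq,
    hn'] at e2
  nlinarith

theorem outerNormal_eq {d : ℕ} {O : Set (Euc d)} {x n : Euc d} (h : IsOuterNormalAt O x n) :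
    outerNormal O x = n := by
  have hex : ∃ n, IsOuterNormalAt O x n := ⟨n, h⟩
  rw [outerNormal, dif_pos hex]
  exact hex.choose_spec.unique h

theorem norm_outerNormal_le {d : ℕ} (O : Set (Euc d)) (x : Euc d) : ‖outerNormal O x‖ ≤ 1 := by
  by_cases h : ∃ n, IsOuterNormalAt O x n
  · obtain ⟨n, hn⟩ := h
    rw [outerNormal_eq hn, hn.1]
  · rw [outerNormal, dif_neg h, norm_zero]
    exact zero_le_one

theorem IsOuterNormalAt.mem_frontier {d : ℕ} {O : Set (Euc d)} (hO : IsOpen O) {x n : Euc d}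
    (h : IsOuterNormalAt O x n) : x ∈ frontier O := by
  obtain ⟨hn, r, hr, H⟩ := h
  rw [hO.frontier_eq]
  refine ⟨?_, fun hx => by simpa using (H x (Metric.mem_ball_self hr)).1 hx⟩
  have hlim : Tendsto (fun s : ℝ => x + s • (-n)) (𝓝[>] 0) (𝓝 x) := by
    have : Tendsto (fun s : ℝ => x + s • (-n)) (𝓝 0) (𝓝 (x + (0 : ℝ) • (-n))) :=
      Continuous.tendsto (by fun_prop) _
    rw [zero_smul, add_zero] at this
    exact this.mono_left nhdsWithin_le_nhds
  refine mem_closure_of_tendsto hlim ?_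
  filter_upwards [self_mem_nhdsWithin, hlim.eventually (Metric.ball_mem_nhds x hr)] with s hs hs1
  refine (H _ hs1).2 ?_
  rw [add_sub_cancel_left, real_inner_smul_left, inner_neg_left, real_inner_self_eq_norm_sq, hn]
  have hs : (0 : ℝ) < s := hs
  linarith

theorem IsOuterNormalAt.eventually {d : ℕ} {O : Set (Euc d)} (hO : IsOpen O) {x n : Euc d}
    (h : IsOuterNormalAt O x n) : ∀ᶠ y in 𝓝 x, y ∈ frontier O → IsOuterNormalAt O y n := by
  obtain ⟨hn, r, hr, H⟩ := h
  filter_upwards [Metric.ball_mem_nhds x hr] with y hy hyO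
  have hc : Continuous fun z : Euc d => (inner ℝ (z - x) n : ℝ) := by fun_prop
  rw [hO.frontier_eq] at hyO
  have h0 : inner ℝ (y - x) n = (0 : ℝ) := by
    refine le_antisymm ?_ (not_lt.1 fun h => hyO.2 ((H y hy).2 h))
    by_contra! hpos
    have h1 : ∀ᶠ z in 𝓝 y, z ∉ O := by
      filter_upwards [Metric.isOpen_ball.mem_nhds hy,
        (isOpen_lt continuous_const hc).mem_nhds hpos] with z hz1 hz2 hzO
      exact absurd ((H z hz1).1 hzO) (not_lt.2 (le_of_lt hz2))
    obtain ⟨z, hz1, hz2⟩ := (mem_closure_iff_frequently.1 hyO.1).and_eventually h1 |>.exists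
    exact hz2 hz1
  obtain ⟨δ, hδ, hsub⟩ := Metric.isOpen_iff.1 Metric.isOpen_ball y hy
  refine ⟨hn, δ, hδ, fun z hz => ?_⟩
  rw [H z (hsub hz), ← sub_add_sub_cancel z y x, inner_add_left, h0, add_zero]

/-- The normal is locally constant along the boundary where it exists. Hence the preimage of any set
avoiding the default value `0` is relatively open in the frontier; sets containing `0` are handled
by complements. -/
theorem measurable_outerNormal {d : ℕ} {O : Set (Euc d)} (hO : IsOpen O) :
    Measurable (outerNormal O) := by
  have key : ∀ U : Set (Euc d), (0 : Euc d) ∉ U → MeasurableSet (outerNormal O ⁻¹' U) := by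
    intro U hU
    have e : outerNormal O ⁻¹' U
        = frontier O ∩ interior {y | y ∈ frontier O → outerNormal O y ∈ U} := by
      ext x
      refine ⟨fun hx => ?_, fun hx => interior_subset hx.2 hx.1⟩
      have hex : ∃ n, IsOuterNormalAt O x n := by
        by_contra h
        rw [mem_preimage, outerNormal, dif_neg h] at hx
        exact hU hx
      obtain ⟨n, hn⟩ := hex
      rw [mem_preimage, outerNormal_eq hn] at hx
      refine ⟨hn.mem_frontier hO, mem_interior_iff_mem_nhds.2 ?_⟩
      filter_upwards [hn.eventually hO] with y hy hyO
      rwa [outerNormal_eq (hy hyO)]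
    rw [e]
    exact isClosed_frontier.measurableSet.inter isOpen_interior.measurableSet
  refine measurable_of_isOpen fun U _ => ?_
  by_cases hU : (0 : Euc d) ∈ U
  · have e : outerNormal O ⁻¹' U = (outerNormal O ⁻¹' Uᶜ)ᶜ := by rw [preimage_compl, compl_compl]
    rw [e]
    exact (key _ (not_not.2 hU)).compl
  · exact key U hU

theorem exists_mul_normal {d : ℕ} {O S : Set (Euc d)} (hO : IsOpen O) (f : L2S S) (j : Fin d) :
    ∃ q : L2S S, (q =ᵐ[surface S] fun x => f x * outerNormal O x j) ∧ ‖q‖ ≤ ‖f‖ := by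
  have hm : Measurable fun x => outerNormal O x j := by
    have := measurable_outerNormal hO
    fun_prop
  have hb : ∀ x, ‖f x * outerNormal O x j‖ ≤ ‖f x‖ := fun x => by
    rw [norm_mul]
    exact mul_le_of_le_one_right (norm_nonneg _)
      ((PiLp.norm_apply_le _ j).trans (norm_outerNormal_le O x))
  have hL : MemLp (fun x => f x * outerNormal O x j) 2 (surface S) :=
    (Lp.memLp f).mono ((Lp.aestronglyMeasurable f).mul hm.aestronglyMeasurable)
      (Eventually.of_forall hb)
  refine ⟨hL.toLp, hL.coeFn_toLp, Lp.norm_le_norm_of_ae_le ?_⟩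
  filter_upwards [hL.coeFn_toLp] with x hx
  rw [hx]
  exact hb x

section Stokes

variable {m : ℕ} {ΩS ΩD : Set (Euc (m + 1))}

theorem exists_sum_mul_normal (hS : IsOpen ΩS) (t : Fin (m + 1) → L2S (frontier ΩS)) :
    ∃ q : L2S (interface ΩS ΩD),
      (∀ᵐ x ∂surface (interface ΩS ΩD), q x = ∑ j, t j x * outerNormal ΩS x j) ∧
      ‖q‖ ≤ ∑ j, ‖resL2 (interface_subset_stokes (ΩD := ΩD)) (t j)‖ := by
  choose q hq hqn using fun j =>
    exists_mul_normal hS (resL2 (interface_subset_stokes (ΩD := ΩD)) (t j)) j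
  refine ⟨∑ j, q j, ?_, (norm_sum_le _ _).trans (Finset.sum_le_sum fun j _ => hqn j)⟩
  have h1 : ∀ᵐ x ∂surface (interface ΩS ΩD), ∀ j, q j x = t j x * outerNormal ΩS x j := by
    refine ae_all_iff.2 fun j => ?_
    filter_upwards [hq j, resL2_coe (interface_subset_stokes (ΩD := ΩD)) (t j)] with x hx1 hx2
    rw [hx1, hx2]
  filter_upwards [h1, Lp.coeFn_finsetSum Finset.univ q] with x hx1 hx2
  rw [hx2, Finset.sum_apply]
  exact Finset.sum_congr rfl fun j _ => hx1 j

theorem exists_stokesNormalTrace (hS : IsOpen ΩS) {u : H1V ΩS} (hu : u ∈ H1S ΩS ΩD) :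
    ∃ g, IsStokesNormalTrace ΩS ΩD u g := by
  obtain ⟨t, ht⟩ := hu
  obtain ⟨q, hq, -⟩ := exists_sum_mul_normal (ΩD := ΩD) hS t
  exact ⟨q, t, fun j => (ht j).1, hq⟩

/-- The form with differences gives continuity and, for `u = u'`, uniqueness of the Stokes normal
trace. -/
theorem exists_stokesNormalTrace_bound {K : Geometry.SimplicialComplex ℝ (Euc (m + 1))} {κ : ℝ}
    (hS : IsPolyhedralLipschitzDomain ΩS) (hK : IsTriangulation ΩS (interface ΩS ΩD) K)
    (hκ : IsShapeRegular K κ) :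
    ∃ C ≥ 0, ∀ (u u' : H1V ΩS) (g g' : L2S (interface ΩS ΩD)), IsStokesNormalTrace ΩS ΩD u g →
      IsStokesNormalTrace ΩS ΩD u' g' → ‖g - g'‖ ≤ C * ‖u - u'‖ := by
  obtain ⟨C, hC0, hC⟩ := exists_trace_bound hS hK hκ interface_subset_stokes
  refine ⟨∑ _j : Fin (m + 1), C, by positivity, ?_⟩
  rintro u u' g g' ⟨t, ht, hg⟩ ⟨t', ht', hg'⟩
  obtain ⟨q, hq, hqn⟩ := exists_sum_mul_normal (ΩD := ΩD) hS.isOpen fun j => t j - t' j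
  have hsub : ∀ᵐ x ∂surface (interface ΩS ΩD), ∀ j, (t j - t' j : L2S (frontier ΩS)) x
      = t j x - t' j x :=
    ae_all_iff.2 fun j => ae_mono (surface_mono interface_subset_stokes) (Lp.coeFn_sub _ _)
  have e : g - g' = q := by
    refine Lp.ext ?_
    filter_upwards [hg, hg', hq, hsub, Lp.coeFn_sub g g'] with x h1 h2 h3 h4 h5
    rw [h5, Pi.sub_apply, h1, h2, h3, ← Finset.sum_sub_distrib]
    exact Finset.sum_congr rfl fun j _ => by rw [h4, sub_mul]
  rw [e, Finset.sum_mul]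
  refine hqn.trans (Finset.sum_le_sum fun j _ => ?_)
  have htr : HasTrace ΩS ((u - u') j) (t j - t' j) := Submodule.sub_mem _ (ht j) (ht' j)
  exact (hC _ _ htr).trans (mul_le_mul_of_nonneg_left (PiLp.norm_apply_le (u - u') j) hC0)

end Stokes

/-! ### Best approximation -/

theorem abs_greenPairing_le {d : ℕ} {O : Set (Euc d)} (v : Hdiv O) (w : H1 O) :
    |greenPairing O v w| ≤ ‖v‖ * ‖w‖ := by
  have hv : ‖v‖ ^ 2 = ‖v.1.fst‖ ^ 2 + ‖v.1.snd‖ ^ 2 := WithLp.prod_norm_sq_eq_of_L2 v.1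
  have hw : ‖w‖ ^ 2 = ‖w.1.fst‖ ^ 2 + ‖w.1.snd‖ ^ 2 := WithLp.prod_norm_sq_eq_of_L2 w.1
  have h1 := abs_real_inner_le_norm v.1.fst w.1.snd
  have h2 := abs_real_inner_le_norm v.1.snd w.1.fst
  refine (abs_add_le _ _).trans ((add_le_add h1 h2).trans ?_)
  refine abs_le_of_sq_le_sq' ?_ (by positivity) |>.2
  rw [mul_pow, hv, hw]
  nlinarith [sq_nonneg (‖v.1.fst‖ * ‖w.1.fst‖ - ‖v.1.snd‖ * ‖w.1.snd‖)]

theorem prod_norm_le_add {E F : Type*} [SeminormedAddCommGroup E] [SeminormedAddCommGroup F]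
    (z : WithLp 2 (E × F)) : ‖z‖ ≤ ‖z.fst‖ + ‖z.snd‖ := by
  refine abs_le_of_sq_le_sq' ?_ (by positivity) |>.2
  rw [WithLp.prod_norm_sq_eq_of_L2]
  nlinarith [norm_nonneg z.fst, norm_nonneg z.snd]

theorem norm_sub_starProjection_le {E : Type*} [NormedAddCommGroup E] [InnerProductSpace ℝ E]
    (U : Submodule ℝ E) [U.HasOrthogonalProjection] (x : E) {y : E} (hy : y ∈ U) :
    ‖x - U.starProjection x‖ ≤ ‖x - y‖ := by
  rw [U.starProjection_minimal]
  exact ciInf_le ⟨0, by rintro _ ⟨z, rfl⟩; exact norm_nonneg _⟩ (⟨y, hy⟩ : U)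

/-- Here `A` and `B` stand for the Stokes and Darcy errors and `r` for the weighted projection
error. -/
theorem approximation_constants_le {L M c A B r : ℝ} (hL : 0 ≤ L) (hM : 0 ≤ M) (hc : 0 ≤ c)
    (hA : 0 ≤ A) (hB : 0 ≤ B) (hr : 0 ≤ r) :
    A + (B + L * (M * A + c * r + B)) ≤ (1 + L * (M + c + 1)) * (A + B + r) := by
  have e : (1 + L * (M + c + 1)) * (A + B + r) - (A + (B + L * (M * A + c * r + B)))
      = r + L * (M * (B + r) + c * (A + B) + (A + r)) := by ring
  have e2 : 0 ≤ r + L * (M * (B + r) + c * (A + B) + (A + r)) := by positivity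
  linarith

/-! ### The coupling residual in the dual norm and the corrected discrete pair. -/

section

variable {m : ℕ} {ΩS ΩD : Set (Euc (m + 1))}

theorem IsZeroExtTrace.exists_hasTrace {w : H1 ΩD} {φ : L2S (interface ΩS ΩD)}
    (h : IsZeroExtTrace ΩS ΩD w φ) :
    ∃ t, HasTrace ΩD w t ∧ resL2 (interface_subset_darcy (ΩS := ΩS)) t = φ := by
  obtain ⟨t, ht, htφ, -⟩ := h
  exact ⟨t, ht, Lp.ext ((resL2_coe _ t).trans htφ)⟩

/-- The norm of `φ` is an infimum over extensions `w`, so an almost optimal `w` is used; dividing by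
`B + 1` avoids a separate case `B = 0`. -/
theorem h00DualNorm_le {ξ : L2S (interface ΩS ΩD)} {B : ℝ} (hB : 0 ≤ B)
    (h : ∀ w φ, IsZeroExtTrace ΩS ΩD w φ → |(inner ℝ ξ φ : ℝ)| ≤ B * ‖w‖) :
    h00DualNorm ΩS ΩD ξ ≤ B := by
  refine Real.sSup_le ?_ hB
  rintro _ ⟨φ, ⟨w₀, hw₀⟩, hφ, rfl⟩
  refine le_of_forall_pos_le_add fun ε hε => ?_
  have hδ : 0 < ε / (B + 1) := by positivity
  have hlt : h00Norm ΩS ΩD φ < 1 + ε / (B + 1) := hφ.trans_lt (lt_add_of_pos_right _ hδ)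
  have hne : {r | ∃ w, IsZeroExtTrace ΩS ΩD w φ ∧ r = ‖w‖}.Nonempty := ⟨‖w₀‖, w₀, hw₀, rfl⟩
  obtain ⟨_, ⟨w, hw, rfl⟩, hw1⟩ := exists_lt_of_csInf_lt hne hlt
  refine (h w φ hw).trans ((mul_le_mul_of_nonneg_left hw1.le hB).trans ?_)
  have : B * (ε / (B + 1)) ≤ (B + 1) * (ε / (B + 1)) := by gcongr; linarith
  have hcancel : (B + 1) * (ε / (B + 1)) = ε := mul_div_cancel₀ _ (by positivity)
  rw [mul_add, mul_one]
  exact add_le_add le_rfl (this.trans_eq hcancel)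

theorem RD_eq_self {V : Submodule ℝ (Hdiv ΩD)} {q : L2S (interface ΩS ΩD)}
    (hq : q ∈ PhiD ΩS ΩD V) : RD ΩS ΩD V q = q :=
  Submodule.starProjection_eq_self_iff.2 (Submodule.le_topologicalClosure _ hq)

theorem norm_sub_RD_le {V : Submodule ℝ (Hdiv ΩD)} (q : L2S (interface ΩS ΩD))
    {ψ : L2S (interface ΩS ΩD)} (hψ : ψ ∈ PhiD ΩS ΩD V) :
    ‖q - RD ΩS ΩD V q‖ ≤ ‖q - ψ‖ :=
  norm_sub_starProjection_le _ q (Submodule.le_topologicalClosure _ hψ)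

/-- This is the duality argument: the residual is orthogonal to the range of the projection, so `φ`
may be replaced by its own approximation error. -/
theorem inner_sub_RD {V : Submodule ℝ (Hdiv ΩD)} (q φ : L2S (interface ΩS ΩD)) :
    (inner ℝ (q - RD ΩS ΩD V q) φ : ℝ)
      = inner ℝ (q - RD ΩS ΩD V q) (φ - RD ΩS ΩD V φ) := by
  rw [inner_sub_right, RD, Submodule.starProjection_inner_eq_zero q _
    (Submodule.starProjection_apply_mem _ φ), sub_zero]

/-- The projection is the best approximation and piecewise constants are admissible competitors, so
the trace estimate yields the factor `√h`. -/
theorem norm_sub_RD_le_of_trace {K : Geometry.SimplicialComplex ℝ (Euc (m + 1))} {κ h : ℝ}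
    (hD : IsPolyhedralLipschitzDomain ΩD) (hK : IsTriangulation ΩD (interface ΩS ΩD) K)
    (hκ0 : 0 ≤ κ) (hκ : IsShapeRegular K κ) (hh : 0 ≤ h) (hsize : HasMeshSize K h)
    {V : Submodule ℝ (Hdiv ΩD)}
    (hP0 : ∀ φ : L2S (interface ΩS ΩD), IsPiecewiseConstant (interface ΩS ΩD) K φ →
      φ ∈ PhiD ΩS ΩD V)
    {w : H1 ΩD} {φ : L2S (interface ΩS ΩD)} (hw : IsZeroExtTrace ΩS ΩD w φ) :
    ‖φ - RD ΩS ΩD V φ‖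
      ≤ Real.sqrt (2 ^ (m + 2) * faceConst m κ) * Real.sqrt h * ‖w‖ := by
  obtain ⟨t, ht, rfl⟩ := hw.exists_hasTrace
  have h1 := infDist_piecewiseConstant_le hD hK hκ0 hκ hh hsize
    (interface_subset_darcy (ΩS := ΩS)) w t ht
  rw [Real.sqrt_mul (mul_nonneg (by positivity) (faceConst_nonneg _ hκ0))] at h1
  refine le_trans ?_ h1
  have h0 : IsPiecewiseConstant (interface ΩS ΩD) K 0 := fun e he =>
    ⟨0, ae_mono (surface_mono he.2.2) (Lp.coeFn_zero ℝ 2 (surface (interface ΩS ΩD)))⟩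
  refine (Metric.le_infDist ⟨0, h0⟩).2 fun ψ hψ => ?_
  rw [dist_eq_norm]
  exact norm_sub_RD_le _ (hP0 _ hψ)

theorem abs_inner_residual_le {V : Submodule ℝ (Hdiv ΩD)} {uD b : Hdiv ΩD}
    {g gD q : L2S (interface ΩS ΩD)} (hg : IsDarcyNormalTrace ΩS ΩD uD g)
    (hgD : IsDarcyNormalTrace ΩS ΩD b gD) {w : H1 ΩD} {φ : L2S (interface ΩS ΩD)}
    (hw : IsZeroExtTrace ΩS ΩD w φ) {C c l : ℝ} (hC : ‖φ‖ ≤ C * ‖w‖) (hc : 0 ≤ c) (hl : 0 ≤ l)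
    (hlam : RD ΩS ΩD V q = q ∨ ‖φ - RD ΩS ΩD V φ‖ ≤ c * l * ‖w‖) :
    |(inner ℝ (RD ΩS ΩD V q - gD) φ : ℝ)|
      ≤ (2 * C * ‖q - g‖ + c * (l * ‖g - RD ΩS ΩD V g‖) + ‖uD - b‖) * ‖w‖ := by
  set R := RD ΩS ΩD V with hR
  have hz : (0 : L2S (interface ΩS ΩD)) ∈ PhiD ΩS ΩD V := Submodule.zero_mem _
  have e1 : |(inner ℝ (g - gD) φ : ℝ)| ≤ ‖uD - b‖ * ‖w‖ := by
    have h1 := (hg.sub hgD) w φ hw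
    rw [← abs_neg, ← h1]
    exact abs_greenPairing_le _ _
  have e2 : |(inner ℝ (q - g) φ : ℝ)| ≤ ‖q - g‖ * (C * ‖w‖) :=
    (abs_real_inner_le_norm _ _).trans (mul_le_mul_of_nonneg_left hC (norm_nonneg _))
  have e3 : |(inner ℝ (q - R q) φ : ℝ)|
      ≤ ‖q - g‖ * (C * ‖w‖) + ‖g - R g‖ * (c * l * ‖w‖) := by
    have hC0 : 0 ≤ C * ‖w‖ := (norm_nonneg _).trans hC
    rcases hlam with h | h
    · rw [h, sub_self, inner_zero_left, abs_zero]
      positivity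
    · have hs : q - R q = ((q - g) - R (q - g)) + (g - R g) := by rw [map_sub]; abel
      rw [hs, inner_add_left]
      refine (abs_add_le _ _).trans (add_le_add ?_ ?_)
      · refine (abs_real_inner_le_norm _ _).trans (mul_le_mul ?_ hC (norm_nonneg _)
          (norm_nonneg _))
        simpa using norm_sub_RD_le (q - g) hz
      · rw [inner_sub_RD]
        exact (abs_real_inner_le_norm _ _).trans (mul_le_mul_of_nonneg_left h (norm_nonneg _))
  have hs : R q - gD = (q - g) + (g - gD) - (q - R q) := by abel
  rw [hs, inner_sub_left, inner_add_left]
  refine (abs_sub _ _).trans ((add_le_add (abs_add_le _ _) le_rfl).trans ?_)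
  linarith

theorem exists_Xh_dist_le {K : Geometry.SimplicialComplex ℝ (Euc (m + 1))} {κ h : ℝ}
    (hS : IsPolyhedralLipschitzDomain ΩS)
    (hD : IsPolyhedralLipschitzDomain ΩD) (hK : IsTriangulation ΩD (interface ΩS ΩD) K)
    (hκ0 : 0 ≤ κ) (hκ : IsShapeRegular K κ) (hh : 0 ≤ h) (hsize : HasMeshSize K h)
    {VS : Submodule ℝ (H1V ΩS)} {V : Submodule ℝ (Hdiv ΩD)} (hV : IsDarcyFE ΩD K V)
    (hP0 : ∀ φ : L2S (interface ΩS ΩD), IsPiecewiseConstant (interface ΩS ΩD) K φ →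
      φ ∈ PhiD ΩS ΩD V) {CL : ℝ} (hCL : 0 < CL)
    (L : PhiD ΩS ΩD V →ₗ[ℝ] darcyFE ΩS ΩD V)
    (hL : ∀ φ, IsDarcyNormalTrace ΩS ΩD (L φ : Hdiv ΩD) (φ : L2S (interface ΩS ΩD)) ∧
      ‖L φ‖ ≤ CL * h00DualNorm ΩS ΩD (φ : L2S (interface ΩS ΩD)))
    {CS CD : ℝ} (hCS : 0 ≤ CS) (hCD : 0 ≤ CD)
    (hCSb : ∀ (u u' : H1V ΩS) (g g' : L2S (interface ΩS ΩD)), IsStokesNormalTrace ΩS ΩD u g →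
      IsStokesNormalTrace ΩS ΩD u' g' → ‖g - g'‖ ≤ CS * ‖u - u'‖)
    (hCDb : ∀ (w : H1 ΩD) (t : L2S (frontier ΩD)), HasTrace ΩD w t →
      ‖resL2 (interface_subset_darcy (ΩS := ΩS)) t‖ ≤ CD * ‖w‖)
    {l : ℝ} (hl0 : 0 ≤ l) (hl : PhiS ΩS ΩD VS ⊆ PhiD ΩS ΩD V ∨ l = Real.sqrt h)
    {uS a : H1V ΩS} {uD b : Hdiv ΩD} {g : L2S (interface ΩS ΩD)}
    (hgS : IsStokesNormalTrace ΩS ΩD uS g) (hgD : IsDarcyNormalTrace ΩS ΩD uD g)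
    (ha : a ∈ stokesFE ΩS ΩD VS) (hb : b ∈ darcyFE ΩS ΩD V) :
    ∃ c, WithLp.toLp 2 (a, c) ∈ Xh ΩS ΩD VS V ∧
      ‖uD - c‖ ≤ ‖uD - b‖ + CL * (2 * CD * CS * ‖uS - a‖
        + Real.sqrt (2 ^ (m + 2) * faceConst m κ) * (l * ‖g - RD ΩS ΩD V g‖) + ‖uD - b‖) := by
  obtain ⟨q, hq⟩ := exists_stokesNormalTrace hS.isOpen ha.2
  obtain ⟨gb, hgb⟩ := exists_trace_of_mem_darcyFE (ΩS := ΩS) hD hK hV hb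
  -- The defect in the coupling condition, which the lifting corrects.
  let ξ : PhiD ΩS ΩD V := ⟨RD ΩS ΩD V q - gb,
    Submodule.sub_mem _ (RD_mem hD hK hV q) ⟨b, hb, hgb⟩⟩
  obtain ⟨hξ, hξn⟩ := hL ξ
  refine ⟨b + L ξ, ⟨ha, Submodule.add_mem _ hb (L ξ).2, q, hq, ?_⟩, ?_⟩
  · have h1 := hgb.add hξ
    rwa [show gb + (ξ : L2S (interface ΩS ΩD)) = RD ΩS ΩD V q from
      add_sub_cancel gb (RD ΩS ΩD V q)] at h1
  · have h1 : ‖uD - (b + L ξ)‖ ≤ ‖uD - b‖ + ‖(L ξ : Hdiv ΩD)‖ := by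
      rw [← sub_sub]
      exact norm_sub_le _ _
    refine h1.trans (add_le_add le_rfl (hξn.trans (mul_le_mul_of_nonneg_left ?_ hCL.le)))
    refine h00DualNorm_le (by positivity) fun w φ hw => ?_
    have hφ : ‖φ‖ ≤ CD * ‖w‖ := by
      obtain ⟨t, ht, rfl⟩ := hw.exists_hasTrace
      exact hCDb w t ht
    have hqg : ‖q - g‖ ≤ CS * ‖uS - a‖ := by
      rw [norm_sub_rev]
      exact hCSb _ _ _ _ hgS hq
    refine (abs_inner_residual_le hgD hgb hw hφ
      -- If `Φ^h_S ⊆ Φ^h_D`, then `q` is its own projection and no power of `h` is needed; otherwise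
      -- `l = √h`.
      (Real.sqrt_nonneg (2 ^ (m + 2) * faceConst m κ)) hl0 (hl.imp
      (fun hsub => RD_eq_self (hsub ⟨a, ha, hq⟩)) fun h => ?_)).trans
        (mul_le_mul_of_nonneg_right ?_ (norm_nonneg _))
    · rw [h]
      exact norm_sub_RD_le_of_trace hD hK hκ0 hκ hh hsize hP0 hw
    · have : 2 * CD * ‖q - g‖ ≤ 2 * CD * (CS * ‖uS - a‖) := by gcongr
      linarith

theorem infDist_Xh_le {VS : Submodule ℝ (H1V ΩS)} {V : Submodule ℝ (Hdiv ΩD)}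
    {u : WithLp 2 (H1V ΩS × Hdiv ΩD)} {C r : ℝ} (hC : 0 ≤ C)
    (H : ∀ a ∈ stokesFE ΩS ΩD VS, ∀ b ∈ darcyFE ΩS ΩD V, ∃ c,
      WithLp.toLp 2 (a, c) ∈ Xh ΩS ΩD VS V ∧
      ‖u.fst - a‖ + ‖u.snd - c‖ ≤ C * (‖u.fst - a‖ + ‖u.snd - b‖ + r)) :
    Metric.infDist u (Xh ΩS ΩD VS V) ≤ C * (Metric.infDist u.fst (stokesFE ΩS ΩD VS)
      + Metric.infDist u.snd (darcyFE ΩS ΩD V) + r) := by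
  have hS0 : (stokesFE ΩS ΩD VS).Nonempty := by
    refine ⟨0, Submodule.zero_mem _, 0, fun j => ⟨Submodule.zero_mem _, ?_⟩⟩
    exact ae_mono (surface_mono sdiff_subset) (Lp.coeFn_zero ℝ 2 (surface (frontier ΩS)))
  have hD0 : (darcyFE ΩS ΩD V : Set (Hdiv ΩD)).Nonempty := ⟨0, Submodule.zero_mem _⟩
  refine le_of_forall_pos_le_add fun ε hε => ?_
  obtain ⟨δ, hδ, hδε⟩ : ∃ δ > 0, C * (2 * δ) ≤ ε := by
    refine ⟨ε / (2 * (C + 1)), by positivity, ?_⟩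
    have h1 : C * (2 * (ε / (2 * (C + 1)))) = C / (C + 1) * ε := by field_simp
    rw [h1]
    exact mul_le_of_le_one_left hε.le ((div_le_one (by positivity)).2 (by linarith))
  obtain ⟨a, ha, ha'⟩ := (Metric.infDist_lt_iff hS0).1 (lt_add_of_pos_right _ hδ)
  obtain ⟨b, hb, hb'⟩ := (Metric.infDist_lt_iff hD0).1 (lt_add_of_pos_right _ hδ)
  obtain ⟨c, hc, hle⟩ := H a ha b hb
  rw [dist_eq_norm] at ha' hb'
  refine (Metric.infDist_le_dist_of_mem hc).trans ?_
  rw [dist_eq_norm]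
  refine (prod_norm_le_add _).trans (le_trans hle ?_)
  have h1 : C * (‖u.fst - a‖ + ‖u.snd - b‖ + r)
      ≤ C * (Metric.infDist u.fst (stokesFE ΩS ΩD VS)
        + Metric.infDist u.snd (darcyFE ΩS ΩD V) + r + 2 * δ) :=
    mul_le_mul_of_nonneg_left (by linarith) hC
  linarith

end

end StokesDarcy

/-! ### The quasi-optimality estimate. -/

theorem mainTheorem5 {d : ℕ} (hd : d = 2 ∨ d = 3)
    (Ω ΩS ΩD : Set (EuclideanSpace ℝ (Fin d))) (hΩ : IsSubdivision Ω ΩS ΩD)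
    {ι : Type*} (h : ι → ℝ) (hpos : ∀ i, 0 < h i)
    (TS TD : ι → Geometry.SimplicialComplex ℝ (EuclideanSpace ℝ (Fin d)))
    (hTS : ∀ i, IsTriangulation ΩS (interface ΩS ΩD) (TS i))
    (hTD : ∀ i, IsTriangulation ΩD (interface ΩS ΩD) (TD i))
    (hTSsize : ∀ i, HasMeshSize (TS i) (h i)) (hTDsize : ∀ i, HasMeshSize (TD i) (h i))
    (hTSreg : IsRegularFamily TS) (hTDreg : IsRegularFamily TD)
    (VS : ι → Submodule ℝ (H1V ΩS)) (VD : ι → Submodule ℝ (Hdiv ΩD))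
    (hVS : ∀ i, IsStokesFE ΩS (TS i) (VS i)) (hVD : ∀ i, IsDarcyFE ΩD (TD i) (VD i))
    (hP0 : ∀ i, ∀ φ : L2S (interface ΩS ΩD),
      IsPiecewiseConstant (interface ΩS ΩD) (TD i) φ → φ ∈ PhiD ΩS ΩD (VD i))
    (hlift : HasStableLifting ΩS ΩD VD) :
    ∃ C > 0, ∃ lam : ι → ℝ,
      (∀ i, 0 ≤ lam i ∧ lam i ≤ C * Real.sqrt (h i)) ∧
      (∀ i, PhiS ΩS ΩD (VS i) ⊆ PhiD ΩS ΩD (VD i) → lam i = 0) ∧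
      ∀ i, ∀ u ∈ X ΩS ΩD, ∀ g, IsStokesNormalTrace ΩS ΩD u.fst g →
        Metric.infDist u (Xh ΩS ΩD (VS i) (VD i)) ≤
          C * (Metric.infDist u.fst (stokesFE ΩS ΩD (VS i))
            + Metric.infDist u.snd (darcyFE ΩS ΩD (VD i))
            + lam i * ‖g - RD ΩS ΩD (VD i) g‖) := by
  obtain ⟨m, rfl⟩ : ∃ m, d = m + 1 := by
    rcases hd with rfl | rfl
    exacts [⟨1, rfl⟩, ⟨2, rfl⟩]
  -- The trace constants come from the triangulations of one fixed index `i₀`, hence do not depend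
  -- on `h`; the empty family has to be set aside.
  rcases isEmpty_or_nonempty ι with hι | ⟨⟨i₀⟩⟩
  · exact ⟨1, one_pos, fun _ => 0, fun i => hι.elim i, fun i => hι.elim i, fun i => hι.elim i⟩
  classical
  obtain ⟨κS, hκS⟩ := hTSreg
  obtain ⟨κ', hκ'⟩ := hTDreg
  obtain ⟨κ, hκ0, hκ⟩ : ∃ κ : ℝ, 0 ≤ κ ∧ ∀ i, IsShapeRegular (TD i) κ := by
    refine ⟨max κ' 0, le_max_right _ _, fun i T hT hc => ?_⟩
    obtain ⟨c, ρ, hρ, hb, hdiam⟩ := hκ' i T hT hc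
    exact ⟨c, ρ, hρ, hb, hdiam.trans (mul_le_mul_of_nonneg_right (le_max_left _ _) hρ.le)⟩
  obtain ⟨CL, hCL, hLift⟩ := hlift
  obtain ⟨CS, hCS, hCSb⟩ := exists_stokesNormalTrace_bound hΩ.stokes (hTS i₀) (hκS i₀)
  obtain ⟨CD, hCD, hCDb⟩ := exists_trace_bound hΩ.darcy (hTD i₀) (hκ i₀)
    (interface_subset_darcy (ΩS := ΩS))
  set c := Real.sqrt (2 ^ (m + 2) * faceConst m κ) with hc
  have hc0 : 0 ≤ c := Real.sqrt_nonneg _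
  refine ⟨1 + CL * (2 * CD * CS + c + 1), by positivity,
    fun i => if PhiS ΩS ΩD (VS i) ⊆ PhiD ΩS ΩD (VD i) then 0 else Real.sqrt (h i),
    fun i => ?_, fun i hi => if_pos hi, fun i u hu g hg => ?_⟩
  · have h1 : Real.sqrt (h i) ≤ (1 + CL * (2 * CD * CS + c + 1)) * Real.sqrt (h i) :=
      le_mul_of_one_le_left (Real.sqrt_nonneg _) (le_add_of_nonneg_right (by positivity))
    dsimp only
    split_ifs
    · exact ⟨le_rfl, by positivity⟩
    · exact ⟨Real.sqrt_nonneg _, h1⟩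
  · set l := if PhiS ΩS ΩD (VS i) ⊆ PhiD ΩS ΩD (VD i) then 0 else Real.sqrt (h i) with hl
    have hl0 : 0 ≤ l := by
      rw [hl]
      split_ifs
      exacts [le_rfl, Real.sqrt_nonneg _]
    have hl' : PhiS ΩS ΩD (VS i) ⊆ PhiD ΩS ΩD (VD i) ∨ l = Real.sqrt (h i) :=
      or_iff_not_imp_left.2 fun hn => if_neg hn
    obtain ⟨-, -, g', hg'S, hg'D⟩ := hu
    -- The normal trace in the estimate and the one in the definition of `𝕏` must coincide, since
    -- the argument needs `g` to be the Darcy normal trace as well.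
    have hgg : g = g' := by
      have := hCSb _ _ _ _ hg hg'S
      rw [sub_self, norm_zero, mul_zero] at this
      exact sub_eq_zero.1 (norm_le_zero_iff.1 this)
    subst hgg
    obtain ⟨L, hL⟩ := hLift i
    refine infDist_Xh_le (by positivity) fun a ha b hb => ?_
    obtain ⟨c', hc', hle⟩ := exists_Xh_dist_le hΩ.stokes hΩ.darcy (hTD i) hκ0 (hκ i) (hpos i).le
      (hTDsize i) (hVD i) (hP0 i) hCL L hL hCS hCD hCSb hCDb hl0 hl' hg hg'D ha hb
    exact ⟨c', hc', (add_le_add le_rfl hle).trans (approximation_constants_le hCL.le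
      (by positivity) hc0 (norm_nonneg _) (norm_nonneg _) (mul_nonneg hl0 (norm_nonneg _)))⟩
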